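/- Let $\mathfrak g$ be a finite-dimensional complex simple Lie algebra with Cartan subalgebra $\mathfrak t$, root system $\Delta$, simple roots $\Pi\subset\Delta^+$, Borel subalgebra $\mathfrak b=\mathfrak t\oplus\bigoplus_{\gamma\in\Delta^+}\mathfrak g_\gamma$, Weyl group $W$, $W$-invariant inner product $(\ ,\ )$, and highest root $\theta$. Put $\mathcal H=\{\gamma\in\Delta^+\mid(\gamma,\theta)\neq0\}$. Let $\widehat V=V\oplus\mathbb R\delta\oplus\mathbb R\lambda$, where $V$ is the real span of $\Delta$, with the form extended by $(\delta,V)=(\lambda,V)=(\delta,\delta)=(\lambda,\lambda)=0$, $(\delta,\lambda)=1$. Let $\widehat\Delta^+=\Delta^+\cup\{\gamma+k\delta\mid\gamma\in\Delta,\ k\ge1\}$, and let $\widehat W\subset GL(\widehat V)$ be the affine Weyl group, generated by the reflections in $\Pi\cup\{\delta-\theta\}$. For an abelian ideal $\mathfrak a\ne0$ of $\mathfrak b$, with set of roots $I_{\mathfrak a}=\{\gamma\in\Delta^+\mid\mathfrak g_\gamma\subset\mathfrak a\}$, let $w_{\mathfrak a}\in\widehat W$ be the (unique) element with $\{\nu\in\widehat\Delta^+\mid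 w_{\mathfrak a}(\nu)\in-\widehat\Delta^+\}=\{\delta-\gamma\mid\gamma\in I_{\mathfrak a}\}$; the rootlet of $\mathfrak a$ is $\tau(\mathfrak a)=w_{\mathfrak a}(2\delta-\theta)$, a long positive root. Let $\tilde\alpha\in\Pi$ be a long simple root (a root is long if it has maximal length, so all roots are long if they have the same length). Then, among the nonzero abelian ideals of $\mathfrak b$ with rootlet $\tilde\alpha$, there are a smallest one $\mathfrak a(\tilde\alpha)_{min}$ and a largest one $\mathfrak a(\tilde\alpha)_{max}$ with respect to inclusion, and there is an element of $W$ taking $\theta$ to $\tilde\alpha$. Let $\tilde w$ be such an element of $W$ of minimal length. Let $\Pi[\tilde\alpha]_{min}$ and $\Pi[\tilde\alpha]_{max}$ be the sets of simple roots of the standard Levi subalgebras of the normalisers in $\mathfrak g$ of $\mathfrak a(\tilde\alpha)_{min}$ and $\mathfrak a(\tilde\alpha)_{max}$. (i) Unless $\Delta$ is of type $A_n$ with $\tilde\alpha=\alpha_1$ or $\tilde\alpha=\alpha_n$ (standard numbering), $$\Pi[\tilde\alpha]_{max}=(\Pi\cap\mathcal H)\sqcup\{\tilde w^{-1}(\beta)\mid\beta\in\Pi,\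 (\beta,\tilde\alpha)=0\}.$$ (ii) If $(\theta,\tilde\alpha)=0$, then $\Pi[\tilde\alpha]_{max}=(\Pi\cap\mathcal H)\sqcup\Pi[\tilde\alpha]_{min}$. (iii) If $\theta$ is a fundamental weight and $(\theta,\tilde\alpha)\neq0$, then $$\Pi[\tilde\alpha]_{max}=\Pi[\tilde\alpha]_{min}=\{\tilde\alpha\}\sqcup\{\beta\in\Pi\mid(\beta,\tilde\alpha)=0\}.$$ Here $\sqcup$ denotes a union of disjoint sets. -/

import Mathlib

open LieAlgebra LieAlgebra.IsKilling Module

namespace AbIdeal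

section Combinatorics

variable {ι K M N : Type*} [Fintype ι] [Field K] [CharZero K] [AddCommGroup M] [Module K M]
  [AddCommGroup N] [Module K N] {P : RootPairing ι K M N}

/-- The canonical Weyl-invariant symmetric bilinear form on the ambient space of the roots,
`(x, y) = ∑ γ, ⟨x, γ^∨⟩ ⟨y, γ^∨⟩`. It is positive definite on the real span of the roots. -/
noncomputable def ip (P : RootPairing ι K M N) (x y : M) : K := P.RootForm x y

/-- The set of simple roots, as vectors. -/
def simpleRoots (b : P.Base) : Set M := P.root '' (b.support : Set ι)

/-- The root `θ` is the highest root: for every root `γ`, the difference `θ - γ` is a non-negative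
integral combination of simple roots. -/
def IsHighestRoot (b : P.Base) (θ : ι) : Prop :=
  ∀ γ : ι, P.root θ - P.root γ ∈ AddSubmonoid.closure (simpleRoots b)

/-- A root is long if its squared length is maximal among all roots (so every root is long
when all roots have the same length). -/
def IsLong (P : RootPairing ι K M N) [P.IsCrystallographic] (μ : ι) : Prop :=
  ∀ γ : ι, (P.posRootForm ℤ).rootLength γ ≤ (P.posRootForm ℤ).rootLength μ

/-- `θ` is a fundamental weight: it pairs to `1` with one simple coroot and to `0` with all the
other simple coroots. -/
def IsFundamental (b : P.Base) (θ : ι) : Prop :=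
  ∃ i ∈ b.support, P.pairing θ i = 1 ∧ ∀ j ∈ b.support, j ≠ i → P.pairing θ j = 0

/-- The root system is of type `A_n` for some `n`, and, in the standard numbering
`α_1, …, α_n` of the simple roots, the root `α` is `α_1` or `α_n`. -/
def IsEndOfTypeA [P.IsCrystallographic] (b : P.Base) (α : ι) : Prop :=
  ∃ (n : ℕ) (e : Fin n ≃ b.support),
    (∀ i j, b.cartanMatrix (e i) (e j) = CartanMatrix.A n i j) ∧
    ∃ i : Fin n, ((e i : b.support) : ι) = α ∧ (i.val = 0 ∨ i.val + 1 = n)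

/-- The set `𝓗` of positive roots that are not orthogonal to `θ`, as vectors. -/
def nonOrthogonal (b : P.Base) (θ : ι) : Set M :=
  {x | ∃ γ : ι, b.IsPos γ ∧ ip P (P.root γ) (P.root θ) ≠ 0 ∧ x = P.root γ}

/-! ### The finite Weyl group -/

/-- The Weyl group, as the group of linear automorphisms generated by the simple reflections. -/
def weyl (b : P.Base) : Subgroup (M ≃ₗ[K] M) :=
  Subgroup.closure {s | ∃ i ∈ b.support, s = P.reflection i}

/-- The length of an element of the Weyl group: the least number of factors in an expression as a
product of simple reflections. -/
noncomputable def length (b : P.Base) (w : M ≃ₗ[K] M) : ℕ :=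
  sInf {k | ∃ l : List b.support, l.length = k ∧ (l.map fun i ↦ P.reflection (i : ι)).prod = w}

/-- `w` is an element of minimal length among those elements of the Weyl group that take the
root `θ` to the root `μ`. -/
def IsShortestTo (b : P.Base) (θ μ : ι) (w : M ≃ₗ[K] M) : Prop :=
  w ∈ weyl b ∧ w (P.root θ) = P.root μ ∧
    ∀ w' ∈ weyl b, w' (P.root θ) = P.root μ → length b w ≤ length b w'

/-- The set of all `w⁻¹(β)`, where `β` runs over the simple roots orthogonal to the root `μ`. -/
def transported (b : P.Base) (μ : ι) (w : M ≃ₗ[K] M) : Set M :=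
  {x | ∃ β ∈ b.support, ip P (P.root β) (P.root μ) = 0 ∧ x = w.symm (P.root β)}

/-! ### The affine Weyl group -/

variable (K M) in
/-- The space `V ⊕ Kδ ⊕ Kλ`: the triple `(v, s, t)` stands for `v + s δ + t λ`. (Over `K = ℂ`
this is the complexification of the usual real space; the affine Weyl group is generated by the
same reflections in affine roots.) -/
abbrev AffSpace : Type _ := M × K × K

/-- The extension of the invariant form to `V ⊕ Kδ ⊕ Kλ`, with
`(δ, V) = (λ, V) = (δ, δ) = (λ, λ) = 0` and `(δ, λ) = 1`. -/
noncomputable def affIp (P : RootPairing ι K M N) (x y : AffSpace K M) : K :=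
  ip P x.1 y.1 + x.2.1 * y.2.2 + x.2.2 * y.2.1

/-- The vector `γ + k δ`, for a root `γ` and an integer `k`; these are the affine real roots. -/
def affRoot (P : RootPairing ι K M N) (γ : ι) (k : ℤ) : AffSpace K M := (P.root γ, (k : K), 0)

/-- The positive affine roots: `γ + k δ` with `k ≥ 1`, or with `k = 0` and `γ` positive. -/
def affPos (b : P.Base) : Set (AffSpace K M) :=
  {x | ∃ (γ : ι) (k : ℤ), ((k = 0 ∧ b.IsPos γ) ∨ 1 ≤ k) ∧ x = affRoot P γ k}

/-- The affine simple roots: the simple roots, and `α₀ = δ - θ`. -/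
def affSimple (b : P.Base) (θ : ι) : Set (AffSpace K M) :=
  {x | ∃ i ∈ b.support, x = affRoot P i 0} ∪ {(-P.root θ, 1, 0)}

/-- The affine Weyl group: the group of linear automorphisms of `V ⊕ Kδ ⊕ Kλ` generated by the
reflections `x ↦ x - (x, a) a^∨`, with `a^∨ = 2 a / (a, a)`, in the affine simple roots `a`. -/
def affWeyl (b : P.Base) (θ : ι) : Subgroup (AffSpace K M ≃ₗ[K] AffSpace K M) :=
  Subgroup.closure {s | ∃ a ∈ affSimple b θ, ∀ x, s x = x - affIp P x a • (2 / affIp P a a) • a}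

/-- The inversion set of `w`: the positive affine roots that `w` makes negative. -/
def inversions (b : P.Base) (w : AffSpace K M ≃ₗ[K] AffSpace K M) : Set (AffSpace K M) :=
  {x | x ∈ affPos b ∧ -(w x) ∈ affPos b}

/-- `w` is the minuscule element of the affine Weyl group attached to a set `I` of roots: its
inversion set is `{δ - γ | γ ∈ I}`. -/
def IsMinuscule (b : P.Base) (θ : ι) (I : Set ι) (w : AffSpace K M ≃ₗ[K] AffSpace K M) : Prop :=
  w ∈ affWeyl b θ ∧ inversions b w = {x | ∃ γ ∈ I, x = (-P.root γ, 1, 0)}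

/-- The root `μ` is the rootlet of the set of roots `I`: one has `w (2δ - θ) = μ` for the
minuscule element `w` attached to `I`. -/
def IsRootlet (b : P.Base) (θ : ι) (I : Set ι) (μ : ι) : Prop :=
  ∃ w, IsMinuscule b θ I w ∧ w (-P.root θ, 2, 0) = affRoot P μ 0

end Combinatorics

section LieTheory

variable {K L : Type*} [Field K] [CharZero K] [LieRing L] [LieAlgebra K L]
  [FiniteDimensional K L] [IsKilling K L] {H : LieSubalgebra K L} [H.IsCartanSubalgebra]
  [LieModule.IsTriangularizable K H L]

/-- The underlying subspace of the standard Borel subalgebra. -/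
def borelSubmodule (b : (rootSystem H).Base) : Submodule K L :=
  H.toSubmodule ⊔ ⨆ γ : {γ : H.root // b.IsPos γ}, (rootSpace H γ.1.1).toSubmodule

lemma borelSubmodule_lie_mem (b : (rootSystem H).Base) {x y : L} (hx : x ∈ borelSubmodule b)
    (hy : y ∈ borelSubmodule b) : ⁅x, y⁆ ∈ borelSubmodule b := by
  have hH : ∀ z ∈ H, z ∈ borelSubmodule b := fun z hz ↦ Submodule.mem_sup_left hz
  have hR : ∀ (γ : H.root), b.IsPos γ → ∀ z ∈ rootSpace H γ.1, z ∈ borelSubmodule b :=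
    fun γ hγ z hz ↦ Submodule.mem_sup_right
      (Submodule.mem_iSup_of_mem (⟨γ, hγ⟩ : {γ : H.root // b.IsPos γ}) hz)
  have key : ∀ z ∈ borelSubmodule b, ∀ p : L → Prop, (∀ h ∈ H, p h) →
      (∀ γ : H.root, b.IsPos γ → ∀ e ∈ rootSpace H γ.1, p e) → p 0 →
      (∀ u v, p u → p v → p (u + v)) → p z := by
    intro z hz p h1 h2 h0 ha
    obtain ⟨u, hu, v, hv, rfl⟩ := Submodule.mem_sup.mp hz
    clear hz
    refine ha _ _ (h1 u hu) ?_
    induction hv using Submodule.iSup_induction' with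
    | mem γ e he => exact h2 γ.1 γ.2 e he
    | zero => exact h0
    | add u v _ _ hu hv => exact ha _ _ hu hv
  refine key x hx (fun x ↦ ⁅x, y⁆ ∈ borelSubmodule b) (fun h hh ↦ ?_) (fun γ hγ e he ↦ ?_)
    (by simp) (fun u v hu hv ↦ by simpa using add_mem hu hv)
  · refine key y hy (fun y ↦ ⁅h, y⁆ ∈ borelSubmodule b) (fun h' hh' ↦ hH _ (H.lie_mem hh hh'))
      (fun γ hγ e he ↦ ?_) (by simp) (fun u v hu hv ↦ by simpa using add_mem hu hv)
    exact hR γ hγ _ ((rootSpace H γ.1).lie_mem (x := ⟨h, hh⟩) he)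
  · refine key y hy (fun y ↦ ⁅e, y⁆ ∈ borelSubmodule b) (fun h hh ↦ ?_) (fun γ' hγ' e' he' ↦ ?_)
      (by simp) (fun u v hu hv ↦ by simpa using add_mem hu hv)
    · rw [← lie_skew]
      exact neg_mem (hR γ hγ _ ((rootSpace H γ.1).lie_mem (x := ⟨h, hh⟩) he))
    · have hs := lie_mem_genWeightSpace_of_mem_genWeightSpace he he'
      by_cases hz : ⁅e, e'⁆ = 0
      · rw [hz]; exact zero_mem _
      have hne : rootSpace H ((γ.1 : H → K) + (γ'.1 : H → K)) ≠ ⊥ := by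
        intro hbot
        have hs' : ⁅e, e'⁆ ∈ rootSpace H ((γ.1 : H → K) + (γ'.1 : H → K)) := hs
        rw [hbot] at hs'
        exact hz (by simpa using hs')
      let χ : LieModule.Weight K H L := ⟨(γ.1 : H → K) + (γ'.1 : H → K), hne⟩
      by_cases hχ : χ.IsZero
      · exfalso
        have e0 : (rootSystem H).root γ + (rootSystem H).root γ' = 0 := by
          ext h
          exact congrFun hχ h
        let := (rootSystem H).indexNeg
        have hn : γ' = -γ := by
          apply (rootSystem H).root.injective
          rw [RootPairing.indexNeg_neg, RootPairing.root_reflectionPerm,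
            RootPairing.reflection_apply_self]
          exact (neg_eq_of_add_eq_zero_right e0).symm
        rw [hn, RootPairing.Base.IsPos.neg_iff_not] at hγ'
        exact hγ' hγ
      · refine hR ⟨χ, by simpa using hχ⟩ (hγ.add hγ' ?_) _ hs
        ext h
        rfl

/-- The standard Borel subalgebra attached to a base: the sum of the Cartan subalgebra and the root
spaces of the positive roots. -/
def borel (b : (rootSystem H).Base) : LieSubalgebra K L :=
  { borelSubmodule b with lie_mem' := borelSubmodule_lie_mem b }

/-- `𝔞` is an abelian ideal of the standard Borel subalgebra. -/
def IsAbelianIdeal (b : (rootSystem H).Base) (𝔞 : LieSubalgebra K L) : Prop :=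
  𝔞 ≤ borel b ∧ (∀ x ∈ borel b, ∀ y ∈ 𝔞, ⁅x, y⁆ ∈ 𝔞) ∧ ∀ x ∈ 𝔞, ∀ y ∈ 𝔞, ⁅x, y⁆ = 0

/-- The positive roots whose root spaces lie in `𝔞`. -/
def rootsOf (b : (rootSystem H).Base) (𝔞 : LieSubalgebra K L) : Set H.root :=
  {γ | b.IsPos γ ∧ (rootSpace H γ.1).toSubmodule ≤ 𝔞.toSubmodule}

/-- The set of nonzero abelian ideals of the Borel subalgebra with rootlet `μ`. -/
def fibre (b : (rootSystem H).Base) (θ μ : H.root) : Set (LieSubalgebra K L) :=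
  {𝔞 | IsAbelianIdeal b 𝔞 ∧ 𝔞 ≠ ⊥ ∧ IsRootlet b θ (rootsOf b 𝔞) μ}

/-- The simple roots of the standard Levi subalgebra of a standard parabolic subalgebra `𝔭`. The
roots of the standard Levi subalgebra of `𝔭` are the roots `γ` such that the root spaces of `γ`
and of `-γ` both lie in `𝔭`. -/
def leviSimpleRoots (b : (rootSystem H).Base) (𝔭 : LieSubalgebra K L) : Set (Dual K H) :=
  {x | ∃ γ ∈ b.support, (rootSpace H γ.1).toSubmodule ≤ 𝔭.toSubmodule ∧
    (rootSpace H (-(γ.1 : H → K))).toSubmodule ≤ 𝔭.toSubmodule ∧ x = (rootSystem H).root γ}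

end LieTheory

end AbIdeal

/-!
The proof transfers the whole question to the lattice spanned by the affine simple roots, where a
root is positive exactly when its coordinates are non-negative (`AffineSystem`, `latticeModel`).
An abelian ideal of the Borel subalgebra is the sum of its root spaces, so ideals are compared
through their sets of roots (`IsAbelianIdeal.le_iff`), and the ideals with rootlet `α` correspond to
the elements `w` of the affine Weyl group that take the finite simple roots to positive roots and
`2δ - θ` to `α` (`isRootlet_iff`, `exists_mem_fibre`); the roots of the ideal are the `γ` for which
`w` makes `δ - γ` negative.

Let `v` be the shortest element of the finite Weyl group taking `θ` to `α`. Every such `w` factors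
as `u v s₀`, with `s₀` the reflection in `α₀ = δ - θ` and `u` in the parabolic subgroup generated by
the reflections in the affine simple roots orthogonal to `α` (`IsFib.exists_factor`). The element
`v s₀` itself has the smallest inversion set, which gives the smallest ideal. Conversely, let `w`
have a maximal inversion set. Then for each affine simple root `β ≠ α` one has
`w⁻¹ β = γ + m δ` with `γ` finite and `m ≤ 0`, and `γ` is simple if `m = 0`; otherwise multiplying
`w` by the reflection in `β` would enlarge the inversion set (`IsMax.inv_sr`). It follows that the
inversion set of `w` is the largest one (`IsMax.map_nonpos`).

The root space of `-αᵢ` normalises the ideal attached to `w` exactly when `w αᵢ` is an affine simple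
root (`leviSimpleRoots_normalizer`), so it remains to find the simple roots that the smallest and the
largest `w` take to affine simple roots. For simple roots orthogonal to `θ` both conditions amount
to `v αᵢ` being simple (`IsFib.map_simple_of_map`, `IsMax.map_simple`). For those not orthogonal to
`θ` the smallest `w` takes none to a simple root if `α` is orthogonal to `θ`
(`IsShort.not_map_simple`). For the largest `w`, write `δ = ∑ cₛ βₛ` over the affine simple roots
`βₛ`, apply `w⁻¹` and compare the coefficients of `δ`, and use `⟨δ, α^∨⟩ = 0`: with `mₛ` the
coefficient of `δ` in `w⁻¹ βₛ` this gives `∑ cₛ (mₛ - ⟨βₛ, α^∨⟩) = 1`, and a term is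
positive only if `mₛ = 0` and `⟨βₛ, α^∨⟩ = -1`. There is such an `s`, and then `w⁻¹ βₛ` is a simple
root not orthogonal to `θ` (`IsMax.exists_map_simple`). If there is only one simple root not
orthogonal to `θ`, this settles the matter. If there are two, then the sum of the simple roots along
a path joining them in the Dynkin diagram is a root pairing to at least `2` with the coroot of `θ`, hence
is `θ`, and the root system is of type `A` with the two roots at the ends (`isEndOfTypeA_of_form_ne`).
All `cₛ` are then one, and a negative term in the sum above, which exists if `α` is orthogonal to
`θ`, forces two positive ones (`IsMax.exists_two_map_simple`). If `α` is not orthogonal to `θ`, then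
`u = 1` and there is only one `w` (`IsFib.eq_of_not_orthogonal`).
-/

set_option linter.unusedSectionVars false

namespace AbIdeal

/-! ### A lattice model of an untwisted affine root system -/

/-- A lattice model of an untwisted affine root system, in coordinates with respect to the affine
simple roots: the simple roots are indexed by `some i`, `i : S`, the additional affine simple root
`α₀` by `none`, and the basis vector `Pi.single t 1` is the simple root with index `t`. Hence a
vector is positive exactly when all its coordinates are non-negative. The vector `imag` is the
basic imaginary root `δ`, so that `δ - α₀` is the highest root `θ`; the affine real
roots are the `γ + k δ` with `γ` in `finRoots`. The last axiom expresses that `θ` is long: a finite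
root other than `±θ` pairs to `0` or `±1` with the coroot of `θ`, which is `-co none`. -/
structure AffineSystem (S : Type*) [Fintype S] [DecidableEq S] where
  /-- The finite roots. -/
  finRoots : Set (Option S → ℤ)
  /-- The basic imaginary root `δ`. -/
  imag : Option S → ℤ
  /-- The invariant form; its radical contains `δ`. -/
  form : LinearMap.BilinForm ℤ (Option S → ℤ)
  /-- The simple coroots. -/
  co : Option S → Dual ℤ (Option S → ℤ)
  imag_none : imag none = 1
  one_le_imag : ∀ t, 1 ≤ imag t
  form_imag : ∀ x, form imag x = 0
  form_comm : ∀ x y, form x y = form y x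
  two_form : ∀ t x, 2 * form x (Pi.single t 1) = co t x * form (Pi.single t 1) (Pi.single t 1)
  form_pos : ∀ x ∈ finRoots, 0 < form x x
  apply_none : ∀ x ∈ finRoots, x none = 0
  nonneg_or_nonpos : ∀ x ∈ finRoots, 0 ≤ x ∨ x ≤ 0
  neg_mem : ∀ x ∈ finRoots, -x ∈ finRoots
  simple_mem : ∀ i, Pi.single (some i) 1 ∈ finRoots
  reflect_mem : ∀ i, ∀ x ∈ finRoots, x - co (some i) x • Pi.single (some i) 1 ∈ finRoots
  top_mem : imag - Pi.single none 1 ∈ finRoots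
  le_top : ∀ x ∈ finRoots, x ≤ imag - Pi.single none 1
  reflect_top_mem : ∀ x ∈ finRoots, x + co none x • (imag - Pi.single none 1) ∈ finRoots
  reduced : ∀ i, ∀ n : ℤ, n • Pi.single (some i) 1 ∈ finRoots → n = 1 ∨ n = -1
  abs_co_none_le : ∀ x ∈ finRoots, x ≠ imag - Pi.single none 1 → x ≠ -(imag - Pi.single none 1) →
    |co none x| ≤ 1

namespace AffineSystem

variable {S : Type*} [Fintype S] [DecidableEq S] (D : AffineSystem S)

/-- The affine simple root with index `t`. -/
abbrev sr (t : Option S) : Option S → ℤ := Pi.single t 1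

/-- The highest root. -/
def top : Option S → ℤ := D.imag - sr none

/-- The affine real roots. -/
def roots : Set (Option S → ℤ) := {x | ∃ γ ∈ D.finRoots, ∃ k : ℤ, x = γ + k • D.imag}

lemma top_mem_finRoots : D.top ∈ D.finRoots := D.top_mem

lemma le_top' {x : Option S → ℤ} (hx : x ∈ D.finRoots) : x ≤ D.top := D.le_top x hx

lemma imag_eq : D.imag = D.top + sr none := by simp [top]

lemma form_imag_right (x : Option S → ℤ) : D.form x D.imag = 0 := by
  rw [D.form_comm, D.form_imag]

lemma form_sr_none_left (x : Option S → ℤ) : D.form (sr none) x = -D.form D.top x := by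
  simp [top, D.form_imag]

lemma form_sr_none_right (x : Option S → ℤ) : D.form x (sr none) = -D.form x D.top := by
  rw [D.form_comm, form_sr_none_left, D.form_comm]

lemma mem_roots_of_fin {x : Option S → ℤ} (hx : x ∈ D.finRoots) : x ∈ D.roots :=
  ⟨x, hx, 0, by simp⟩

lemma neg_mem_roots {x : Option S → ℤ} (hx : x ∈ D.roots) : -x ∈ D.roots := by
  obtain ⟨γ, hγ, k, rfl⟩ := hx
  exact ⟨-γ, D.neg_mem γ hγ, -k, by simp [add_comm]⟩

lemma sr_mem_roots (t : Option S) : sr t ∈ D.roots := by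
  cases t with
  | none => exact ⟨-D.top, D.neg_mem _ D.top_mem_finRoots, 1, by simp [top]⟩
  | some i => exact D.mem_roots_of_fin (D.simple_mem i)

lemma form_self_pos {x : Option S → ℤ} (hx : x ∈ D.roots) : 0 < D.form x x := by
  obtain ⟨γ, hγ, k, rfl⟩ := hx
  simpa [D.form_imag, D.form_imag_right, -zsmul_eq_mul] using D.form_pos γ hγ

lemma ne_zero_of_mem {x : Option S → ℤ} (hx : x ∈ D.roots) : x ≠ 0 := by
  rintro rfl
  simpa using D.form_self_pos hx

lemma not_nonpos {x : Option S → ℤ} (hx : x ∈ D.roots) (h : 0 ≤ x) : ¬ x ≤ 0 :=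
  fun h' ↦ D.ne_zero_of_mem hx (le_antisymm h' h)

lemma neg_top_le {x : Option S → ℤ} (hx : x ∈ D.finRoots) : -D.top ≤ x := by
  have := D.le_top' (D.neg_mem x hx)
  exact neg_le.mp this

lemma imag_add_nonneg {x : Option S → ℤ} (hx : x ∈ D.finRoots) {k : ℤ} (hk : 1 ≤ k) :
    0 ≤ x + k • D.imag := by
  intro t
  have h1 := D.neg_top_le hx t
  have h2 := D.one_le_imag t
  have h3 : 0 ≤ (sr none : Option S → ℤ) t := by
    by_cases h : t = none <;> simp [sr, h]
  simp only [top, Pi.neg_apply, Pi.sub_apply, Pi.zero_apply, Pi.add_apply, Pi.smul_apply,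
    smul_eq_mul] at *
  nlinarith

lemma nonneg_or_nonpos' {x : Option S → ℤ} (hx : x ∈ D.roots) : 0 ≤ x ∨ x ≤ 0 := by
  obtain ⟨γ, hγ, k, rfl⟩ := hx
  rcases lt_trichotomy k 0 with hk | rfl | hk
  · right
    have := D.imag_add_nonneg (D.neg_mem γ hγ) (k := -k) (by lia)
    rw [← neg_nonneg]
    simpa [add_comm] using this
  · simpa using D.nonneg_or_nonpos γ hγ
  · left
    exact D.imag_add_nonneg hγ (by lia)

lemma nonneg_of_not_nonpos {x : Option S → ℤ} (hx : x ∈ D.roots) (h : ¬ x ≤ 0) : 0 ≤ x :=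
  (D.nonneg_or_nonpos' hx).resolve_right h

/-- A root with a positive coordinate is positive. -/
lemma nonneg_of_apply_pos {x : Option S → ℤ} (hx : x ∈ D.roots) {t : Option S} (h : 0 < x t) :
    0 ≤ x :=
  D.nonneg_of_not_nonpos hx fun h' ↦ absurd (h' t) (by simpa using h)

lemma reduced' {t : Option S} {n : ℤ} (h : n • sr t ∈ D.roots) : n = 1 ∨ n = -1 := by
  obtain ⟨γ, hγ, k, hk⟩ := h
  have h0 : k = (n • sr t : Option S → ℤ) none := by
    rw [hk]; simp [D.apply_none γ hγ, D.imag_none]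
  cases t with
  | some i =>
    simp only [sr, Pi.smul_apply, ne_eq, reduceCtorEq, not_false_eq_true, Pi.single_eq_of_ne',
      smul_eq_mul, mul_zero] at h0
    subst h0
    rw [zero_smul, add_zero] at hk
    exact D.reduced i n (hk ▸ hγ)
  | none =>
    simp only [sr, Pi.smul_apply, Pi.single_eq_same, smul_eq_mul, mul_one] at h0
    subst h0
    have hγ' : γ = -(k • D.top) := by
      rw [top, smul_sub, hk]; abel
    have h1 := D.form_pos _ hγ
    have ht : ∃ t, 0 < D.top t := by
      by_contra! h
      exact D.not_nonpos (D.mem_roots_of_fin D.top_mem_finRoots)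
        ((D.nonneg_or_nonpos _ D.top_mem_finRoots).resolve_right
          (fun h' ↦ D.ne_zero_of_mem (D.mem_roots_of_fin D.top_mem_finRoots)
            (le_antisymm h' (by
              have := D.neg_top_le D.top_mem_finRoots
              intro s
              have h2 := this s
              have h3 := h' s
              simp only [Pi.neg_apply, Pi.zero_apply] at h2 h3 ⊢
              have h4 := D.one_le_imag s
              rcases eq_or_ne s none with rfl | hs
              · simp [D.apply_none _ D.top_mem_finRoots]
              · simp [top, sr, hs] at h3 ⊢
                lia)))) h
    obtain ⟨t, ht⟩ := ht
    have h2 := D.le_top' hγ t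
    have h3 := D.neg_top_le hγ t
    have h4 : k ≠ 0 := by
      rintro rfl
      rw [hγ'] at h1; simp at h1
    rw [hγ'] at h2 h3
    simp only [Pi.neg_apply, Pi.smul_apply, smul_eq_mul] at h2 h3
    have h5 : -1 ≤ k := by nlinarith
    have h6 : k ≤ 1 := by nlinarith
    lia

lemma co_sr_self (t : Option S) : D.co t (sr t) = 2 := by
  have h1 := D.two_form t (sr t)
  have h2 := D.form_self_pos (D.sr_mem_roots t)
  exact (mul_right_cancel₀ h2.ne' h1).symm

lemma co_eq_zero_iff (t : Option S) (x : Option S → ℤ) : D.co t x = 0 ↔ D.form x (sr t) = 0 := by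
  have h1 := D.two_form t x
  have h2 := (D.form_self_pos (D.sr_mem_roots t)).ne'
  constructor
  · intro h; rw [h] at h1; simpa using h1
  · intro h; rw [h] at h1; simpa [h2] using h1.symm

lemma co_imag (t : Option S) : D.co t D.imag = 0 := by
  rw [co_eq_zero_iff, D.form_imag]

/-- The reflection in an affine simple root. -/
noncomputable def s (t : Option S) : (Option S → ℤ) ≃ₗ[ℤ] (Option S → ℤ) :=
  Module.reflection (D.co_sr_self t)

lemma s_apply (t : Option S) (x : Option S → ℤ) : D.s t x = x - D.co t x • sr t :=
  Module.reflection_apply (x := sr t) (f := D.co t) x (D.co_sr_self t)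

@[simp] lemma s_s (t : Option S) (x : Option S → ℤ) : D.s t (D.s t x) = x :=
  Module.involutive_reflection (D.co_sr_self t) x

@[simp] lemma s_mul_s (t : Option S) : D.s t * D.s t = 1 := by
  ext1 x; exact D.s_s t x

@[simp] lemma s_inv (t : Option S) : (D.s t)⁻¹ = D.s t := inv_eq_of_mul_eq_one_left (D.s_mul_s t)

lemma s_sr (t : Option S) : D.s t (sr t) = -sr t := by
  rw [s_apply, co_sr_self]; module

lemma s_imag (t : Option S) : D.s t D.imag = D.imag := by simp [s_apply, co_imag]

lemma s_apply_of_form_eq_zero {t : Option S} {x : Option S → ℤ} (h : D.form x (sr t) = 0) :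
    D.s t x = x := by
  simp [s_apply, (D.co_eq_zero_iff t x).mpr h]

lemma s_apply_of_ne {t u : Option S} (x : Option S → ℤ) (h : u ≠ t) : D.s t x u = x u := by
  simp [s_apply, h]

lemma form_s_s (t : Option S) (x y : Option S → ℤ) : D.form (D.s t x) (D.s t y) = D.form x y := by
  have h1 := D.two_form t x
  have h2 := D.two_form t y
  have h3 := D.form_comm (sr t) y
  simp only [s_apply, map_sub, map_smul, LinearMap.sub_apply, LinearMap.smul_apply, smul_eq_mul, h3]
  have : ∀ a b : ℤ, 2 * a = 2 * b → a = b := by intro a b; lia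
  apply this
  linear_combination (-D.co t y) * h1 - D.co t x * h2

lemma s_mem_fin (i : S) {x : Option S → ℤ} (hx : x ∈ D.finRoots) : D.s (some i) x ∈ D.finRoots := by
  rw [s_apply]; exact D.reflect_mem i x hx

lemma s_mem_roots (t : Option S) {x : Option S → ℤ} (hx : x ∈ D.roots) : D.s t x ∈ D.roots := by
  obtain ⟨γ, hγ, k, rfl⟩ := hx
  cases t with
  | some i => exact ⟨_, D.s_mem_fin i hγ, k, by simp [s_imag, -zsmul_eq_mul]⟩
  | none =>
    refine ⟨_, D.reflect_top_mem γ hγ, k - D.co none γ, ?_⟩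
    rw [s_apply, map_add, map_smul, co_imag]
    simp only [smul_zero, add_zero]
    module

/-- A simple reflection permutes the positive roots other than the simple root itself. -/
lemma s_nonneg {t : Option S} {x : Option S → ℤ} (hx : x ∈ D.roots) (h : 0 ≤ x) (hne : x ≠ sr t) :
    0 ≤ D.s t x := by
  apply D.nonneg_of_not_nonpos (D.s_mem_roots t hx)
  intro h'
  have key : x = x t • sr t := by
    ext u
    by_cases hu : u = t
    · subst hu; simp
    · have h1 := h' u
      rw [D.s_apply_of_ne x hu] at h1
      simpa [hu] using le_antisymm h1 (h u)
  rcases D.reduced' (key ▸ hx) with h1 | h1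
  · rw [h1, one_smul] at key
    exact hne key
  · have := h t
    rw [h1] at this
    simp at this

/-! ### The Weyl group of the lattice model -/

/-- The subgroup generated by the simple reflections with index in `J`. -/
def par (J : Set (Option S)) : Subgroup ((Option S → ℤ) ≃ₗ[ℤ] (Option S → ℤ)) :=
  Subgroup.closure (D.s '' J)

/-- The product of the simple reflections with the given indices. -/
noncomputable def word (l : List (Option S)) : (Option S → ℤ) ≃ₗ[ℤ] (Option S → ℤ) :=
  (l.map D.s).prod

@[simp] lemma word_nil : D.word [] = 1 := rfl

@[simp] lemma word_cons (t : Option S) (l : List (Option S)) :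
    D.word (t :: l) = D.s t * D.word l := by simp [word]

@[simp] lemma word_append (l l' : List (Option S)) :
    D.word (l ++ l') = D.word l * D.word l' := by simp [word]

lemma s_mem_par {J : Set (Option S)} {t : Option S} (h : t ∈ J) : D.s t ∈ D.par J :=
  Subgroup.subset_closure ⟨t, h, rfl⟩

lemma word_mem_par {J : Set (Option S)} {l : List (Option S)} (h : ∀ t ∈ l, t ∈ J) :
    D.word l ∈ D.par J := by
  apply Subgroup.list_prod_mem
  intro g hg
  obtain ⟨t, ht, rfl⟩ := List.mem_map.mp hg
  exact D.s_mem_par (h t ht)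

lemma exists_word {J : Set (Option S)} {w : (Option S → ℤ) ≃ₗ[ℤ] (Option S → ℤ)}
    (hw : w ∈ D.par J) : ∃ l : List (Option S), (∀ t ∈ l, t ∈ J) ∧ D.word l = w := by
  unfold par at hw
  induction hw using Subgroup.closure_induction with
  | mem x hx =>
    obtain ⟨t, ht, rfl⟩ := hx
    exact ⟨[t], by simpa using ht, by simp⟩
  | one => exact ⟨[], by simp, rfl⟩
  | mul x y _ _ hx hy =>
    obtain ⟨l, hl, rfl⟩ := hx
    obtain ⟨l', hl', rfl⟩ := hy
    refine ⟨l ++ l', ?_, by simp⟩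
    intro t ht
    rcases List.mem_append.mp ht with h | h
    exacts [hl t h, hl' t h]
  | inv x _ hx =>
    obtain ⟨l, hl, rfl⟩ := hx
    refine ⟨l.reverse, by simpa using hl, ?_⟩
    clear hl ‹D.word l ∈ _›
    induction l with
    | nil => simp
    | cons t l ih => simp [ih]

lemma par_mono {J J' : Set (Option S)} (h : J ⊆ J') : D.par J ≤ D.par J' :=
  Subgroup.closure_mono (Set.image_mono h)

/-- Induction on an element of a standard parabolic subgroup. -/
@[elab_as_elim]
lemma par_induction {J : Set (Option S)} {p : ((Option S → ℤ) ≃ₗ[ℤ] (Option S → ℤ)) → Prop}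
    {w} (hw : w ∈ D.par J) (h1 : p 1) (hs : ∀ t ∈ J, ∀ w, p w → p (D.s t * w)) : p w := by
  obtain ⟨l, hl, rfl⟩ := D.exists_word hw
  clear hw
  induction l with
  | nil => exact h1
  | cons t l ih =>
    rw [word_cons]
    exact hs t (hl t (by simp)) _ (ih fun u hu ↦ hl u (by simp [hu]))

/-- The affine Weyl group. -/
abbrev W : Subgroup ((Option S → ℤ) ≃ₗ[ℤ] (Option S → ℤ)) := D.par Set.univ

/-- The finite Weyl group. -/
abbrev W₀ : Subgroup ((Option S → ℤ) ≃ₗ[ℤ] (Option S → ℤ)) := D.par (Set.range some)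

lemma par_le (J : Set (Option S)) : D.par J ≤ D.W := D.par_mono (Set.subset_univ J)

variable {D} in
lemma mem_W {J : Set (Option S)} {w} (hw : w ∈ D.par J) : w ∈ D.W := D.par_le J hw

variable {w g : (Option S → ℤ) ≃ₗ[ℤ] (Option S → ℤ)} {x y : Option S → ℤ} {J : Set (Option S)}

variable {D}

lemma map_mem_roots (hw : w ∈ D.W) (hx : x ∈ D.roots) : w x ∈ D.roots := by
  refine D.par_induction hw ?_ fun t _ w ih ↦ ?_
  · exact hx
  · exact D.s_mem_roots t ih

lemma map_mem_fin (hw : w ∈ D.W₀) (hx : x ∈ D.finRoots) : w x ∈ D.finRoots := by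
  refine D.par_induction hw ?_ fun t ht w ih ↦ ?_
  · exact hx
  · obtain ⟨i, rfl⟩ := ht
    exact D.s_mem_fin i ih

lemma map_imag (hw : w ∈ D.W) : w D.imag = D.imag := by
  refine D.par_induction hw ?_ fun t _ w ih ↦ ?_
  · rfl
  · rw [LinearEquiv.mul_apply, ih, s_imag]

lemma form_map_map (hw : w ∈ D.W) (x y : Option S → ℤ) : D.form (w x) (w y) = D.form x y := by
  refine D.par_induction hw ?_ fun t _ w ih ↦ ?_
  · rfl
  · rw [LinearEquiv.mul_apply, LinearEquiv.mul_apply, form_s_s, ih]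

/-- Coordinates outside `J` are not changed by the parabolic subgroup of `J`. -/
lemma par_apply_of_notMem (hw : w ∈ D.par J) {u : Option S} (hu : u ∉ J) : w x u = x u := by
  refine D.par_induction hw ?_ fun t ht w ih ↦ ?_
  · rfl
  · rw [LinearEquiv.mul_apply, s_apply_of_ne, ih]
    rintro rfl; exact hu ht

lemma fin_apply_none (hw : w ∈ D.W₀) (x : Option S → ℤ) : w x none = x none :=
  par_apply_of_notMem hw (by simp)

/-- An element of the parabolic subgroup of `J` fixes the vectors orthogonal to `J`. -/
lemma par_apply_of_orthogonal (hw : w ∈ D.par J) (h : ∀ t ∈ J, D.form x (sr t) = 0) : w x = x := by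
  refine D.par_induction hw ?_ fun t ht w ih ↦ ?_
  · rfl
  · rw [LinearEquiv.mul_apply, ih, s_apply_of_form_eq_zero D (h t ht)]

omit [Fintype S] [DecidableEq S] in
lemma inv_apply_eq : w⁻¹ x = y ↔ x = w y := by
  rw [show w⁻¹ x = w.symm x from rfl, LinearEquiv.symm_apply_eq]

omit [Fintype S] [DecidableEq S] in
@[simp] lemma inv_apply_self' : w⁻¹ (w x) = x := by rw [inv_apply_eq]

omit [Fintype S] [DecidableEq S] in
@[simp] lemma apply_inv_self' : w (w⁻¹ x) = x := (inv_apply_eq.mp rfl).symm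

/-- Conjugating simple reflections: if `g` takes one simple root to another, it conjugates
the corresponding simple reflections. -/
lemma mul_s_eq_s_mul (hg : g ∈ D.W) {t u : Option S} (h : g (sr t) = sr u) :
    g * D.s t = D.s u * g := by
  ext1 x
  have h1 := D.two_form t x
  have h2 := D.two_form u (g x)
  have h3 : D.form (g x) (sr u) = D.form x (sr t) := by rw [← h, form_map_map hg]
  have h4 : D.form (sr u) (sr u) = D.form (sr t) (sr t) := by rw [← h, form_map_map hg]
  rw [h3, h4, h1] at h2
  have h5 := mul_right_cancel₀ (D.form_self_pos (D.sr_mem_roots t)).ne' h2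
  simp [s_apply, h, h5, -zsmul_eq_mul]

/-- The exchange condition: if a word takes a positive root to a negative one, then some suffix of
the word takes it to the simple root of the preceding letter. -/
lemma exists_suffix (hx : x ∈ D.roots) (h : 0 ≤ x) {l : List (Option S)} (hl : D.word l x ≤ 0) :
    ∃ l₁ t l₂, l = l₁ ++ t :: l₂ ∧ D.word l₂ x = sr t := by
  induction l with
  | nil => exact absurd hl (D.not_nonpos hx h)
  | cons t l ih =>
    by_cases hl' : D.word l x ≤ 0
    · obtain ⟨l₁, u, l₂, rfl, h2⟩ := ih hl'
      exact ⟨t :: l₁, u, l₂, by simp, h2⟩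
    · refine ⟨[], t, l, rfl, ?_⟩
      by_contra hne
      have hr : D.word l x ∈ D.roots := map_mem_roots (D.word_mem_par (by simp)) hx
      rw [word_cons, LinearEquiv.mul_apply] at hl
      exact D.not_nonpos (D.s_mem_roots t hr) (D.s_nonneg hr (D.nonneg_of_not_nonpos hr hl') hne) hl

/-- The deletion condition. -/
lemma exists_word_mul_s {l : List (Option S)} (hl : ∀ t ∈ l, t ∈ J) {t : Option S}
    (h : D.word l (sr t) ≤ 0) :
    ∃ l' : List (Option S), (∀ t ∈ l', t ∈ J) ∧ l'.length + 1 = l.length ∧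
      D.word l * D.s t = D.word l' := by
  obtain ⟨l₁, u, l₂, rfl, h2⟩ := exists_suffix (D.sr_mem_roots t)
    (Pi.single_nonneg.mpr zero_le_one) h
  refine ⟨l₁ ++ l₂, ?_, by simp; lia, ?_⟩
  · intro v hv
    apply hl
    simp only [List.mem_append, List.mem_cons] at hv ⊢
    tauto
  · have := mul_s_eq_s_mul (g := D.word l₂) (D.word_mem_par (by simp)) h2
    simp only [word_append, word_cons, mul_assoc, this]
    rw [← mul_assoc (D.s u), s_mul_s, one_mul]

/-- Every left coset of the standard parabolic subgroup of `J'` has a representative that takes the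
simple roots with index in `J'` to positive roots. -/
lemma exists_factor (hw : w ∈ D.par J) (J' : Set (Option S)) :
    ∃ u ∈ D.par J, ∃ v ∈ D.par J', w = u * v ∧ ∀ t ∈ J', 0 ≤ u (sr t) := by
  obtain ⟨l, hl, rfl⟩ := D.exists_word hw
  clear hw
  induction hn : l.length generalizing l with
  | zero =>
    obtain rfl := List.length_eq_zero_iff.mp hn
    exact ⟨1, one_mem _, 1, one_mem _, by simp, fun t _ ↦ by simp⟩
  | succ n ih =>
    by_cases h : ∀ t ∈ J', 0 ≤ D.word l (sr t)
    · exact ⟨_, D.word_mem_par hl, 1, one_mem _, by simp, h⟩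
    · push Not at h
      obtain ⟨t, ht, h⟩ := h
      have h' := (D.nonneg_or_nonpos' (map_mem_roots (D.word_mem_par (J := Set.univ) (l := l)
        (by simp)) (D.sr_mem_roots t))).resolve_left h
      obtain ⟨l', h1, h2, h3⟩ := exists_word_mul_s hl h'
      obtain ⟨u, hu, v, hv, h4, h5⟩ := ih l' h1 (by lia)
      refine ⟨u, hu, v * D.s t, mul_mem hv (D.s_mem_par ht), ?_, h5⟩
      rw [← mul_assoc, ← h4, ← h3, mul_assoc, s_mul_s, mul_one]

/-- An element of the Weyl group that takes all simple roots to positive roots is trivial. -/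
lemma eq_one_of_nonneg (hw : w ∈ D.W) (h : ∀ t, 0 ≤ w (sr t)) : w = 1 := by
  obtain ⟨l, hl, rfl⟩ := D.exists_word hw
  clear hw
  induction hn : l.length using Nat.strong_induction_on generalizing l with
  | _ n ih =>
  rcases List.eq_nil_or_concat l with rfl | ⟨l', t, rfl⟩
  · rfl
  · rw [List.concat_eq_append] at *
    have h1 : D.word l' (sr t) ≤ 0 := by
      have := h t
      rw [word_append, LinearEquiv.mul_apply, word_cons, word_nil, mul_one, s_sr, map_neg] at this
      simpa using this
    obtain ⟨l'', h2, h3, h4⟩ := exists_word_mul_s (J := Set.univ) (by simp) h1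
    have h5 : D.word (l' ++ [t]) = D.word l'' := by simp [h4]
    rw [h5] at h ⊢
    refine ih _ ?_ l'' h2 h rfl
    simp only [List.length_append, List.length_singleton] at hn
    lia

end AffineSystem

end AbIdeal

namespace AbIdeal

namespace AffineSystem

variable {S : Type*} [Fintype S] [DecidableEq S] {D : AffineSystem S}
  {w g u v : (Option S → ℤ) ≃ₗ[ℤ] (Option S → ℤ)} {x y : Option S → ℤ} {J : Set (Option S)}
  {i₀ : S}

/-! ### Heights and positivity -/

lemma map_eq_sum (g : (Option S → ℤ) →ₗ[ℤ] (Option S → ℤ)) (x : Option S → ℤ) :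
    g x = ∑ t, x t • g (sr t) := by
  conv_lhs => rw [← Finset.univ_sum_single x]
  rw [map_sum]
  refine Finset.sum_congr rfl fun t _ ↦ ?_
  rw [← map_smul]
  congr 1
  ext u
  by_cases h : u = t <;> simp [h]

lemma form_eq_sum (x y : Option S → ℤ) : D.form x y = ∑ t, x t * D.form (sr t) y := by
  conv_lhs => rw [← Finset.univ_sum_single x]
  rw [map_sum, LinearMap.sum_apply]
  refine Finset.sum_congr rfl fun t _ ↦ ?_
  rw [← smul_eq_mul, ← LinearMap.smul_apply, ← map_smul]
  congr 2
  ext u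
  by_cases h : u = t <;> simp [h]

lemma map_nonneg_of (hx : 0 ≤ x) (h : ∀ t, 0 < x t → 0 ≤ g (sr t)) : 0 ≤ g x := by
  rw [show g x = (g : (Option S → ℤ) →ₗ[ℤ] (Option S → ℤ)) x from rfl, map_eq_sum]
  refine Finset.sum_nonneg fun t _ ↦ ?_
  rcases (hx t).eq_or_lt with h0 | h0
  · simp only [Pi.zero_apply] at h0
    rw [← h0, zero_smul]
  · intro p
    exact mul_nonneg h0.le (h t h0 p)

lemma map_nonneg_of_fin (hx : 0 ≤ x) (hn : x none = 0) (h : ∀ i : S, 0 ≤ g (sr (some i))) :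
    0 ≤ g x := by
  refine map_nonneg_of hx fun t ht ↦ ?_
  cases t with
  | none => simp [hn] at ht
  | some i => exact h i

omit [DecidableEq S] in
lemma sum_pos_of_nonneg (hx : 0 ≤ x) (h0 : x ≠ 0) : 1 ≤ ∑ t, x t := by
  by_contra! h
  apply h0
  have h1 : ∑ t, x t = 0 := le_antisymm (by lia) (Finset.sum_nonneg fun t _ ↦ hx t)
  ext t
  exact (Finset.sum_eq_zero_iff_of_nonneg fun t _ ↦ hx t).mp h1 t (Finset.mem_univ t)

lemma eq_sr_of_sum_eq_one (hx : 0 ≤ x) (h : ∑ t, x t = 1) : ∃ t, x = sr t := by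
  obtain ⟨t, ht⟩ : ∃ t, x t ≠ 0 := by
    by_contra! h'
    simp [h'] at h
  refine ⟨t, ?_⟩
  have h1 := Finset.add_sum_erase Finset.univ x (Finset.mem_univ t)
  have h2 : 0 ≤ ∑ u ∈ Finset.univ.erase t, x u := Finset.sum_nonneg fun u _ ↦ hx u
  have h3 := hx t
  simp only [Pi.zero_apply] at h3
  have h4 : ∑ u ∈ Finset.univ.erase t, x u = 0 := by lia
  have h5 := (Finset.sum_eq_zero_iff_of_nonneg fun u _ ↦ hx u).mp h4
  ext u
  by_cases hu : u = t
  · subst hu; simp; lia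
  · simpa [hu] using h5 u (by simp [hu])

/-- A positive vector whose constituents go to positive roots, while the vector itself goes to a
simple root, is simple: simple roots are the positive roots of height one. -/
lemma exists_eq_sr_of_map (hx : 0 ≤ x) {s : Option S} (h : g x = sr s)
    (hg : ∀ t, 0 < x t → g (sr t) ∈ D.roots ∧ 0 ≤ g (sr t)) : ∃ t, x = sr t := by
  apply eq_sr_of_sum_eq_one hx
  have h0 : x ≠ 0 := by
    rintro rfl
    rw [map_zero] at h
    simpa using congrFun h s
  refine le_antisymm ?_ (sum_pos_of_nonneg hx h0)
  have h1 : ∑ p, g x p = 1 := by rw [h]; simp [sr]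
  rw [← h1, show g x = (g : (Option S → ℤ) →ₗ[ℤ] (Option S → ℤ)) x from rfl, map_eq_sum]
  simp only [Finset.sum_apply, Pi.smul_apply, smul_eq_mul]
  rw [Finset.sum_comm]
  simp only [← Finset.mul_sum]
  refine Finset.sum_le_sum fun t _ ↦ ?_
  rcases (hx t).eq_or_lt with h0 | h0
  · simp only [Pi.zero_apply] at h0
    simp [← h0]
  · have h2 := sum_pos_of_nonneg (hg t h0).2 (D.ne_zero_of_mem (hg t h0).1)
    simp only [Pi.zero_apply] at h0
    simp only [LinearEquiv.coe_coe]
    nlinarith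

/-! ### Elements of the affine Weyl group with a given simple rootlet -/

lemma form_top_pos : 0 < D.form D.top D.top := D.form_pos _ D.top_mem_finRoots

lemma top_none : D.top none = 0 := D.apply_none _ D.top_mem_finRoots

lemma form_sr_none_self : D.form (sr none) (sr none) = D.form D.top D.top := by
  rw [form_sr_none_left, form_sr_none_right, neg_neg]

/-- The additional simple coroot is minus the coroot of the highest root. -/
lemma co_none_mul (x : Option S → ℤ) : D.co none x * D.form D.top D.top = -2 * D.form x D.top := by
  have := D.two_form none x
  rw [form_sr_none_self, form_sr_none_right] at this
  lia

lemma co_none_top : D.co none D.top = -2 :=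
  mul_right_cancel₀ form_top_pos.ne' (co_none_mul D.top)

/-- The highest root is dominant. -/
lemma form_simple_top_nonneg (i : S) : 0 ≤ D.form (sr (some i)) D.top := by
  have h1 := D.le_top' (D.reflect_mem i _ D.top_mem_finRoots) (some i)
  have h2 := D.two_form (some i) D.top
  have h3 := D.form_pos _ (D.simple_mem i)
  simp only [Pi.sub_apply, Pi.smul_apply, Pi.single_eq_same, smul_eq_mul, mul_one] at h1
  have h4 : 0 ≤ D.co (some i) D.top := by lia
  rw [D.form_comm]
  have := mul_nonneg h4 h3.le
  simp only [sr]
  lia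

lemma form_top_nonneg (hx : 0 ≤ x) (hn : x none = 0) : 0 ≤ D.form x D.top := by
  rw [form_eq_sum]
  refine Finset.sum_nonneg fun t _ ↦ ?_
  cases t with
  | none => simp [hn]
  | some i => exact mul_nonneg (hx _) (form_simple_top_nonneg i)

lemma s_none_top : D.s none D.top = 2 • D.imag - D.top := by
  rw [s_apply, co_none_top, imag_eq]; module

lemma s_none_two_imag_sub_top : D.s none (2 • D.imag - D.top) = D.top := by
  rw [← s_none_top, s_s]

variable (D) in
/-- The element `w` of the affine Weyl group takes the finite simple roots to positive roots and
`2δ - θ` to the simple root with index `i₀`. These are the elements attached to the abelian ideals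
whose rootlet is that simple root. -/
structure IsFib (i₀ : S) (w : (Option S → ℤ) ≃ₗ[ℤ] (Option S → ℤ)) : Prop where
  mem : w ∈ D.W
  nonneg : ∀ i : S, 0 ≤ w (sr (some i))
  map_eq : w (2 • D.imag - D.top) = sr (some i₀)

variable (D) in
/-- The element `v` of the finite Weyl group takes `θ` to the simple root with index `i₀`, and the
positive roots orthogonal to `θ` to positive roots. -/
structure IsShort (i₀ : S) (v : (Option S → ℤ) ≃ₗ[ℤ] (Option S → ℤ)) : Prop where
  mem : v ∈ D.W₀
  map_eq : v D.top = sr (some i₀)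
  nonneg : ∀ x ∈ D.finRoots, 0 ≤ x → D.form x D.top = 0 → 0 ≤ v x

lemma IsFib.map_nonneg (hw : D.IsFib i₀ w) (hx : 0 ≤ x) (hn : x none = 0) : 0 ≤ w x :=
  map_nonneg_of_fin hx hn hw.nonneg

/-- The positive roots made negative have the form `δ - γ`. -/
lemma IsFib.exists_eq_sub (hw : D.IsFib i₀ w) (hx : x ∈ D.roots) (h : 0 ≤ x) (h' : w x ≤ 0) :
    ∃ γ ∈ D.finRoots, 0 ≤ γ ∧ x = D.imag - γ := by
  have hr := map_mem_roots hw.mem hx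
  obtain ⟨γ, hγ, k, rfl⟩ := hx
  have hk : 0 ≤ k := by
    have := h none
    simpa [D.apply_none γ hγ, D.imag_none] using this
  have hi : 0 ≤ D.imag := fun t ↦ zero_le_one.trans (D.one_le_imag t)
  have h2 : γ ≤ 0 := by
    refine (D.nonneg_or_nonpos γ hγ).resolve_left fun h1 ↦ ?_
    refine D.not_nonpos hr ?_ h'
    rw [map_add, map_smul, map_imag hw.mem]
    exact add_nonneg (hw.map_nonneg h1 (D.apply_none γ hγ)) (smul_nonneg hk hi)
  refine ⟨-γ, D.neg_mem γ hγ, by simpa using h2, ?_⟩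
  obtain rfl | hk1 := hk.eq_or_lt
  · exact absurd (by simpa using h2) (D.not_nonpos (by simpa using D.mem_roots_of_fin hγ) h)
  obtain rfl | hk2 := (show 1 ≤ k by lia).eq_or_lt
  · module
  exfalso
  refine D.not_nonpos hr ?_ h'
  have e : γ + k • D.imag = (2 • D.imag - D.top) + (D.top + γ) + (k - 2) • D.imag := by module
  rw [e, map_add, map_add, hw.map_eq, map_smul, map_imag hw.mem]
  refine add_nonneg (add_nonneg (Pi.single_nonneg.mpr zero_le_one) (hw.map_nonneg ?_ ?_))
    (smul_nonneg (by lia) hi)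
  · have := D.neg_top_le hγ
    intro t
    have := this t
    simp only [Pi.neg_apply, Pi.zero_apply, Pi.add_apply] at this ⊢
    lia
  · simp [top_none, D.apply_none γ hγ]

/-- If all positive roots made negative by `u` are orthogonal to `μ`, then `u` is a product of
simple reflections orthogonal to `μ`. -/
lemma mem_par_of_orthogonal (hu : u ∈ D.W) (μ : Option S → ℤ)
    (h : ∀ x ∈ D.roots, 0 ≤ x → u x ≤ 0 → D.form x μ = 0) :
    u ∈ D.par {t | D.form (sr t) μ = 0} := by
  obtain ⟨l, hl, rfl⟩ := D.exists_word hu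
  clear hu
  induction hn : l.length generalizing l with
  | zero =>
    obtain rfl := List.length_eq_zero_iff.mp hn
    exact one_mem _
  | succ n ih =>
    have hm : D.word l ∈ D.W := D.word_mem_par (by simp)
    by_cases h0 : ∀ t, 0 ≤ D.word l (sr t)
    · rw [eq_one_of_nonneg hm h0]
      exact one_mem _
    push Not at h0
    obtain ⟨t, ht⟩ := h0
    have ht := (D.nonneg_or_nonpos' (map_mem_roots hm (D.sr_mem_roots t))).resolve_left ht
    have ht0 := h _ (D.sr_mem_roots t) (Pi.single_nonneg.mpr zero_le_one) ht
    obtain ⟨l', h1, h2, h3⟩ := exists_word_mul_s hl ht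
    have h4 : D.word l = D.word l' * D.s t := by rw [← h3, mul_assoc, s_mul_s, mul_one]
    rw [h4] at h ht ⊢
    refine mul_mem (ih l' h1 (fun x hx hx0 hx1 ↦ ?_) (by lia)) (D.s_mem_par ht0)
    have hne : x ≠ sr t := by
      rintro rfl
      rw [LinearEquiv.mul_apply, s_sr, map_neg] at ht
      have hr := map_mem_roots (D.word_mem_par (J := Set.univ) (l := l') (by simp)) hx
      exact D.not_nonpos hr (by simpa using ht) hx1
    have := h (D.s t x) (D.s_mem_roots t hx) (D.s_nonneg hx hx0 hne) (by simpa using hx1)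
    rw [← D.s_apply_of_form_eq_zero (t := t) (x := μ) (by rwa [D.form_comm]), form_s_s] at this
    exact this

lemma form_sr_top_pos_of_ne (i : S) (h : D.form (sr (some i)) D.top ≠ 0) :
    0 < D.form (sr (some i)) D.top := lt_of_le_of_ne (form_simple_top_nonneg i) h.symm

/-- The shortest element taking the highest root to a given root is unique. -/
lemma IsShort.unique (hv : D.IsShort i₀ v) (hu : D.IsShort i₀ u) : v = u := by
  have hx : u⁻¹ * v ∈ D.W₀ := mul_mem (inv_mem hu.mem) hv.mem
  have htop : (u⁻¹ * v) D.top = D.top := by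
    rw [LinearEquiv.mul_apply, hv.map_eq, inv_apply_eq, hu.map_eq]
  suffices u⁻¹ * v = 1 by rwa [inv_mul_eq_one, eq_comm] at this
  refine eq_one_of_nonneg (mem_W hx) fun t ↦ ?_
  cases t with
  | none =>
    have : sr none = D.imag - D.top := by simp [top]
    rw [this, map_sub, map_imag (mem_W hx), htop, ← this]
    exact Pi.single_nonneg.mpr zero_le_one
  | some i =>
    have hr := map_mem_fin hx (D.simple_mem i)
    refine (D.nonneg_or_nonpos _ hr).resolve_right fun hneg ↦ ?_
    by_cases h : D.form (sr (some i)) D.top = 0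
    · have h1 := hv.nonneg _ (D.simple_mem i) (Pi.single_nonneg.mpr zero_le_one) h
      have h2 := hu.nonneg _ (D.neg_mem _ hr) (by simpa using hneg) (by
        rw [map_neg, LinearMap.neg_apply, neg_eq_zero, ← htop, form_map_map (mem_W hx)]
        exact h)
      rw [map_neg, LinearEquiv.mul_apply, apply_inv_self'] at h2
      exact D.not_nonpos (map_mem_roots (mem_W hv.mem) (D.sr_mem_roots _)) h1 (by simpa using h2)
    · have h1 := form_sr_top_pos_of_ne i h
      rw [← form_map_map (mem_W hx), htop] at h1
      have h2 := form_top_nonneg (D := D) (x := -(u⁻¹ * v) (sr (some i))) (by simpa using hneg)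
        (by simpa using D.apply_none _ hr)
      rw [map_neg, LinearMap.neg_apply] at h2
      lia

lemma sr_none_eq : sr none = D.imag - D.top := by simp [top]

lemma IsFib.map_sr_none (hw : D.IsFib i₀ w) : w (sr none) = sr (some i₀) - D.imag := by
  have : (sr none : Option S → ℤ) = (2 • D.imag - D.top) - D.imag := by
    rw [sr_none_eq (D := D)]; module
  rw [this, map_sub, hw.map_eq, map_imag hw.mem]

/-- The structure of the elements with a given simple rootlet: they are products of an element `u`
of the standard parabolic subgroup orthogonal to the rootlet, of the shortest element `v` taking the
highest root to the rootlet, and of the reflection in `α₀`. -/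
lemma IsFib.exists_factor (hw : D.IsFib i₀ w) (hv : D.IsShort i₀ v) :
    ∃ u ∈ D.par {t | D.form (sr t) (sr (some i₀)) = 0},
      w = u * (v * D.s none) ∧ ∀ i : S, 0 ≤ u (sr (some i)) := by
  obtain ⟨u, hu, v₁, hv₁, huv, hpos⟩ := AffineSystem.exists_factor (D := D) (J := Set.univ)
    (mul_mem hw.mem (D.s_mem_par (Set.mem_univ none))) (Set.range some)
  replace hpos : ∀ i : S, 0 ≤ u (sr (some i)) := fun i ↦ hpos _ ⟨i, rfl⟩
  have huv' : ∀ z, u (v₁ z) = w (D.s none z) := fun z ↦ (LinearEquiv.congr_fun huv z).symm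
  have hμ : u (v₁ D.top) = sr (some i₀) := by
    rw [huv', s_none_top, hw.map_eq]
  have hpar := mem_par_of_orthogonal hu (v₁ D.top) fun x hx hx0 hx1 ↦ by
    set y := v₁⁻¹ x with hy
    have hyr : y ∈ D.roots := map_mem_roots (inv_mem (mem_W hv₁)) hx
    have hxy : x = v₁ y := by simp [hy]
    have hn : y none = x none := by rw [hxy, fin_apply_none hv₁]
    have hn1 : 1 ≤ y none := by
      by_contra! hlt
      have h0 := hx0 none
      simp only [Pi.zero_apply] at h0
      refine D.not_nonpos (map_mem_roots hu hx) (map_nonneg_of_fin hx0 (by lia) hpos) hx1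
    have hy0 : 0 ≤ y := D.nonneg_of_apply_pos hyr (t := none) (by lia)
    rw [hxy, huv'] at hx1
    have hne : y ≠ sr none := by
      intro h
      rw [h, s_sr, map_neg, hw.map_sr_none] at hx1
      have := hx1 none
      simp [D.imag_none] at this
    obtain ⟨γ, hγ, hγ0, hz⟩ := hw.exists_eq_sub (D.s_mem_roots none hyr) (D.s_nonneg hyr hy0 hne) hx1
    have hyz : y = D.imag - γ + D.co none γ • sr none := by
      rw [← D.s_s none y, hz, map_sub, s_imag, s_apply]; module
    have h1 : 0 ≤ D.co none γ := by
      rw [hyz] at hn1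
      simpa [D.imag_none, D.apply_none γ hγ] using hn1
    have h2 := co_none_mul (D := D) γ
    have h3 := form_top_nonneg (D := D) hγ0 (D.apply_none γ hγ)
    have h4 := mul_nonneg h1 (form_top_pos (D := D)).le
    have h5 : D.form γ D.top = 0 := by lia
    have h6 : D.co none γ = 0 := by
      rw [h5] at h2
      simpa [(form_top_pos (D := D)).ne'] using h2
    rw [hxy, form_map_map (mem_W hv₁), hyz, h6]
    simp [D.form_imag, h5]
  have hfix : u (v₁ D.top) = v₁ D.top :=
    par_apply_of_orthogonal hpar fun t ht ↦ by rw [D.form_comm]; exact ht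
  have hv₁top : v₁ D.top = sr (some i₀) := hfix ▸ hμ
  rw [hv₁top] at hpar
  have hshort : D.IsShort i₀ v₁ := by
    refine ⟨hv₁, hv₁top, fun x hx hx0 hx1 ↦ ?_⟩
    have hr := map_mem_fin hv₁ hx
    refine (D.nonneg_or_nonpos _ hr).resolve_right fun hneg ↦ ?_
    have h1 : 0 ≤ u (-v₁ x) := map_nonneg_of_fin (by simpa using hneg)
      (by simpa using D.apply_none _ hr) hpos
    rw [map_neg, huv', D.s_apply_of_form_eq_zero (by rw [form_sr_none_right, hx1, neg_zero])] at h1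
    exact D.not_nonpos (map_mem_roots hw.mem (D.mem_roots_of_fin hx))
      (hw.map_nonneg hx0 (D.apply_none x hx)) (by simpa using h1)
  obtain rfl := hv.unique hshort
  refine ⟨u, hpar, ?_, hpos⟩
  rw [← mul_assoc, ← huv, mul_assoc, s_mul_s, mul_one]

/-- The element attached to the smallest ideal with a given simple rootlet. -/
lemma IsShort.isFib (hv : D.IsShort i₀ v) : D.IsFib i₀ (v * D.s none) := by
  refine ⟨mul_mem (mem_W hv.mem) (D.s_mem_par (Set.mem_univ _)), fun i ↦ ?_, ?_⟩
  · by_cases h : D.form (sr (some i)) D.top = 0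
    · rw [LinearEquiv.mul_apply,
        D.s_apply_of_form_eq_zero (by rw [form_sr_none_right, h, neg_zero])]
      exact hv.nonneg _ (D.simple_mem i) (Pi.single_nonneg.mpr zero_le_one) h
    · have h1 := form_sr_top_pos_of_ne i h
      have h2 := co_none_mul (D := D) (sr (some i))
      have h3 : D.co none (sr (some i)) < 0 := by
        by_contra! hc
        have := mul_nonneg hc (form_top_pos (D := D)).le
        lia
      refine D.nonneg_of_apply_pos (map_mem_roots (mul_mem (mem_W hv.mem)
        (D.s_mem_par (Set.mem_univ _))) (D.sr_mem_roots _)) (t := none) ?_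
      rw [LinearEquiv.mul_apply, fin_apply_none hv.mem, s_apply]
      simpa using h3
  · rw [LinearEquiv.mul_apply, s_none_two_imag_sub_top, hv.map_eq]

/-- The element attached to the smallest ideal has the smallest inversion set. -/
lemma IsFib.map_nonpos_of_short (hw : D.IsFib i₀ w) (hv : D.IsShort i₀ v) (hx : x ∈ D.roots)
    (hx0 : 0 ≤ x) (h : (v * D.s none) x ≤ 0) : w x ≤ 0 := by
  obtain ⟨u, hu, rfl, hpos⟩ := hw.exists_factor hv
  have hm := hv.isFib
  have hr := map_mem_roots hm.mem hx
  rw [LinearEquiv.mul_apply]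
  refine (D.nonneg_or_nonpos' (map_mem_roots (mem_W hu) hr)).resolve_left fun h1 ↦ ?_
  have key : ∀ t, t ∉ {t | D.form (sr t) (sr (some i₀)) = 0} → (v * D.s none) x t = 0 := by
    intro t ht
    have h2 := h1 t
    rw [par_apply_of_notMem hu ht] at h2
    exact le_antisymm (h t) h2
  have horth : D.form ((v * D.s none) x) (sr (some i₀)) = 0 := by
    rw [form_eq_sum]
    refine Finset.sum_eq_zero fun t _ ↦ ?_
    by_cases ht : D.form (sr t) (sr (some i₀)) = 0
    · simp [ht]
    · simp [key t ht]
  rw [← hm.map_eq, form_map_map hm.mem] at horth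
  have h3 : D.form x D.top = 0 := by
    rwa [map_sub, map_nsmul, form_imag_right, smul_zero, zero_sub, neg_eq_zero] at horth
  rw [LinearEquiv.mul_apply, D.s_apply_of_form_eq_zero
    (by rw [form_sr_none_right, h3, neg_zero])] at h h1
  have h4 : x none = 0 := by
    have h5 := h none
    rw [fin_apply_none hv.mem] at h5
    exact le_antisymm h5 (hx0 none)
  have h6 : x ∈ D.finRoots := by
    obtain ⟨γ, hγ, k, rfl⟩ := hx
    have : k = 0 := by simpa [D.apply_none γ hγ, D.imag_none] using h4
    simpa [this] using hγ
  exact D.not_nonpos (map_mem_roots (mem_W hv.mem) hx) (hv.nonneg x h6 hx0 h3) h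

end AffineSystem

end AbIdeal

namespace AbIdeal

namespace AffineSystem

variable {S : Type*} [Fintype S] [DecidableEq S] {D : AffineSystem S}
  {w g u v : (Option S → ℤ) ≃ₗ[ℤ] (Option S → ℤ)} {x y : Option S → ℤ} {J : Set (Option S)}
  {i₀ : S}

/-! ### Elements with a maximal inversion set -/

variable (D) in
/-- The element `w` has rootlet `i₀`, and its set of inversions is maximal among the elements with
that rootlet. -/
structure IsMax (i₀ : S) (w : (Option S → ℤ) ≃ₗ[ℤ] (Option S → ℤ)) : Prop where
  isFib : D.IsFib i₀ w
  maximal : ∀ w', D.IsFib i₀ w' → (∀ x ∈ D.roots, 0 ≤ x → w x ≤ 0 → w' x ≤ 0) →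
    ∀ x ∈ D.roots, 0 ≤ x → w' x ≤ 0 → w x ≤ 0

lemma finite_finRoots : D.finRoots.Finite :=
  (Set.finite_Icc (-D.top) D.top).subset fun _ hx ↦ ⟨D.neg_top_le hx, D.le_top' hx⟩

lemma exists_isMax (hv : D.IsShort i₀ v) : ∃ w, D.IsMax i₀ w := by
  let A : ((Option S → ℤ) ≃ₗ[ℤ] (Option S → ℤ)) → Set (Option S → ℤ) :=
    fun w ↦ {x | x ∈ D.roots ∧ 0 ≤ x ∧ w x ≤ 0}
  have hfin : (A '' {w | D.IsFib i₀ w}).Finite := by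
    refine ((D.finite_finRoots.image fun γ ↦ D.imag - γ).finite_subsets).subset ?_
    rintro _ ⟨w, hw, rfl⟩ x ⟨hx, hx0, hx1⟩
    obtain ⟨γ, hγ, -, rfl⟩ := hw.exists_eq_sub hx hx0 hx1
    exact ⟨γ, hγ, rfl⟩
  obtain ⟨m, ⟨⟨w, hw, rfl⟩, hmax⟩⟩ := hfin.exists_maximal ⟨_, _, hv.isFib, rfl⟩
  refine ⟨w, hw, fun w' hw' h x hx hx0 hx1 ↦ ?_⟩
  exact (hmax ⟨w', hw', rfl⟩ (fun y hy ↦ ⟨hy.1, hy.2.1, h y hy.1 hy.2.1 hy.2.2⟩)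
    (show x ∈ A w' from ⟨hx, hx0, hx1⟩)).2.2

lemma co_sr_nonpos {t s : Option S} (h : s ≠ t) : D.co t (sr s) ≤ 0 := by
  have h1 := D.s_nonneg (t := t) (D.sr_mem_roots s) (Pi.single_nonneg.mpr zero_le_one) (by
    intro h'
    have := congrFun h' s
    simp [h] at this) t
  rw [s_apply] at h1
  simpa [h.symm] using h1

lemma form_sr_sr_nonpos {t s : Option S} (h : s ≠ t) : D.form (sr s) (sr t) ≤ 0 := by
  have h1 := D.two_form t (sr s)
  have h2 := co_sr_nonpos (D := D) h
  have h3 := D.form_self_pos (D.sr_mem_roots t)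
  have := mul_nonneg (neg_nonneg.mpr h2) h3.le
  simp only [sr] at *
  lia

omit [Fintype S] in
lemma sr_nonneg (t : Option S) : (0 : Option S → ℤ) ≤ sr t := Pi.single_nonneg.mpr zero_le_one

omit [Fintype S] in
lemma sr_self (t : Option S) : (sr t : Option S → ℤ) t = 1 := Pi.single_eq_same ..

omit [Fintype S] in
lemma sr_ne {t u : Option S} (h : u ≠ t) : (sr t : Option S → ℤ) u = 0 := Pi.single_eq_of_ne h _

omit [Fintype S] in
lemma sr_injective {t u : Option S} (h : (sr t : Option S → ℤ) = sr u) : t = u := by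
  by_contra hne
  have := congrFun h t
  rw [sr_self, sr_ne hne] at this
  simp at this

lemma IsFib.form_map (hw : D.IsFib i₀ w) (x : Option S → ℤ) :
    D.form (w x) (sr (some i₀)) = -D.form x D.top := by
  rw [← hw.map_eq, form_map_map hw.mem, map_sub, map_nsmul, form_imag_right, smul_zero, zero_sub]

/-- For an element with a maximal inversion set, the inverse images `γ + k δ` of the simple roots
other than the rootlet have `k ≤ 0`, and are simple for `k = 0`: otherwise one more simple
reflection would enlarge the inversion set. -/
lemma IsMax.inv_sr (hw : D.IsMax i₀ w) {s : Option S} (hs : s ≠ some i₀) :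
    w⁻¹ (sr s) none ≤ 0 ∧ (w⁻¹ (sr s) none = 0 → ∃ i : S, w⁻¹ (sr s) = sr (some i)) := by
  have hf := hw.isFib
  obtain ⟨γ, hγ, m, hx⟩ := map_mem_roots (inv_mem hf.mem) (D.sr_mem_roots s)
  have hn : w⁻¹ (sr s) none = m := by rw [hx]; simp [D.apply_none γ hγ, D.imag_none]
  have hwx : w (γ + m • D.imag) = sr s := by rw [← hx, apply_inv_self']
  have hwγ : w γ = sr s - m • D.imag := by
    rw [← hwx, map_add, map_smul, map_imag hf.mem]; module
  rw [hn]
  -- if `γ` is positive, then so is `w γ = β - m δ`, where `β` is the simple root with index `s`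
  rcases D.nonneg_or_nonpos γ hγ with h0 | h0
  · have h1 := hf.map_nonneg h0 (D.apply_none γ hγ)
    have hm : m ≤ 0 := by
      obtain ⟨t, ht⟩ : ∃ t : Option S, t ≠ s := by
        rcases eq_or_ne s none with rfl | h
        · exact ⟨some i₀, by simp⟩
        · exact ⟨none, h.symm⟩
      have h2 := h1 t
      have h3 := D.one_le_imag t
      rw [hwγ] at h2
      simp only [Pi.zero_apply, Pi.sub_apply, ne_eq, ht, not_false_eq_true, Pi.single_eq_of_ne,
        Pi.smul_apply, smul_eq_mul, zero_sub] at h2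
      nlinarith
    refine ⟨hm, fun hm0 ↦ ?_⟩
    subst hm0
    rw [zero_smul, add_zero] at hx
    rw [zero_smul, sub_zero] at hwγ
    obtain ⟨t, ht⟩ := exists_eq_sr_of_map (D := D) h0 hwγ fun t ht ↦ by
      cases t with
      | none => simp [D.apply_none γ hγ] at ht
      | some i => exact ⟨map_mem_roots hf.mem (D.sr_mem_roots _), hf.nonneg i⟩
    cases t with
    | none => simpa [ht] using D.apply_none γ hγ
    | some i => exact ⟨i, hx.trans ht⟩
  -- if `γ` is negative, then `m = 1`, and `γ + δ` can be added to the inversion set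
  · exfalso
    have h1 := hf.map_nonneg (x := -γ) (by simpa using h0) (by simp [D.apply_none γ hγ])
    rw [map_neg, hwγ] at h1
    have hm : 1 ≤ m := by
      have h2 := h1 s
      have h3 := D.one_le_imag s
      simp only [Pi.zero_apply, Pi.neg_apply, Pi.sub_apply, Pi.single_eq_same, Pi.smul_apply,
        smul_eq_mul, neg_sub] at h2
      by_contra! h4
      nlinarith
    have horth : D.form (sr s) (sr (some i₀)) = 0 := by
      have h2 := hf.form_map (γ + m • D.imag)
      rw [hwx] at h2
      have h3 := form_top_nonneg (D := D) (x := -γ) (by simpa using h0)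
        (by simp [D.apply_none γ hγ])
      have h4 := form_sr_sr_nonpos (D := D) hs
      rw [map_neg, LinearMap.neg_apply] at h3
      rw [map_add, map_smul, LinearMap.add_apply, LinearMap.smul_apply, D.form_imag, smul_zero,
        add_zero] at h2
      lia
    have hm1 : m = 1 := by
      by_contra hm1
      have h2 : γ + m • D.imag = (2 • D.imag - D.top) + (D.top + γ) + (m - 2) • D.imag := by module
      have h3 := D.neg_top_le hγ
      have h4 : 0 ≤ w (D.top + γ) := by
        refine hf.map_nonneg (fun t ↦ ?_) (by simp [top_none, D.apply_none γ hγ])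
        have := h3 t
        simp only [Pi.neg_apply, Pi.zero_apply, Pi.add_apply] at this ⊢
        lia
      rw [h2, map_add, map_add, hf.map_eq, map_smul, map_imag hf.mem] at hwx
      have h5 := congrFun hwx (some i₀)
      have h6 := h4 (some i₀)
      have h7 := D.one_le_imag (some i₀)
      simp only [Pi.add_apply, Pi.single_eq_same, Pi.smul_apply, smul_eq_mul, ne_eq, hs.symm,
        not_false_eq_true, Pi.single_eq_of_ne, Pi.zero_apply] at h5 h6
      nlinarith [mul_nonneg (show 0 ≤ m - 2 by lia) (show 0 ≤ D.imag (some i₀) by lia)]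
    subst hm1
    set x := γ + (1 : ℤ) • D.imag with hxdef
    have hx1 : x none = 1 := by rw [← hn, hx]
    have hxr : x ∈ D.roots := ⟨γ, hγ, 1, rfl⟩
    have hfib : D.IsFib i₀ (D.s s * w) := by
      refine ⟨mul_mem (D.s_mem_par (Set.mem_univ s)) hf.mem, fun i ↦ ?_, ?_⟩
      · refine D.s_nonneg (map_mem_roots hf.mem (D.sr_mem_roots _)) (hf.nonneg i) fun h ↦ ?_
        rw [← hwx] at h
        have := congrFun (w.injective h) none
        rw [hx1] at this
        simp at this
      · rw [LinearEquiv.mul_apply, hf.map_eq, D.s_apply_of_form_eq_zero]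
        rwa [D.form_comm]
    have hle := hw.maximal _ hfib (fun y hy hy0 hy1 ↦ by
      have h2 := D.s_nonneg (t := s) (x := -w y) (D.neg_mem_roots (map_mem_roots hf.mem hy))
        (by simpa using hy1) (fun h ↦ by
          rw [← hwx, ← map_neg] at h
          have h3 := congrFun (w.injective h) none
          have h4 := hy0 none
          rw [hx1] at h3
          simp only [Pi.neg_apply, Pi.zero_apply] at h3 h4
          lia)
      rw [map_neg] at h2
      simpa using h2) x hxr (D.nonneg_of_apply_pos hxr (t := none) (by lia)) (by
        rw [LinearEquiv.mul_apply, hwx, s_sr]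
        simp)
    rw [hwx] at hle
    exact D.not_nonpos (D.sr_mem_roots s) (sr_nonneg s) hle

lemma apply_none_eq_sum (x : Option S → ℤ) : w⁻¹ x none = ∑ t, x t * w⁻¹ (sr t) none := by
  rw [show w⁻¹ x = ((w⁻¹ : (Option S → ℤ) ≃ₗ[ℤ] (Option S → ℤ)) :
    (Option S → ℤ) →ₗ[ℤ] (Option S → ℤ)) x from rfl, map_eq_sum]
  simp [Finset.sum_apply]

lemma ne_of_form_eq_zero {t : Option S} (h : D.form (sr t) (sr (some i₀)) = 0) : t ≠ some i₀ := by
  rintro rfl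
  exact (D.form_self_pos (D.sr_mem_roots _)).ne' h

/-- A maximal inversion set is the largest one. -/
lemma IsMax.map_nonpos (hw : D.IsMax i₀ w) (hv : D.IsShort i₀ v)
    {w' : (Option S → ℤ) ≃ₗ[ℤ] (Option S → ℤ)} (hw' : D.IsFib i₀ w')
    (hx : x ∈ D.roots) (hx0 : 0 ≤ x) (h : w' x ≤ 0) : w x ≤ 0 := by
  obtain ⟨u, hu, h1, -⟩ := hw.isFib.exists_factor hv
  obtain ⟨u', hu', h2, -⟩ := hw'.exists_factor hv
  obtain ⟨γ, hγ, -, hxγ⟩ := hw'.exists_eq_sub hx hx0 h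
  have hg : w' = (u' * u⁻¹) * w := by rw [h1, h2]; group
  have hmem := mul_mem hu' (inv_mem hu)
  refine (D.nonneg_or_nonpos' (map_mem_roots hw.isFib.mem hx)).resolve_left fun hpos ↦ ?_
  have hn := apply_none_eq_sum (w := w) (w x)
  rw [inv_apply_self', hxγ] at hn
  have : ∑ t, w x t * w⁻¹ (sr t) none ≤ 0 := by
    refine Finset.sum_nonpos fun t _ ↦ ?_
    by_cases ht : D.form (sr t) (sr (some i₀)) = 0
    · exact mul_nonpos_of_nonneg_of_nonpos (hpos t) (hw.inv_sr (ne_of_form_eq_zero ht)).1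
    · have h3 := h t
      rw [hg, LinearEquiv.mul_apply, par_apply_of_notMem hmem (by exact ht)] at h3
      rw [le_antisymm h3 (hpos t)]
      simp
  rw [hxγ, ← hn] at this
  simp [D.imag_none, D.apply_none γ hγ] at this

/-! ### The simple roots that go to simple roots -/

lemma mul_s_none_apply {i : S} (h : D.form (sr (some i)) D.top = 0) :
    (v * D.s none) (sr (some i)) = v (sr (some i)) := by
  rw [LinearEquiv.mul_apply, D.s_apply_of_form_eq_zero (by rw [form_sr_none_right, h, neg_zero])]

lemma IsShort.form_map (hv : D.IsShort i₀ v) (x : Option S → ℤ) :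
    D.form (v x) (sr (some i₀)) = D.form x D.top := by
  rw [← hv.map_eq, form_map_map (mem_W hv.mem)]

lemma IsShort.form_inv (hv : D.IsShort i₀ v) (x : Option S → ℤ) :
    D.form (v⁻¹ x) D.top = D.form x (sr (some i₀)) := by
  rw [← hv.form_map, apply_inv_self']

lemma IsShort.inv_nonneg (hv : D.IsShort i₀ v) {j : S}
    (h : D.form (sr (some j)) (sr (some i₀)) = 0) : 0 ≤ v⁻¹ (sr (some j)) := by
  have hr := map_mem_fin (inv_mem hv.mem) (D.simple_mem j)
  refine (D.nonneg_or_nonpos _ hr).resolve_right fun hneg ↦ ?_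
  have h1 := hv.nonneg _ (D.neg_mem _ hr) (by simpa using hneg)
    (by rw [map_neg, LinearMap.neg_apply, hv.form_inv, h, neg_zero])
  rw [map_neg, apply_inv_self'] at h1
  simp at h1

/-- The inverse of the shortest element takes the simple roots orthogonal to the rootlet to simple
roots orthogonal to `θ`. -/
lemma IsShort.inv_simple (hv : D.IsShort i₀ v) {j : S}
    (h : D.form (sr (some j)) (sr (some i₀)) = 0) :
    ∃ i : S, v⁻¹ (sr (some j)) = sr (some i) ∧ D.form (sr (some i)) D.top = 0 := by
  have hr := map_mem_fin (inv_mem hv.mem) (D.simple_mem j)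
  have hpos := hv.inv_nonneg h
  have hform := hv.form_inv (sr (some j))
  rw [h, form_eq_sum] at hform
  have hterm : ∀ t ∈ Finset.univ, 0 ≤ v⁻¹ (sr (some j)) t * D.form (sr t) D.top := by
    intro t _
    cases t with
    | none => rw [D.apply_none _ hr, zero_mul]
    | some i => exact mul_nonneg (hpos _) (form_simple_top_nonneg i)
  have hz := (Finset.sum_eq_zero_iff_of_nonneg hterm).mp hform
  obtain ⟨t, ht⟩ := exists_eq_sr_of_map (D := D) (g := v) hpos (apply_inv_self' ..) fun t ht ↦ by
    have h1 := hz t (Finset.mem_univ t)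
    cases t with
    | none => rw [D.apply_none _ hr] at ht; exact absurd ht (lt_irrefl _)
    | some i =>
      refine ⟨map_mem_roots (mem_W hv.mem) (D.sr_mem_roots _),
        hv.nonneg _ (D.simple_mem i) (sr_nonneg _) ?_⟩
      rcases mul_eq_zero.mp h1 with h2 | h2
      · lia
      · exact h2
  cases t with
  | none =>
    have := D.apply_none _ hr
    rw [ht] at this
    simp at this
  | some i =>
    refine ⟨i, ht, ?_⟩
    rw [← ht, hv.form_inv, h]

/-- A simple root orthogonal to `θ` that goes to a simple root under an element with rootlet `i₀`
already goes to a simple root under the shortest element. -/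
lemma IsFib.map_simple_of_map (hw : D.IsFib i₀ w) (hv : D.IsShort i₀ v) {i : S} {s : Option S}
    (h : D.form (sr (some i)) D.top = 0) (hs : w (sr (some i)) = sr s) :
    ∃ j : S, v (sr (some i)) = sr (some j) := by
  obtain ⟨u, hu, h1, -⟩ := hw.exists_factor hv
  have hs0 : D.form (sr s) (sr (some i₀)) = 0 := by rw [← hs, hw.form_map, h, neg_zero]
  have hvi : v (sr (some i)) = u⁻¹ (sr s) := by
    rw [eq_comm, inv_apply_eq, ← hs, h1, LinearEquiv.mul_apply, mul_s_none_apply h]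
  have hpos : 0 ≤ v (sr (some i)) := hv.nonneg _ (D.simple_mem i) (sr_nonneg _) h
  have hn : v (sr (some i)) none = 0 := by simp [fin_apply_none hv.mem]
  obtain ⟨t, ht⟩ := exists_eq_sr_of_map (D := D) (g := v⁻¹) hpos (inv_apply_self' ..) fun t ht ↦ by
    have ht0 : D.form (sr t) (sr (some i₀)) = 0 := by
      by_contra hne
      rw [hvi, par_apply_of_notMem (inv_mem hu) (by exact hne)] at ht
      have : t ≠ s := by rintro rfl; exact hne hs0
      simp [this] at ht
    cases t with
    | none => rw [hn] at ht; exact absurd ht (lt_irrefl _)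
    | some j =>
      exact ⟨map_mem_roots (inv_mem (mem_W hv.mem)) (D.sr_mem_roots _), hv.inv_nonneg ht0⟩
  cases t with
  | none => rw [ht] at hn; simp at hn
  | some j => exact ⟨j, ht⟩

/-- The converse of `IsFib.map_simple_of_map` for maximal inversion sets. -/
lemma IsMax.map_simple (hw : D.IsMax i₀ w) (hv : D.IsShort i₀ v) {i j : S}
    (h : D.form (sr (some i)) D.top = 0) (hj : v (sr (some i)) = sr (some j)) :
    ∃ s, w (sr (some i)) = sr s := by
  obtain ⟨u, hu, h1, -⟩ := hw.isFib.exists_factor hv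
  have hj0 : D.form (sr (some j)) (sr (some i₀)) = 0 := by rw [← hj, hv.form_map, h]
  have hwi : w (sr (some i)) = u (sr (some j)) := by
    rw [h1, LinearEquiv.mul_apply, mul_s_none_apply h, hj]
  have hpos := hw.isFib.nonneg i
  have hout : ∀ t, 0 < w (sr (some i)) t → D.form (sr t) (sr (some i₀)) = 0 := by
    intro t ht
    by_contra hne
    rw [hwi, par_apply_of_notMem hu (by exact hne)] at ht
    have : t ≠ some j := by rintro rfl; exact hne hj0
    simp [this] at ht
  have hn := apply_none_eq_sum (w := w) (w (sr (some i)))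
  rw [inv_apply_self'] at hn
  have hn0 : ∑ t, -(w (sr (some i)) t * w⁻¹ (sr t) none) = 0 := by
    rw [Finset.sum_neg_distrib, ← hn]; simp
  have hterm : ∀ t ∈ Finset.univ, 0 ≤ -(w (sr (some i)) t * w⁻¹ (sr t) none) := by
    intro t _
    rcases (hpos t).eq_or_lt with h0 | h0
    · rw [← h0]; simp
    · have := (hw.inv_sr (ne_of_form_eq_zero (hout t h0))).1
      exact neg_nonneg.mpr (mul_nonpos_of_nonneg_of_nonpos (hpos t) this)
  have hz := (Finset.sum_eq_zero_iff_of_nonneg hterm).mp hn0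
  refine exists_eq_sr_of_map (D := D) (g := w⁻¹) hpos (inv_apply_self' ..) fun t ht ↦ ?_
  have h2 := hz t (Finset.mem_univ t)
  have h3 : w⁻¹ (sr t) none = 0 := by
    rcases mul_eq_zero.mp (neg_eq_zero.mp h2) with h4 | h4
    · lia
    · exact h4
  obtain ⟨k, hk⟩ := (hw.inv_sr (ne_of_form_eq_zero (hout t ht))).2 h3
  rw [hk]
  exact ⟨D.sr_mem_roots _, sr_nonneg _⟩

lemma IsShort.form_self (hv : D.IsShort i₀ v) :
    D.form (sr (some i₀)) (sr (some i₀)) = D.form D.top D.top := by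
  rw [← hv.map_eq, form_map_map (mem_W hv.mem)]

lemma co_none_neg {i : S} (h : D.form (sr (some i)) D.top ≠ 0) : D.co none (sr (some i)) < 0 := by
  have h1 := form_sr_top_pos_of_ne i h
  have h2 := co_none_mul (D := D) (sr (some i))
  by_contra! hc
  have := mul_nonneg hc (form_top_pos (D := D)).le
  lia

/-- If the element attached to the smallest ideal takes a simple root that is not orthogonal to `θ`
to an affine simple root, then to `α₀`, because the coefficient of `δ` in the image is positive. -/
lemma IsShort.map_simple_of_ne (hv : D.IsShort i₀ v) {i : S} {s : Option S}
    (h : D.form (sr (some i)) D.top ≠ 0) (hs : (v * D.s none) (sr (some i)) = sr s) :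
    D.co none (sr (some i)) = -1 ∧ v (sr (some i)) = sr (some i₀) - D.top := by
  have hc := co_none_neg h
  have h1 : v (sr (some i)) - D.co none (sr (some i)) • (D.imag - sr (some i₀)) = sr s := by
    rw [← hs, LinearEquiv.mul_apply, s_apply, map_sub, map_smul, sr_none_eq (D := D), map_sub,
      map_imag (mem_W hv.mem), hv.map_eq]
  have hn := congrFun h1 none
  have hv0 : v (sr (some i)) none = 0 := by simp [fin_apply_none hv.mem]
  simp only [Pi.sub_apply, Pi.smul_apply, hv0, D.imag_none, smul_eq_mul, ne_eq, reduceCtorEq,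
    not_false_eq_true, Pi.single_eq_of_ne, sub_zero, mul_one, zero_sub] at hn
  have hs0 : s = none := by
    by_contra hne
    rw [sr_ne (Ne.symm hne)] at hn
    lia
  subst hs0
  rw [sr_self] at hn
  have hc1 : D.co none (sr (some i)) = -1 := by lia
  refine ⟨hc1, ?_⟩
  rw [hc1, sr_none_eq (D := D)] at h1
  calc v (sr (some i)) = (v (sr (some i)) - (-1 : ℤ) • (D.imag - sr (some i₀)))
        + (sr (some i₀) - D.imag) := by module
    _ = _ := by rw [h1]; module

/-- If the rootlet is orthogonal to `θ`, then the element attached to the smallest ideal takes no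
simple root that is not orthogonal to `θ` to a simple root. -/
lemma IsShort.not_map_simple (hv : D.IsShort i₀ v) (horth : D.form (sr (some i₀)) D.top = 0) {i : S}
    (h : D.form (sr (some i)) D.top ≠ 0) : ¬ ∃ s, (v * D.s none) (sr (some i)) = sr s := by
  rintro ⟨s, hs⟩
  obtain ⟨h1, h2⟩ := hv.map_simple_of_ne h hs
  have h3 := hv.form_map (sr (some i))
  rw [h2, map_sub, LinearMap.sub_apply, hv.form_self, D.form_comm D.top (sr (some i₀)), horth,
    sub_zero] at h3
  have h4 := co_none_mul (D := D) (sr (some i))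
  have h5 := form_top_pos (D := D)
  rw [h1, ← h3] at h4
  lia

lemma top_apply (i : S) : D.top (some i) = D.imag (some i) := by simp [top]

/-- The coroot of a simple root in the Weyl group orbit of `θ` pairs to `0` or `-1` with the other
affine simple roots, except in rank one. -/
lemma IsShort.co_mem (hv : D.IsShort i₀ v) (hne : D.top ≠ sr (some i₀)) {s : Option S}
    (hs : s ≠ some i₀) : D.co (some i₀) (sr s) = 0 ∨ D.co (some i₀) (sr s) = -1 := by
  have hco : ∀ x, D.co (some i₀) x = -D.co none (v⁻¹ x) := by
    intro x
    have h1 := D.two_form (some i₀) x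
    have h2 := co_none_mul (D := D) (v⁻¹ x)
    rw [hv.form_inv] at h2
    have h3 := hv.form_self
    simp only [sr] at h2 h3
    rw [h3] at h1
    refine mul_right_cancel₀ (form_top_pos (D := D)).ne' ?_
    rw [neg_mul, h2, ← h1]
    ring
  have hneg : D.top ≠ -sr (some i₀) := by
    intro h
    have h1 := congrFun h (some i₀)
    have h2 := D.one_le_imag (some i₀)
    rw [top_apply] at h1
    simp at h1
    lia
  have habs : |D.co (some i₀) (sr s)| ≤ 1 := by
    rw [hco, abs_neg]
    cases s with
    | some j =>
      refine D.abs_co_none_le _ (map_mem_fin (inv_mem hv.mem) (D.simple_mem j)) ?_ ?_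
      · intro h
        rw [inv_apply_eq, show D.imag - Pi.single none 1 = D.top from rfl, hv.map_eq] at h
        exact hs (sr_injective h)
      · intro h
        rw [inv_apply_eq, show D.imag - Pi.single none 1 = D.top from rfl, map_neg,
          hv.map_eq] at h
        have := congrFun h (some j)
        rw [sr_self, Pi.neg_apply, sr_ne hs] at this
        simp at this
    | none =>
      rw [sr_none_eq (D := D), map_sub, map_imag (inv_mem (mem_W hv.mem)), map_sub, co_imag,
        zero_sub, abs_neg]
      refine D.abs_co_none_le _ (map_mem_fin (inv_mem hv.mem) D.top_mem_finRoots) ?_ ?_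
      · intro h
        rw [inv_apply_eq, show D.imag - Pi.single none 1 = D.top from rfl, hv.map_eq] at h
        exact hne h
      · intro h
        rw [inv_apply_eq, show D.imag - Pi.single none 1 = D.top from rfl, map_neg,
          hv.map_eq] at h
        exact hneg h
  have := co_sr_nonpos (D := D) hs
  have := (abs_le.mp habs).1
  lia

/-- Expanding the basic imaginary root in terms of the images of the simple roots under `w⁻¹`, and
comparing the coefficients of `δ` and the pairings with the rootlet. -/
lemma IsFib.sum_eq_one (hw : D.IsFib i₀ w) :
    ∑ s, D.imag s * (w⁻¹ (sr s) none - D.co (some i₀) (sr s)) = 1 := by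
  have h1 := apply_none_eq_sum (w := w) D.imag
  rw [map_imag (inv_mem hw.mem), D.imag_none] at h1
  have h2 : D.co (some i₀) D.imag = ∑ s, D.imag s * D.co (some i₀) (sr s) := by
    conv_lhs => rw [← Finset.univ_sum_single D.imag, map_sum]
    refine Finset.sum_congr rfl fun s _ ↦ ?_
    rw [← smul_eq_mul, ← map_smul]
    congr 1
    ext t
    by_cases h : t = s <;> simp [h]
  rw [co_imag] at h2
  simp only [mul_sub, Finset.sum_sub_distrib, ← h1, ← h2, sub_zero]

lemma IsFib.inv_rootlet_none (hw : D.IsFib i₀ w) : w⁻¹ (sr (some i₀)) none = 2 := by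
  rw [← hw.map_eq, inv_apply_self']
  simp [D.imag_none, top_none]

lemma IsMax.term_le (hw : D.IsMax i₀ w) (hv : D.IsShort i₀ v) (hne : D.top ≠ sr (some i₀))
    (s : Option S) : w⁻¹ (sr s) none - D.co (some i₀) (sr s) ≤ 1 := by
  rcases eq_or_ne s (some i₀) with rfl | hs
  · rw [hw.isFib.inv_rootlet_none, co_sr_self]; lia
  · have := (hw.inv_sr hs).1
    have := hv.co_mem hne hs
    lia

lemma IsMax.exists_of_term_pos (hw : D.IsMax i₀ w) (hv : D.IsShort i₀ v)
    (hne : D.top ≠ sr (some i₀)) {s : Option S}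
    (h : 0 < w⁻¹ (sr s) none - D.co (some i₀) (sr s)) :
    ∃ i : S, w (sr (some i)) = sr s ∧ D.form (sr (some i)) D.top ≠ 0 := by
  have hs : s ≠ some i₀ := by
    rintro rfl
    rw [hw.isFib.inv_rootlet_none, co_sr_self] at h
    lia
  have h1 := hw.inv_sr hs
  have h2 := hv.co_mem hne hs
  obtain ⟨i, hi⟩ := h1.2 (by lia)
  have hwi : w (sr (some i)) = sr s := by rw [← hi, apply_inv_self']
  refine ⟨i, hwi, fun h0 ↦ ?_⟩
  have h3 := hw.isFib.form_map (sr (some i))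
  rw [hwi, h0, neg_zero, ← co_eq_zero_iff] at h3
  lia

/-- For a maximal inversion set, some simple root not orthogonal to `θ` goes to a simple root. -/
lemma IsMax.exists_map_simple (hw : D.IsMax i₀ w) (hv : D.IsShort i₀ v)
    (hne : D.top ≠ sr (some i₀)) :
    ∃ i s, w (sr (some i)) = sr s ∧ D.form (sr (some i)) D.top ≠ 0 := by
  obtain ⟨s, hs⟩ : ∃ s, 0 < w⁻¹ (sr s) none - D.co (some i₀) (sr s) := by
    by_contra! h
    have h1 := hw.isFib.sum_eq_one
    have : ∑ s, D.imag s * (w⁻¹ (sr s) none - D.co (some i₀) (sr s)) ≤ 0 :=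
      Finset.sum_nonpos fun s _ ↦ mul_nonpos_of_nonneg_of_nonpos
        (zero_le_one.trans (D.one_le_imag s)) (h s)
    lia
  obtain ⟨i, hi⟩ := hw.exists_of_term_pos hv hne hs
  exact ⟨i, s, hi⟩

/-- For a rootlet orthogonal to `θ`, some affine simple root orthogonal to the rootlet is an
inversion of the inverse of the element with a maximal inversion set. -/
lemma IsMax.exists_inv_none_neg (hw : D.IsMax i₀ w) (hv : D.IsShort i₀ v)
    (horth : D.form (sr (some i₀)) D.top = 0) :
    ∃ t, D.form (sr t) (sr (some i₀)) = 0 ∧ w⁻¹ (sr t) none < 0 := by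
  obtain ⟨u, hu, h1, -⟩ := hw.isFib.exists_factor hv
  have hform : D.form (v⁻¹ D.top) D.top = 0 := by rw [hv.form_inv, D.form_comm, horth]
  have h2 : w⁻¹ (u (sr none)) = D.imag - v⁻¹ D.top := by
    rw [inv_apply_eq, h1, LinearEquiv.mul_apply, LinearEquiv.mul_apply, map_sub, s_imag,
      D.s_apply_of_form_eq_zero (by rw [form_sr_none_right, hform, neg_zero]), map_sub,
      map_imag (mem_W hv.mem), apply_inv_self', ← sr_none_eq]
  by_contra! hcon
  have h3 := apply_none_eq_sum (w := w) (u (sr none))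
  rw [h2, Finset.sum_eq_zero fun t _ ↦ ?_] at h3
  · rw [Pi.sub_apply, fin_apply_none (inv_mem hv.mem), top_none, D.imag_none] at h3
    simp at h3
  · by_cases ht : D.form (sr t) (sr (some i₀)) = 0
    · have h4 := (hw.inv_sr (ne_of_form_eq_zero ht)).1
      rw [le_antisymm h4 (hcon t ht), mul_zero]
    · rw [par_apply_of_notMem hu (by exact ht), sr_ne, zero_mul]
      rintro rfl
      apply ht
      rw [form_sr_none_left, D.form_comm, horth, neg_zero]

/-- If all coefficients of `θ` are one and the rootlet is orthogonal to `θ`, then at least two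
simple roots not orthogonal to `θ` go to simple roots. -/
lemma IsMax.exists_two_map_simple (hw : D.IsMax i₀ w) (hv : D.IsShort i₀ v)
    (horth : D.form (sr (some i₀)) D.top = 0) (hone : ∀ t, D.imag t = 1) :
    ∃ i i', i ≠ i' ∧ ((∃ s, w (sr (some i)) = sr s) ∧ D.form (sr (some i)) D.top ≠ 0) ∧
      ((∃ s, w (sr (some i')) = sr s) ∧ D.form (sr (some i')) D.top ≠ 0) := by
  have hne : D.top ≠ sr (some i₀) := by
    intro h
    rw [← h] at horth
    exact (form_top_pos (D := D)).ne' horth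
  -- the sum of terms `≤ 1`, one of them negative, equals one
  obtain ⟨t, ht, htn⟩ := hw.exists_inv_none_neg hv horth
  have hsum := hw.isFib.sum_eq_one
  simp only [hone, one_mul] at hsum
  have hft : w⁻¹ (sr t) none - D.co (some i₀) (sr t) ≤ -1 := by
    rw [(D.co_eq_zero_iff _ _).mpr ht]; lia
  obtain ⟨s₁, hs₁⟩ : ∃ s, 0 < w⁻¹ (sr s) none - D.co (some i₀) (sr s) := by
    by_contra! h
    have := Finset.sum_nonpos fun s (_ : s ∈ Finset.univ) ↦ h s
    lia
  obtain ⟨s₂, hs₂, hne₂⟩ : ∃ s, 0 < w⁻¹ (sr s) none - D.co (some i₀) (sr s) ∧ s ≠ s₁ := by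
    by_contra! h
    have hts : t ≠ s₁ := by rintro rfl; lia
    have : ∑ s, (w⁻¹ (sr s) none - D.co (some i₀) (sr s)) ≤
        ∑ s, ((sr s₁ : Option S → ℤ) s - (sr t : Option S → ℤ) s) := by
      refine Finset.sum_le_sum fun s _ ↦ ?_
      rcases eq_or_ne s s₁ with rfl | h1
      · have := hw.term_le hv hne s
        rw [sr_self, sr_ne hts.symm]
        lia
      · rw [sr_ne h1]
        rcases eq_or_ne s t with rfl | h2
        · rw [sr_self]; lia
        · rw [sr_ne h2]
          by_contra! h3
          exact h1 (h s (by lia))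
    rw [hsum] at this
    simp [sr] at this
  obtain ⟨i, hi, hi'⟩ := hw.exists_of_term_pos hv hne hs₁
  obtain ⟨j, hj, hj'⟩ := hw.exists_of_term_pos hv hne hs₂
  refine ⟨i, j, ?_, ⟨⟨s₁, hi⟩, hi'⟩, ⟨⟨s₂, hj⟩, hj'⟩⟩
  rintro rfl
  rw [hi] at hj
  exact hne₂ (sr_injective hj).symm

/-- At most two simple roots are not orthogonal to `θ`. -/
lemma eq_or_eq_of_form_ne {i i' j : S} (hne : i ≠ i') (hi : D.form (sr (some i)) D.top ≠ 0)
    (hi' : D.form (sr (some i')) D.top ≠ 0) (hj : D.form (sr (some j)) D.top ≠ 0) :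
    j = i ∨ j = i' := by
  -- `⟨θ, θ^∨⟩ = 2`, and each simple root not orthogonal to `θ` contributes at least one
  by_contra! hcon
  have h2 : D.co none D.top = ∑ s, D.top s * D.co none (sr s) := by
    conv_lhs => rw [← Finset.univ_sum_single D.top, map_sum]
    refine Finset.sum_congr rfl fun s _ ↦ ?_
    rw [← smul_eq_mul, ← map_smul]
    congr 1
    ext t
    by_cases h : t = s <;> simp [h]
  rw [co_none_top, Fintype.sum_option, top_none, zero_mul, zero_add] at h2
  have h3 : ∑ s : S, D.top (some s) * D.co none (sr (some s)) ≤
      ∑ s ∈ ({i, i', j} : Finset S), D.top (some s) * D.co none (sr (some s)) := by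
    rw [← neg_le_neg_iff, ← Finset.sum_neg_distrib, ← Finset.sum_neg_distrib]
    refine Finset.sum_le_sum_of_subset_of_nonneg (Finset.subset_univ _) fun s _ _ ↦ ?_
    have h4 := D.one_le_imag (some s)
    rw [← top_apply] at h4
    have h5 := co_sr_nonpos (D := D) (t := none) (s := some s) (by simp)
    exact neg_nonneg.mpr (mul_nonpos_of_nonneg_of_nonpos (by lia) h5)
  have h6 : ∀ k, D.form (sr (some k)) D.top ≠ 0 →
      D.top (some k) * D.co none (sr (some k)) ≤ -1 := by
    intro k hk
    have h4 := D.one_le_imag (some k)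
    rw [← top_apply] at h4
    have := co_none_neg hk
    nlinarith
  rw [Finset.sum_insert (by simp [hne, hcon.1.symm]), Finset.sum_insert (by simp [hcon.2.symm]),
    Finset.sum_singleton] at h3
  have := h6 i hi
  have := h6 i' hi'
  have := h6 j hj
  lia

/-- If the rootlet is not orthogonal to `θ`, there is only one element with that rootlet. -/
lemma IsFib.eq_of_not_orthogonal (hw : D.IsFib i₀ w) (hv : D.IsShort i₀ v)
    (h : D.form (sr (some i₀)) D.top ≠ 0) : w = v * D.s none := by
  obtain ⟨u, hu, h1, hpos⟩ := hw.exists_factor hv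
  have hnone : none ∉ {t | D.form (sr t) (sr (some i₀)) = 0} := by
    simp only [Set.mem_ofPred_eq, form_sr_none_left, neg_eq_zero]
    rwa [D.form_comm]
  suffices u = 1 by rw [h1, this, one_mul]
  refine eq_one_of_nonneg (mem_W hu) fun t ↦ ?_
  cases t with
  | some i => exact hpos i
  | none =>
    refine D.nonneg_of_apply_pos (map_mem_roots (mem_W hu) (D.sr_mem_roots _)) (t := none) ?_
    rw [par_apply_of_notMem hu hnone]
    simp

/-- If `θ` is orthogonal to all simple roots except the rootlet `α`, and the shortest element takes
`α` to `α - θ`, then it permutes the simple roots orthogonal to `α`. -/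
lemma IsShort.map_simple_iff (hv : D.IsShort i₀ v)
    (hsingle : ∀ i, D.form (sr (some i)) D.top ≠ 0 → i = i₀)
    (hmap : v (sr (some i₀)) = sr (some i₀) - D.top) (i : S) :
    (D.form (sr (some i)) D.top = 0 ∧ ∃ j : S, v (sr (some i)) = sr (some j)) ↔
      D.form (sr (some i)) (sr (some i₀)) = 0 := by
  have hperp : ∀ j : S, D.form (sr (some j)) (sr (some i₀)) = 0 →
      D.form (sr (some j)) D.top = 0 := by
    intro j hj
    by_contra h
    rw [hsingle j h] at hj
    exact (D.form_self_pos (D.sr_mem_roots _)).ne' hj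
  have htop : v (D.top - sr (some i₀)) = D.top := by
    rw [map_sub, hv.map_eq, hmap]; abel
  have hJ : ∀ j : S, D.form (sr (some j)) (sr (some i₀)) = 0 →
      ∃ k : S, v⁻¹ (sr (some j)) = sr (some k) ∧ D.form (sr (some k)) (sr (some i₀)) = 0 := by
    intro j hj
    obtain ⟨k, hk, hk'⟩ := hv.inv_simple hj
    refine ⟨k, hk, ?_⟩
    have h1 := form_map_map (mem_W hv.mem) (v⁻¹ (sr (some j))) (D.top - sr (some i₀))
    rw [htop, apply_inv_self', hperp j hj, hk, map_sub, hk', zero_sub] at h1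
    lia
  constructor
  · rintro ⟨h, j, hj⟩
    have hj0 : D.form (sr (some j)) (sr (some i₀)) = 0 := by rw [← hj, hv.form_map, h]
    obtain ⟨k, hk, hk'⟩ := hJ j hj0
    rw [inv_apply_eq, ← hj] at hk
    rwa [v.injective hk]
  · intro h
    refine ⟨hperp i h, ?_⟩
    choose φ hφ hφ' using hJ
    let ψ : {j : S // D.form (sr (some j)) (sr (some i₀)) = 0} →
        {j : S // D.form (sr (some j)) (sr (some i₀)) = 0} := fun j ↦ ⟨φ j.1 j.2, hφ' j.1 j.2⟩
    have hψ : Function.Injective ψ := by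
      intro j k hjk
      have h1 : φ j.1 j.2 = φ k.1 k.2 := congrArg Subtype.val hjk
      have h2 : v⁻¹ (sr (some j.1)) = v⁻¹ (sr (some k.1)) := by rw [hφ j.1 j.2, hφ k.1 k.2, h1]
      exact Subtype.ext (Option.some_injective _ (sr_injective ((v⁻¹).injective h2)))
    obtain ⟨j, hj⟩ := Finite.surjective_of_injective hψ ⟨i, h⟩
    refine ⟨j.1, ?_⟩
    have h1 := hφ j.1 j.2
    rw [show φ j.1 j.2 = i from congrArg Subtype.val hj, inv_apply_eq] at h1
    exact h1.symm

/-! ### Stability of inversion sets under simple reflections -/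

lemma imag_sub_mem_roots {γ : Option S → ℤ} (hγ : γ ∈ D.finRoots) : D.imag - γ ∈ D.roots :=
  ⟨-γ, D.neg_mem γ hγ, 1, by module⟩

lemma imag_sub_nonneg {γ : Option S → ℤ} (hγ : γ ∈ D.finRoots) : 0 ≤ D.imag - γ := by
  have := D.imag_add_nonneg (D.neg_mem γ hγ) le_rfl
  rwa [one_smul, neg_add_eq_sub] at this

/-- If `w` takes a simple root `α` to a simple root, then `α` can be subtracted within the set of all
`γ` for which `δ - γ` is an inversion. -/
lemma IsFib.sub_mem (hw : D.IsFib i₀ w) {i : S} {s : Option S} (hs : w (sr (some i)) = sr s)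
    {γ : Option S → ℤ} (hγ : w (D.imag - γ) ≤ 0)
    (hγi : γ - sr (some i) ∈ D.finRoots) : w (D.imag - (γ - sr (some i))) ≤ 0 := by
  have hr := map_mem_roots hw.mem (imag_sub_mem_roots hγi)
  refine (D.nonneg_or_nonpos' hr).resolve_left fun hpos ↦ ?_
  have h1 : w (D.imag - (γ - sr (some i))) = w (D.imag - γ) + sr s := by
    rw [← hs, ← map_add]; congr 1; abel
  have h2 : w (D.imag - (γ - sr (some i))) = (w (D.imag - (γ - sr (some i))) s) • sr s := by
    ext t
    rcases eq_or_ne t s with rfl | ht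
    · simp
    · have h3 := hpos t
      have h4 := hγ t
      rw [h1] at h3 ⊢
      simp only [Pi.zero_apply, Pi.add_apply, sr_ne ht, add_zero, Pi.smul_apply, smul_zero] at *
      lia
  have h3 := hγ s
  have h4 := hpos s
  rw [h1, Pi.add_apply, sr_self] at h4
  rw [Pi.zero_apply] at h3 h4
  have h5 : w (D.imag - (γ - sr (some i))) s = 1 := by
    rw [h2] at hr
    have := D.reduced' hr
    rw [h1, Pi.add_apply, sr_self] at this ⊢
    lia
  have h6 : w (D.imag - (γ - sr (some i))) = w (sr (some i)) := by rw [h2, h5, one_smul, hs]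
  have h7 := congrFun (w.injective h6) none
  rw [Pi.sub_apply, D.apply_none _ hγi, D.imag_none, sr_ne (by simp)] at h7
  simp at h7

lemma IsFib.not_simple_mem (hw : D.IsFib i₀ w) {i : S} {s : Option S}
    (hs : w (sr (some i)) = sr s) : ¬ w (D.imag - sr (some i)) ≤ 0 := by
  intro h
  have hr := map_mem_roots hw.mem (imag_sub_mem_roots (D.simple_mem i))
  refine D.not_nonpos hr ?_ h
  rw [map_sub, map_imag hw.mem, hs]
  intro t
  rcases eq_or_ne t s with rfl | ht
  · have := D.one_le_imag t
    rw [Pi.sub_apply, sr_self]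
    simpa using this
  · have := D.one_le_imag t
    rw [Pi.sub_apply, sr_ne ht, Pi.zero_apply]
    lia

/-- If the set of all `γ` for which `δ - γ` is an inversion of `w` is stable under a simple
reflection, then `w` takes the corresponding simple root to a simple root. -/
lemma IsFib.exists_map_simple (hw : D.IsFib i₀ w) {i : S}
    (h : ∀ γ ∈ D.finRoots, w (D.imag - γ) ≤ 0 → w (D.imag - D.s (some i) γ) ≤ 0) :
    ∃ s, w (sr (some i)) = sr s := by
  by_contra! hcon
  have hwi := D.s_mem_par (J := Set.univ) (Set.mem_univ (some i))
  have hg : w * D.s (some i) * w⁻¹ ∈ D.W := mul_mem (mul_mem hw.mem hwi) (inv_mem hw.mem)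
  have hgν : (w * D.s (some i) * w⁻¹) (w (sr (some i))) = -w (sr (some i)) := by
    rw [LinearEquiv.mul_apply, inv_apply_self', LinearEquiv.mul_apply, s_sr, map_neg]
  have hstab : ∀ x ∈ D.roots, 0 ≤ x → w x ≤ 0 → w (D.s (some i) x) ≤ 0 := by
    intro x hx hx0 hx1
    obtain ⟨γ, hγ, -, rfl⟩ := hw.exists_eq_sub hx hx0 hx1
    rw [map_sub, s_imag]
    exact h γ hγ hx1
  -- the reflection in `w αᵢ` would take all simple roots in the support of `w αᵢ` to positive roots
  have hpos : 0 ≤ (w * D.s (some i) * w⁻¹) (w (sr (some i))) := by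
    refine map_nonneg_of (hw.nonneg i) fun t _ ↦ ?_
    rw [LinearEquiv.mul_apply, LinearEquiv.mul_apply]
    set η := w⁻¹ (sr t) with hη
    have hwη : w η = sr t := apply_inv_self' ..
    have hr : η ∈ D.roots := map_mem_roots (inv_mem hw.mem) (D.sr_mem_roots t)
    have hr' := D.s_mem_roots (some i) hr
    refine (D.nonneg_or_nonpos' (map_mem_roots hw.mem hr')).resolve_right fun hneg ↦ ?_
    rcases D.nonneg_or_nonpos' hr with h0 | h0
    · have hne : η ≠ sr (some i) := by
        intro he
        rw [he] at hwη
        exact hcon t hwη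
      have h1 := hstab _ hr' (D.s_nonneg hr h0 hne) hneg
      rw [s_s, hwη] at h1
      exact D.not_nonpos (D.sr_mem_roots t) (sr_nonneg t) h1
    · have h1 := hstab (-η) (D.neg_mem_roots hr) (by simpa using h0) (by
        rw [map_neg, hwη]; simp)
      rw [map_neg, map_neg] at h1
      exact D.not_nonpos (map_mem_roots hw.mem hr') (by simpa using h1) hneg
  rw [hgν] at hpos
  exact D.not_nonpos (map_mem_roots hw.mem (D.sr_mem_roots _)) (hw.nonneg i) (by simpa using hpos)

end AffineSystem

end AbIdeal

namespace AbIdeal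

section RootPairing

variable {ι K M N : Type*} [Fintype ι] [DecidableEq ι] [Field K] [CharZero K] [AddCommGroup M]
  [Module K M] [AddCommGroup N] [Module K N] {P : RootPairing ι K M N} [P.IsCrystallographic]

/-! ### The lattice model attached to a root system -/

/-- The coordinates of an element of the root lattice with respect to a base, as a vector whose
coordinate at the additional affine simple root vanishes. -/
noncomputable def coordMap (b : P.Base) : P.rootSpan ℤ →ₗ[ℤ] (Option b.support → ℤ) :=
  LinearMap.pi fun t ↦ t.elim 0 fun i ↦ b.toWeightBasisInt.coord i

/-- The coordinate vector of a root with respect to a base. -/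
noncomputable def vec (b : P.Base) (γ : ι) : Option b.support → ℤ := coordMap b (P.rootSpanMem ℤ γ)

/-- The linear map from the lattice spanned by the affine simple roots to the root lattice, with
kernel spanned by the basic imaginary root. It sends the additional affine simple root to `-θ`. -/
noncomputable def toRootSpan (b : P.Base) (θ : ι) : (Option b.support → ℤ) →ₗ[ℤ] P.rootSpan ℤ :=
  b.toWeightBasisInt.equivFun.symm.toLinearMap ∘ₗ LinearMap.funLeft ℤ ℤ some -
    (LinearMap.proj none).smulRight (P.rootSpanMem ℤ θ)

variable (b : P.Base) (θ : ι)

@[simp] lemma coordMap_none (x : P.rootSpan ℤ) : coordMap b x none = 0 := rfl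

@[simp] lemma coordMap_some (x : P.rootSpan ℤ) (i : b.support) :
    coordMap b x (some i) = b.toWeightBasisInt.repr x i := rfl

@[simp] lemma vec_none (γ : ι) : vec b γ none = 0 := rfl

lemma toRootSpan_apply (x : Option b.support → ℤ) :
    toRootSpan b θ x = b.toWeightBasisInt.equivFun.symm (x ∘ some) -
      x none • P.rootSpanMem ℤ θ := rfl

@[simp] lemma toRootSpan_coordMap (x : P.rootSpan ℤ) : toRootSpan b θ (coordMap b x) = x := by
  rw [toRootSpan_apply, coordMap_none, zero_smul, sub_zero]
  exact b.toWeightBasisInt.equivFun.symm_apply_apply x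

@[simp] lemma toRootSpan_vec (γ : ι) : toRootSpan b θ (vec b γ) = P.rootSpanMem ℤ γ :=
  toRootSpan_coordMap b θ _

lemma vec_eq_add {i j k : ι} {n : ℤ} (h : P.root k = P.root i + n • P.root j) :
    vec b k = vec b i + n • vec b j := by
  have : P.rootSpanMem ℤ k = P.rootSpanMem ℤ i + n • P.rootSpanMem ℤ j := Subtype.ext (by simpa)
  rw [vec, this, map_add, map_smul]; rfl

lemma vec_injective : Function.Injective (vec b) := fun i j h ↦ by
  have h1 := congrArg (toRootSpan b i) h
  rw [toRootSpan_vec, toRootSpan_vec] at h1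
  exact P.root.injective (by simpa using congrArg Subtype.val h1)

lemma vec_simple (i : b.support) : vec b i = Pi.single (some i) 1 := by
  have : P.rootSpanMem ℤ i = b.toWeightBasisInt i := Subtype.ext (by simp)
  funext t
  cases t with
  | none => simp
  | some j =>
    rw [vec, this, coordMap_some, Basis.repr_self]
    simp [Finsupp.single_apply, Pi.single_apply, eq_comm]

lemma vec_add_reflection (i j : ι) :
    vec b (P.reflectionPerm i j) = vec b j - P.pairingIn ℤ j i • vec b i := by
  rw [sub_eq_add_neg, ← neg_smul]
  apply vec_eq_add
  rw [P.root_reflectionPerm, P.reflection_apply_root, ← P.algebraMap_pairingIn ℤ, neg_smul,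
    ← sub_eq_add_neg]
  simp [Int.cast_smul_eq_zsmul]

lemma vec_neg (i : ι) : vec b (P.reflectionPerm i i) = -vec b i := by
  rw [vec, vec, P.rootSpanMem_reflectionPerm_self, map_neg]

lemma root_eq_sum_vec (γ : ι) : P.root γ = ∑ i : b.support, vec b γ (some i) • P.root i := by
  have := congrArg Subtype.val (b.toWeightBasisInt.sum_repr (P.rootSpanMem ℤ γ))
  simp only [AddSubmonoidClass.coe_finsetSum, Submodule.coe_smul, b.coe_toWeightBasisInt_apply]
    at this
  exact this.symm

lemma height_eq_sum_vec (γ : ι) : b.height γ = ∑ i : b.support, vec b γ (some i) := by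
  classical
  have h := root_eq_sum_vec b γ
  let f : ι → ℤ := fun j ↦ if hj : j ∈ b.support then vec b γ (some ⟨j, hj⟩) else 0
  have h2 : P.root γ = ∑ j ∈ b.support, f j • P.root j := by
    rw [h, ← b.support.sum_coe_sort]
    exact Finset.sum_congr rfl fun i _ ↦ by simp [f]
  rw [RootPairing.Base.height_eq_sum h2, ← b.support.sum_coe_sort]
  exact Finset.sum_congr rfl fun i _ ↦ by simp [f]

/-- A non-negative integral combination of simple roots has non-negative coordinates. -/
lemma coordMap_nonneg {x : P.rootSpan ℤ} (hx : (x : M) ∈ AddSubmonoid.closure (simpleRoots b)) :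
    0 ≤ coordMap b x := by
  obtain ⟨x, hx'⟩ := x
  change x ∈ _ at hx
  revert hx'
  refine AddSubmonoid.closure_induction (motive := fun x _ ↦ ∀ hx' : x ∈ P.rootSpan ℤ,
    0 ≤ coordMap b ⟨x, hx'⟩) ?_ ?_ ?_ hx
  · rintro _ ⟨i, hi, rfl⟩ hx'
    change 0 ≤ vec b i
    rw [vec_simple b ⟨i, hi⟩]
    exact Pi.single_nonneg.mpr zero_le_one
  · intro h
    exact (map_zero (coordMap b)).ge
  · intro x y hx hy ihx ihy h
    have aux : ∀ z ∈ AddSubmonoid.closure (simpleRoots b), z ∈ P.rootSpan ℤ := fun z hz ↦ by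
      have : AddSubmonoid.closure (simpleRoots b) ≤ (P.rootSpan ℤ).toAddSubmonoid := by
        rw [AddSubmonoid.closure_le]
        rintro _ ⟨i, -, rfl⟩
        exact Submodule.subset_span ⟨i, rfl⟩
      exact this hz
    have : (⟨x + y, h⟩ : P.rootSpan ℤ) = ⟨x, aux x hx⟩ + ⟨y, aux y hy⟩ := rfl
    rw [this, map_add]
    exact add_nonneg (ihx _) (ihy _)

lemma vec_nonneg_or_nonpos (γ : ι) : 0 ≤ vec b γ ∨ vec b γ ≤ 0 := by
  rcases b.root_mem_or_neg_mem γ with h | h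
  · exact Or.inl (coordMap_nonneg b (x := P.rootSpanMem ℤ γ) h)
  · have := coordMap_nonneg b (x := -P.rootSpanMem ℤ γ) h
    rw [map_neg, neg_nonneg] at this
    exact Or.inr this

lemma isPos_iff_vec_nonneg (γ : ι) : b.IsPos γ ↔ 0 ≤ vec b γ := by
  rw [b.isPos_iff', height_eq_sum_vec]
  refine ⟨fun h ↦ ?_, fun h ↦ Finset.sum_nonneg fun i _ ↦ h _⟩
  rcases vec_nonneg_or_nonpos b γ with h1 | h1
  · exact h1
  · have h2 := (Finset.sum_eq_zero_iff_of_nonpos fun i _ ↦ h1 (some i)).mp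
      (le_antisymm (Finset.sum_nonpos fun i _ ↦ h1 (some i)) h)
    rintro (_ | i)
    · simp
    · simpa using (h2 i (Finset.mem_univ i)).ge

section HighestRoot

variable {b θ} (hθ : IsHighestRoot b θ)
include hθ

lemma vec_le_highest (γ : ι) : vec b γ ≤ vec b θ := by
  have := coordMap_nonneg b (x := P.rootSpanMem ℤ θ - P.rootSpanMem ℤ γ) (hθ γ)
  rwa [map_sub, sub_nonneg] at this

lemma one_le_vec_highest (i : b.support) : 1 ≤ vec b θ (some i) := by
  have := vec_le_highest hθ i (some i)
  rwa [vec_simple, Pi.single_eq_same] at this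

end HighestRoot

lemma rootForm_root_root_int (i j : ι) :
    (2 * P.RootFormIn ℤ (P.rootSpanMem ℤ i) (P.rootSpanMem ℤ j)) =
      P.pairingIn ℤ i j * P.RootFormIn ℤ (P.rootSpanMem ℤ j) (P.rootSpanMem ℤ j) := by
  apply FaithfulSMul.algebraMap_injective ℤ K
  rw [map_mul, map_mul, P.algebraMap_rootFormIn, P.algebraMap_rootFormIn, P.algebraMap_pairingIn]
  rw [map_ofNat]
  exact (P.posRootForm ℤ).two_mul_apply_root_root i j

lemma rootFormIn_root_pos (i : ι) :
    0 < P.RootFormIn ℤ (P.rootSpanMem ℤ i) (P.rootSpanMem ℤ i) := by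
  rw [← P.posRootForm_eq]
  exact (P.posRootForm ℤ).zero_lt_posForm_apply_root i

lemma rootFormIn_right_int (j : ι) (x : P.rootSpan ℤ) :
    2 * P.RootFormIn ℤ x (P.rootSpanMem ℤ j) =
      P.coroot'In ℤ j x * P.RootFormIn ℤ (P.rootSpanMem ℤ j) (P.rootSpanMem ℤ j) := by
  obtain ⟨x, hx⟩ := x
  induction hx using Submodule.span_induction with
  | mem x h =>
    obtain ⟨i, rfl⟩ := h
    exact rootForm_root_root_int i j
  | zero =>
    have : (⟨0, Submodule.zero_mem _⟩ : P.rootSpan ℤ) = 0 := rfl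
    simp [this]
  | add x y hx hy ihx ihy =>
    have : (⟨x + y, Submodule.add_mem _ hx hy⟩ : P.rootSpan ℤ) = ⟨x, hx⟩ + ⟨y, hy⟩ := rfl
    rw [this, map_add, map_add, LinearMap.add_apply, mul_add, ihx, ihy, add_mul]
  | smul a x hx ihx =>
    have : (⟨a • x, Submodule.smul_mem _ a hx⟩ : P.rootSpan ℤ) = a • ⟨x, hx⟩ := rfl
    rw [this, map_smul, map_smul, LinearMap.smul_apply, smul_eq_mul, smul_eq_mul, mul_left_comm,
      ihx, mul_assoc]

variable {b θ} in
/-- The affine root system attached to a root system with a base whose highest root is long. -/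
noncomputable def latticeModel (hθ : IsHighestRoot b θ) (hl : IsLong P θ) :
    AffineSystem b.support :=
  have htop : (vec b θ + Pi.single none 1 : Option b.support → ℤ) - Pi.single none 1 = vec b θ :=
    add_sub_cancel_right _ _
  have himag : toRootSpan b θ (vec b θ + Pi.single none 1) = 0 := by
    have : (Pi.single none 1 : Option b.support → ℤ) ∘ some = 0 := by ext; simp
    rw [map_add, toRootSpan_vec, toRootSpan_apply, this]
    simp
  have hnone : toRootSpan b θ (Pi.single none 1) = -P.rootSpanMem ℤ θ := by
    rw [map_add, toRootSpan_vec] at himag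
    exact (neg_eq_of_add_eq_zero_right himag).symm
  have hsome : ∀ i : b.support, toRootSpan b θ (Pi.single (some i) 1) = P.rootSpanMem ℤ i :=
    fun i ↦ by rw [← vec_simple, toRootSpan_vec]
  { finRoots := Set.range (vec b)
    imag := vec b θ + Pi.single none 1
    form := (P.RootFormIn ℤ).compl₁₂ (toRootSpan b θ) (toRootSpan b θ)
    co := fun t ↦ t.elim (-(P.coroot'In ℤ θ ∘ₗ toRootSpan b θ))
      fun i ↦ P.coroot'In ℤ i ∘ₗ toRootSpan b θ
    imag_none := by simp
    one_le_imag := by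
      rintro (_ | i)
      · simp
      · simpa using one_le_vec_highest hθ i
    form_imag := fun x ↦ by rw [LinearMap.compl₁₂_apply, himag, map_zero, LinearMap.zero_apply]
    form_comm := fun x y ↦ (P.rootFormIn_isSymm ℤ).eq _ _
    two_form := by
      rintro (_ | i) x
      · rw [LinearMap.compl₁₂_apply, LinearMap.compl₁₂_apply, hnone]
        simp only [map_neg, LinearMap.neg_apply, Option.elim_none, LinearMap.comp_apply, neg_neg,
          mul_neg, neg_mul, rootFormIn_right_int]
      · rw [LinearMap.compl₁₂_apply, LinearMap.compl₁₂_apply, hsome]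
        exact rootFormIn_right_int _ _
    form_pos := by
      rintro _ ⟨γ, rfl⟩
      rw [LinearMap.compl₁₂_apply, toRootSpan_vec]
      exact rootFormIn_root_pos γ
    apply_none := by rintro _ ⟨γ, rfl⟩; rfl
    nonneg_or_nonpos := by rintro _ ⟨γ, rfl⟩; exact vec_nonneg_or_nonpos b γ
    neg_mem := by rintro _ ⟨γ, rfl⟩; exact ⟨P.reflectionPerm γ γ, vec_neg b γ⟩
    simple_mem := fun i ↦ ⟨i, vec_simple b i⟩
    reflect_mem := by
      rintro i _ ⟨γ, rfl⟩
      refine ⟨P.reflectionPerm i γ, ?_⟩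
      rw [vec_add_reflection, Option.elim_some, LinearMap.comp_apply, toRootSpan_vec, vec_simple]
      rfl
    top_mem := ⟨θ, htop.symm⟩
    le_top := by
      rintro _ ⟨γ, rfl⟩
      rw [htop]
      exact vec_le_highest hθ γ
    reflect_top_mem := by
      rintro _ ⟨γ, rfl⟩
      refine ⟨P.reflectionPerm θ γ, ?_⟩
      rw [htop, vec_add_reflection, Option.elim_none, LinearMap.neg_apply, LinearMap.comp_apply,
        toRootSpan_vec, neg_smul, sub_eq_add_neg]
      rfl
    reduced := by
      rintro i n ⟨γ, h⟩
      have h1 : P.root γ = (n : K) • P.root i := by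
        have h2 := congrArg (toRootSpan b θ) h
        rw [toRootSpan_vec, map_smul, hsome] at h2
        simpa [Int.cast_smul_eq_zsmul] using congrArg Subtype.val h2
      have := Module.IsReflexive.of_isPerfPair P.toLinearMap
      have := Module.IsReflexive.of_isPerfPair P.flip.toLinearMap
      have : IsAddTorsionFree M := .of_isTorsionFree K M
      have : IsAddTorsionFree N := .of_isTorsionFree K N
      rcases b.eq_one_or_neg_one_of_mem_support_of_smul_mem i i.2 n ⟨γ, h1⟩ with h2 | h2
      · exact Or.inl (by exact_mod_cast h2)
      · exact Or.inr (by exact_mod_cast h2)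
    abs_co_none_le := by
      rintro _ ⟨γ, rfl⟩ h1 h2
      rw [htop] at h1 h2
      have h3 : P.root γ ≠ P.root θ := fun h ↦ h1 (congrArg _ (P.root.injective h))
      have h4 : P.root γ ≠ -P.root θ := fun h ↦ h2 (by
        rw [← vec_neg, P.root.injective (h.trans _)]
        rw [P.root_reflectionPerm, P.reflection_apply_self])
      rw [Option.elim_none, LinearMap.neg_apply, LinearMap.comp_apply, toRootSpan_vec, abs_neg]
      change |P.pairingIn ℤ γ θ| ≤ 1
      by_contra h5
      refine (hl γ).not_gt ((P.posRootForm ℤ).rootLength_lt_of_pairingIn_notMem h3 h4 ?_)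
      intro h6
      simp only [Set.mem_insert_iff, Set.mem_singleton_iff] at h6
      rcases h6 with h6 | h6 | h6 <;> simp [h6] at h5 }

section LatticeModel

variable {b θ} (hθ : IsHighestRoot b θ) (hl : IsLong P θ)

lemma imag_latticeModel : (latticeModel hθ hl).imag = vec b θ + Pi.single none 1 := rfl

lemma top_latticeModel : (latticeModel hθ hl).top = vec b θ := add_sub_cancel_right _ _

lemma form_latticeModel (x y : Option b.support → ℤ) :
    (latticeModel hθ hl).form x y = P.RootFormIn ℤ (toRootSpan b θ x) (toRootSpan b θ y) := rfl

lemma co_some_latticeModel (i : b.support) (x : Option b.support → ℤ) :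
    (latticeModel hθ hl).co (some i) x = P.coroot'In ℤ i (toRootSpan b θ x) := rfl

lemma toRootSpan_single_some (i : b.support) :
    toRootSpan b θ (Pi.single (some i) 1) = P.rootSpanMem ℤ i := by
  rw [← vec_simple, toRootSpan_vec]

lemma toRootSpan_single_none : toRootSpan b θ (Pi.single none 1) = -P.rootSpanMem ℤ θ := by
  have : (Pi.single none 1 : Option b.support → ℤ) ∘ some = 0 := by ext; simp
  rw [toRootSpan_apply, this]
  simp

lemma toRootSpan_imag : toRootSpan b θ (latticeModel hθ hl).imag = 0 := by
  rw [imag_latticeModel, map_add, toRootSpan_vec, toRootSpan_single_none, add_neg_cancel]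

lemma cast_form_vec (i j : ι) :
    (((latticeModel hθ hl).form (vec b i) (vec b j) : ℤ) : K) = ip P (P.root i) (P.root j) := by
  rw [form_latticeModel, toRootSpan_vec, toRootSpan_vec]
  exact P.algebraMap_rootFormIn ℤ _ _

lemma form_vec_eq_zero_iff (i j : ι) :
    (latticeModel hθ hl).form (vec b i) (vec b j) = 0 ↔ ip P (P.root i) (P.root j) = 0 := by
  rw [← cast_form_vec hθ hl, Int.cast_eq_zero]

end LatticeModel

/-! ### Long roots and the highest root -/

variable {b}

lemma ip_weyl {w : M ≃ₗ[K] M} (hw : w ∈ weyl b) (x y : M) : ip P (w x) (w y) = ip P x y := by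
  induction hw using Subgroup.closure_induction generalizing x y with
  | mem s hs =>
    obtain ⟨i, -, rfl⟩ := hs
    exact P.rootForm_reflection_reflection_apply i x y
  | one => rfl
  | mul u v _ _ hu hv => rw [LinearEquiv.mul_apply, LinearEquiv.mul_apply, hu, hv]
  | inv u _ hu =>
    rw [← hu, ← LinearEquiv.mul_apply, ← LinearEquiv.mul_apply, mul_inv_cancel]
    rfl

lemma cast_rootLength (i : ι) :
    (((P.posRootForm ℤ).rootLength i : ℤ) : K) = ip P (P.root i) (P.root i) :=
  (P.posRootForm ℤ).algebraMap_rootLength i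

/-- A long root is conjugate to the highest root. The highest conjugate `γ` of a long root is
dominant, and `⟨θ, γ^∨⟩ ≥ 2` would hold for such a root `γ ≠ θ`, making `θ` longer than `γ`. -/
lemma exists_weyl_map_highest {θ : ι} (hθ : IsHighestRoot b θ) {μ : ι} (hμ : IsLong P μ) :
    IsLong P θ ∧ ∃ w ∈ weyl b, w (P.root θ) = P.root μ := by
  classical
  let A : Finset ι := {γ | ∃ w ∈ weyl b, w (P.root γ) = P.root μ}
  obtain ⟨γ, hγ, hmax⟩ := A.exists_max_image b.height ⟨μ, by simpa [A] using ⟨1, one_mem _, rfl⟩⟩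
  obtain ⟨w, hw, hwγ⟩ : ∃ w ∈ weyl b, w (P.root γ) = P.root μ := by simpa [A] using hγ
  have hlong : (P.posRootForm ℤ).rootLength γ = (P.posRootForm ℤ).rootLength μ := by
    have h : (((P.posRootForm ℤ).rootLength γ : ℤ) : K) = ((P.posRootForm ℤ).rootLength μ : ℤ) := by
      rw [cast_rootLength, cast_rootLength, ← hwγ, ip_weyl hw]
    exact_mod_cast h
  have hdom : ∀ i ∈ b.support, 0 ≤ P.pairingIn ℤ γ i := by
    intro i hi
    have h1 : P.reflectionPerm i γ ∈ A := by
      simp only [A, Finset.mem_filter, Finset.mem_univ, true_and]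
      refine ⟨w * P.reflection i, mul_mem hw (Subgroup.subset_closure ⟨i, hi, rfl⟩), ?_⟩
      rw [LinearEquiv.mul_apply, P.root_reflectionPerm, P.reflection_same, hwγ]
    have h2 := hmax _ h1
    have h3 : P.root (P.reflectionPerm i γ) = P.root γ + (-P.pairingIn ℤ γ i) • P.root i := by
      rw [P.root_reflectionPerm, P.reflection_apply_root, ← P.algebraMap_pairingIn ℤ, neg_smul,
        ← sub_eq_add_neg]
      simp [Int.cast_smul_eq_zsmul]
    rw [b.height_add_zsmul h3, RootPairing.Base.height_one_of_mem_support hi] at h2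
    simpa using h2
  suffices h : θ = γ by
    subst h
    exact ⟨fun γ' ↦ hlong ▸ hμ γ', w, hw, hwγ⟩
  by_contra hne
  let f := P.RootFormIn ℤ
  have hpos : f (P.rootSpanMem ℤ γ) (P.rootSpanMem ℤ γ) ≤
      f (P.rootSpanMem ℤ θ) (P.rootSpanMem ℤ γ) := by
    have h0 : ∀ x : P.rootSpan ℤ, 0 ≤ coordMap b x → 0 ≤ f x (P.rootSpanMem ℤ γ) := by
      intro x hx
      rw [← b.toWeightBasisInt.sum_repr x, map_sum, LinearMap.sum_apply]
      refine Finset.sum_nonneg fun i _ ↦ ?_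
      rw [map_smul, LinearMap.smul_apply, smul_eq_mul]
      refine mul_nonneg (hx (some i)) ?_
      have h1 : b.toWeightBasisInt i = P.rootSpanMem ℤ i := Subtype.ext (by simp)
      have h2 := rootForm_root_root_int (P := P) γ i
      rw [h1, show f (P.rootSpanMem ℤ i) (P.rootSpanMem ℤ γ) = f (P.rootSpanMem ℤ γ)
        (P.rootSpanMem ℤ i) from (P.rootFormIn_isSymm ℤ).eq _ _]
      have := mul_nonneg (hdom i i.2) (rootFormIn_root_pos (P := P) i).le
      change 2 * f _ _ = _ at h2
      lia
    have h3 := h0 _ (coordMap_nonneg b (x := P.rootSpanMem ℤ θ - P.rootSpanMem ℤ γ) (hθ γ))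
    rw [map_sub, LinearMap.sub_apply] at h3
    lia
  have hp := rootFormIn_root_pos (P := P) γ
  have h2 := rootForm_root_root_int (P := P) θ γ
  have h3 : 2 ≤ P.pairingIn ℤ θ γ := by
    by_contra h
    change f _ _ ≤ f _ _ at hpos
    change 0 < f _ _ at hp
    change 2 * f _ _ = _ * f _ _ at h2
    nlinarith
  have h4 : P.root θ ≠ -P.root γ := by
    intro h
    have : P.pairingIn ℤ θ γ = -2 := by
      rw [P.root_eq_neg_iff] at h
      simp [h]
    lia
  refine (hlong ▸ hμ θ).not_gt ((P.posRootForm ℤ).rootLength_lt_of_pairingIn_notMem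
    (fun h ↦ hne (P.root.injective h)) h4 ?_)
  simp only [Set.mem_insert_iff, Set.mem_singleton_iff]
  lia

lemma exists_isShortestTo {θ μ : ι} (h : ∃ w ∈ weyl b, w (P.root θ) = P.root μ) :
    ∃ w, IsShortestTo b θ μ w := by
  obtain ⟨w, hw, hwθ⟩ := h
  obtain ⟨_, ⟨v, ⟨hv, hvθ⟩, rfl⟩, hmin⟩ := (wellFounded_lt (α := ℕ)).has_min
    (length b '' {w | w ∈ weyl b ∧ w (P.root θ) = P.root μ}) ⟨_, w, ⟨hw, hwθ⟩, rfl⟩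
  exact ⟨v, hv, hvθ, fun w' h1 h2 ↦ not_lt.mp (hmin _ ⟨w', ⟨h1, h2⟩, rfl⟩)⟩

end RootPairing

end AbIdeal

namespace AbIdeal

section RootPairing

variable {ι K M N : Type*} [Fintype ι] [DecidableEq ι] [Field K] [CharZero K] [AddCommGroup M]
  [Module K M] [AddCommGroup N] [Module K N] {P : RootPairing ι K M N} [P.IsCrystallographic]

/-! ### The finite and the affine Weyl group in the lattice model -/

/-- The embedding of the lattice of the affine root system into `V ⊕ Kδ ⊕ Kλ`. -/
noncomputable def affEmb (b : P.Base) (θ : ι) : (Option b.support → ℤ) →+ AffSpace K M where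
  toFun x := ((toRootSpan b θ x : M), (x none : K), 0)
  map_zero' := by simp
  map_add' x y := by simp

variable {b : P.Base} {θ : ι}

lemma affEmb_apply (x : Option b.support → ℤ) :
    affEmb b θ x = ((toRootSpan b θ x : M), (x none : K), 0) := rfl

lemma affEmb_injective : Function.Injective (affEmb b θ) := by
  intro x y h
  rw [affEmb_apply, affEmb_apply, Prod.mk.injEq, Prod.mk.injEq] at h
  have h0 : x none = y none := by exact_mod_cast h.2.1
  have h1 := Subtype.ext h.1
  rw [toRootSpan_apply, toRootSpan_apply, h0, sub_left_inj,
    b.toWeightBasisInt.equivFun.symm.injective.eq_iff] at h1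
  funext t
  cases t with
  | none => exact h0
  | some i => exact congrFun h1 i

lemma affIp_affEmb (x y : Option b.support → ℤ) :
    affIp P (affEmb b θ x) (affEmb b θ y) =
      (P.RootFormIn ℤ (toRootSpan b θ x) (toRootSpan b θ y) : ℤ) := by
  simp only [affIp, affEmb_apply, mul_zero, zero_mul, add_zero]
  exact (P.algebraMap_rootFormIn ℤ _ _).symm

section

variable (hθ : IsHighestRoot b θ) (hl : IsLong P θ)

lemma affEmb_sr_some (i : b.support) : affEmb b θ (Pi.single (some i) 1) = affRoot P i 0 := by
  rw [affEmb_apply, toRootSpan_single_some]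
  simp [affRoot]

lemma affEmb_sr_none : affEmb b θ (Pi.single none 1) = (-P.root θ, 1, 0) := by
  rw [affEmb_apply, toRootSpan_single_none]
  simp

lemma affEmb_imag : affEmb b θ (latticeModel hθ hl).imag = (0, 1, 0) := by
  rw [affEmb_apply, toRootSpan_imag, (latticeModel hθ hl).imag_none]
  simp

lemma affEmb_vec (γ : ι) : affEmb b θ (vec b γ) = (P.root γ, 0, 0) := by
  rw [affEmb_apply, toRootSpan_vec]
  simp

lemma affEmb_vec_add (γ : ι) (k : ℤ) :
    affEmb b θ (vec b γ + k • (latticeModel hθ hl).imag) = affRoot P γ k := by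
  rw [map_add, map_zsmul, affEmb_vec, affEmb_imag]
  simp [affRoot]

lemma affEmb_imag_sub (γ : ι) :
    affEmb b θ ((latticeModel hθ hl).imag - vec b γ) = (-P.root γ, 1, 0) := by
  rw [map_sub, affEmb_vec, affEmb_imag]
  simp

lemma affEmb_two_imag_sub_top :
    affEmb b θ (2 • (latticeModel hθ hl).imag - (latticeModel hθ hl).top) =
      (-P.root θ, 2, 0) := by
  rw [map_sub, map_nsmul, top_latticeModel, affEmb_vec, affEmb_imag]
  simp

lemma mem_affSimple_iff {a : AffSpace K M} :
    a ∈ affSimple b θ ↔ ∃ t, a = affEmb b θ (Pi.single t 1) := by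
  constructor
  · rintro (⟨i, hi, rfl⟩ | h)
    · exact ⟨some ⟨i, hi⟩, (affEmb_sr_some (b := b) ⟨i, hi⟩).symm⟩
    · exact ⟨none, h.trans affEmb_sr_none.symm⟩
  · rintro ⟨_ | i, rfl⟩
    · exact Or.inr affEmb_sr_none
    · exact Or.inl ⟨i, i.2, affEmb_sr_some i⟩

lemma mem_affPos_iff {a : AffSpace K M} :
    a ∈ affPos b ↔ ∃ x ∈ (latticeModel hθ hl).roots, 0 ≤ x ∧ a = affEmb b θ x := by
  set D := latticeModel hθ hl with hD
  constructor
  · rintro ⟨γ, k, h, rfl⟩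
    refine ⟨vec b γ + k • D.imag, ⟨_, ⟨γ, rfl⟩, k, rfl⟩, ?_, (affEmb_vec_add hθ hl γ k).symm⟩
    rcases h with ⟨rfl, h⟩ | h
    · rwa [zero_smul, add_zero, ← isPos_iff_vec_nonneg]
    · exact D.imag_add_nonneg ⟨γ, rfl⟩ h
  · rintro ⟨_, ⟨_, ⟨γ, rfl⟩, k, rfl⟩, h, rfl⟩
    refine ⟨γ, k, ?_, affEmb_vec_add hθ hl γ k⟩
    have h0 := h none
    rw [Pi.add_apply, Pi.smul_apply, D.imag_none, vec_none] at h0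
    rcases (show 0 ≤ k by simpa using h0).eq_or_lt with rfl | hk
    · rw [zero_smul, add_zero] at h
      exact Or.inl ⟨rfl, (isPos_iff_vec_nonneg b γ).mpr h⟩
    · exact Or.inr hk

/-- The reflection of `V ⊕ Kδ ⊕ Kλ` in an affine simple root restricts to the corresponding
simple reflection of the lattice. -/
lemma affReflection_affEmb (t : Option b.support) (x : Option b.support → ℤ) :
    affEmb b θ x - affIp P (affEmb b θ x) (affEmb b θ (Pi.single t 1)) •
      (2 / affIp P (affEmb b θ (Pi.single t 1)) (affEmb b θ (Pi.single t 1))) •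
        affEmb b θ (Pi.single t 1) = affEmb b θ ((latticeModel hθ hl).s t x) := by
  set D := latticeModel hθ hl with hD
  have h1 : (2 : K) * (D.form x (Pi.single t 1) : ℤ) =
      (D.co t x : ℤ) * (D.form (Pi.single t 1) (Pi.single t 1) : ℤ) := by
    exact_mod_cast D.two_form t x
  have h2 : ((D.form (Pi.single t 1) (Pi.single t 1) : ℤ) : K) ≠ 0 := by
    exact_mod_cast (D.form_self_pos (D.sr_mem_roots t)).ne'
  rw [affIp_affEmb, affIp_affEmb, ← form_latticeModel hθ hl, ← form_latticeModel hθ hl, smul_smul,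
    D.s_apply, map_sub, map_zsmul, ← Int.cast_smul_eq_zsmul K]
  congr 2
  change (D.form x (Pi.single t 1) : K) * (2 / (D.form (Pi.single t 1) (Pi.single t 1) : K)) = _
  rw [mul_div_assoc', div_eq_iff h2, mul_comm, h1]

lemma exists_lattice_of_mem_affWeyl {w : AffSpace K M ≃ₗ[K] AffSpace K M}
    (hw : w ∈ affWeyl b θ) :
    ∃ w' ∈ (latticeModel hθ hl).W, ∀ x, w (affEmb b θ x) = affEmb b θ (w' x) := by
  set D := latticeModel hθ hl with hD
  induction hw using Subgroup.closure_induction with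
  | mem s hs =>
    obtain ⟨a, ha, h⟩ := hs
    obtain ⟨t, rfl⟩ := mem_affSimple_iff.mp ha
    exact ⟨D.s t, D.s_mem_par (Set.mem_univ _), fun x ↦ by
      rw [h, affReflection_affEmb hθ hl]⟩
  | one => exact ⟨1, one_mem _, fun x ↦ rfl⟩
  | mul u v _ _ hu hv =>
    obtain ⟨u', hu', hu⟩ := hu
    obtain ⟨v', hv', hv⟩ := hv
    exact ⟨u' * v', mul_mem hu' hv', fun x ↦ by
      rw [LinearEquiv.mul_apply, LinearEquiv.mul_apply, hv, hu]⟩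
  | inv u _ hu =>
    obtain ⟨u', hu', hu⟩ := hu
    refine ⟨u'⁻¹, inv_mem hu', fun x ↦ u.injective ?_⟩
    rw [hu, ← LinearEquiv.mul_apply, ← LinearEquiv.mul_apply, mul_inv_cancel, mul_inv_cancel]
    rfl

/-- The linear form `x ↦ 2 (x, a) / (a, a)` on `V ⊕ Kδ ⊕ Kλ`. -/
noncomputable def affCoroot (P : RootPairing ι K M N) (a : AffSpace K M) : Dual K (AffSpace K M) :=
  (2 / affIp P a a) • (P.RootForm.flip a.1 ∘ₗ LinearMap.fst K M (K × K) +
    a.2.2 • (LinearMap.fst K K K ∘ₗ LinearMap.snd K M (K × K)) +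
    a.2.1 • (LinearMap.snd K K K ∘ₗ LinearMap.snd K M (K × K)))

lemma affCoroot_apply (a x : AffSpace K M) : affCoroot P a x = 2 / affIp P a a * affIp P x a := by
  simp only [affCoroot, LinearMap.smul_apply, LinearMap.add_apply, LinearMap.comp_apply,
    LinearMap.fst_apply, LinearMap.snd_apply, smul_eq_mul, affIp, ip]
  change 2 / _ * (P.RootForm x.1 a.1 + _ + _) = _
  ring

lemma exists_mem_affWeyl_of_lattice {w' : (Option b.support → ℤ) ≃ₗ[ℤ] (Option b.support → ℤ)}
    (hw : w' ∈ (latticeModel hθ hl).W) :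
    ∃ w ∈ affWeyl b θ, ∀ x, w (affEmb b θ x) = affEmb b θ (w' x) := by
  set D := latticeModel hθ hl with hD
  refine D.par_induction (p := fun w' ↦ ∃ w ∈ affWeyl b θ, ∀ x,
    w (affEmb b θ x) = affEmb b θ (w' x)) hw ⟨1, one_mem _, fun x ↦ rfl⟩ ?_
  · rintro t - v' ⟨v, hv, hvx⟩
    set a := affEmb b θ (Pi.single t 1) with ha
    have h2 : affCoroot P a a = 2 := by
      have : affIp P a a ≠ 0 := by
        rw [affIp_affEmb, ← form_latticeModel hθ hl]
        exact_mod_cast (D.form_self_pos (D.sr_mem_roots t)).ne'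
      rw [affCoroot_apply, div_mul_cancel₀ _ this]
    have h3 : ∀ x, Module.reflection h2 x = x - affIp P x a • (2 / affIp P a a) • a := by
      intro x
      rw [Module.reflection_apply, affCoroot_apply, smul_smul, mul_comm]
    refine ⟨Module.reflection h2 * v, mul_mem (Subgroup.subset_closure
      ⟨a, mem_affSimple_iff.mpr ⟨t, rfl⟩, h3⟩) hv, fun x ↦ ?_⟩
    rw [LinearEquiv.mul_apply, LinearEquiv.mul_apply, h3, hvx, ha, affReflection_affEmb hθ hl]

lemma mem_inversions_iff {w : AffSpace K M ≃ₗ[K] AffSpace K M}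
    {w' : (Option b.support → ℤ) ≃ₗ[ℤ] (Option b.support → ℤ)}
    (hw' : w' ∈ (latticeModel hθ hl).W) (h : ∀ x, w (affEmb b θ x) = affEmb b θ (w' x))
    {a : AffSpace K M} :
    a ∈ inversions b w ↔
      ∃ x ∈ (latticeModel hθ hl).roots, 0 ≤ x ∧ w' x ≤ 0 ∧ a = affEmb b θ x := by
  set D := latticeModel hθ hl with hD
  constructor
  · rintro ⟨h1, h2⟩
    obtain ⟨x, hx, hx0, rfl⟩ := (mem_affPos_iff hθ hl).mp h1
    obtain ⟨y, hy, hy0, hxy⟩ := (mem_affPos_iff hθ hl).mp h2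
    rw [h, ← map_neg] at hxy
    exact ⟨x, hx, hx0, neg_nonneg.mp (affEmb_injective hxy ▸ hy0), rfl⟩
  · rintro ⟨x, hx, hx0, hwx, rfl⟩
    refine ⟨(mem_affPos_iff hθ hl).mpr ⟨x, hx, hx0, rfl⟩, (mem_affPos_iff hθ hl).mpr
      ⟨-w' x, D.neg_mem_roots (D.map_mem_roots hw' hx), neg_nonneg.mpr hwx, ?_⟩⟩
    rw [h, map_neg]

/-- Rootlets in the lattice model: a set `I` of positive roots has a minuscule element with
rootlet `α` exactly when it is cut out by an element of the fibre over `α`. -/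
lemma isRootlet_iff {i₀ : b.support} {I : Set ι} (hI : ∀ γ ∈ I, b.IsPos γ) :
    IsRootlet b θ I i₀ ↔ ∃ w', (latticeModel hθ hl).IsFib i₀ w' ∧
      I = {γ | b.IsPos γ ∧ w' ((latticeModel hθ hl).imag - vec b γ) ≤ 0} := by
  set D := latticeModel hθ hl with hD
  have hroot : ∀ γ, D.imag - vec b γ ∈ D.roots ∧ 0 ≤ D.imag - vec b γ := fun γ ↦
    ⟨D.imag_sub_mem_roots ⟨γ, rfl⟩, D.imag_sub_nonneg ⟨γ, rfl⟩⟩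
  constructor
  · rintro ⟨w, ⟨hw, hinv⟩, hmap⟩
    obtain ⟨w', hw', h⟩ := exists_lattice_of_mem_affWeyl hθ hl hw
    refine ⟨w', ⟨hw', fun i ↦ ?_, ?_⟩, ?_⟩
    · refine D.nonneg_of_not_nonpos (D.map_mem_roots hw' (D.sr_mem_roots _)) fun hneg ↦ ?_
      have h1 : affEmb b θ (Pi.single (some i) 1) ∈ inversions b w :=
        (mem_inversions_iff hθ hl hw' h).mpr ⟨_, D.sr_mem_roots _, AffineSystem.sr_nonneg _, hneg,
          rfl⟩
      rw [hinv] at h1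
      obtain ⟨γ, -, h1⟩ := h1
      simp [affEmb_apply] at h1
    · apply affEmb_injective (θ := θ)
      rw [← h, affEmb_two_imag_sub_top, hmap, affEmb_sr_some]
    · ext γ
      refine ⟨fun hγ ↦ ⟨hI γ hγ, ?_⟩, fun ⟨hγ, hneg⟩ ↦ ?_⟩
      · have h1 : (-P.root γ, 1, 0) ∈ inversions b w := hinv ▸ ⟨γ, hγ, rfl⟩
        obtain ⟨x, -, -, hx, hxe⟩ := (mem_inversions_iff hθ hl hw' h).mp h1
        rw [← affEmb_imag_sub hθ hl] at hxe
        rwa [← affEmb_injective hxe] at hx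
      · have h1 := (mem_inversions_iff hθ hl hw' h).mpr
          ⟨_, (hroot γ).1, (hroot γ).2, hneg, rfl⟩
        rw [hinv, affEmb_imag_sub hθ hl] at h1
        obtain ⟨γ', hγ', h1⟩ := h1
        have h2 : P.root γ = P.root γ' := by simpa using h1
        rwa [P.root.injective h2]
  · rintro ⟨w', hw', rfl⟩
    obtain ⟨w, hw, h⟩ := exists_mem_affWeyl_of_lattice hθ hl hw'.mem
    refine ⟨w, ⟨hw, ?_⟩, ?_⟩
    · ext a
      rw [mem_inversions_iff hθ hl hw'.mem h]
      constructor
      · rintro ⟨x, hx, hx0, hneg, rfl⟩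
        obtain ⟨_, ⟨γ, rfl⟩, h0, rfl⟩ := hw'.exists_eq_sub hx hx0 hneg
        exact ⟨γ, ⟨(isPos_iff_vec_nonneg b γ).mpr h0, hneg⟩, affEmb_imag_sub hθ hl γ⟩
      · rintro ⟨γ, ⟨hγ, hneg⟩, rfl⟩
        exact ⟨_, (hroot γ).1, (hroot γ).2, hneg, (affEmb_imag_sub hθ hl γ).symm⟩
    · rw [← affEmb_two_imag_sub_top hθ hl, h, hw'.map_eq, affEmb_sr_some]

lemma toRootSpan_s (i : b.support) (x : Option b.support → ℤ) :
    (toRootSpan b θ ((latticeModel hθ hl).s (some i) x) : M) =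
      P.reflection i (toRootSpan b θ x) := by
  rw [AffineSystem.s_apply, map_sub, map_smul, toRootSpan_single_some, P.reflection_apply,
    co_some_latticeModel]
  have := P.algebraMap_coroot'In_apply ℤ i (toRootSpan b θ x)
  rw [← this]
  simp [Int.cast_smul_eq_zsmul]

lemma toRootSpan_word (l : List b.support) (x : Option b.support → ℤ) :
    (toRootSpan b θ ((latticeModel hθ hl).word (l.map some) x) : M) =
      (l.map fun i : b.support ↦ P.reflection i).prod (toRootSpan b θ x) := by
  induction l with
  | nil => rfl
  | cons i l ih =>
    rw [List.map_cons, List.map_cons, List.prod_cons, AffineSystem.word_cons,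
      LinearEquiv.mul_apply, LinearEquiv.mul_apply, toRootSpan_s, ih]

lemma length_eq_sInf (w : M ≃ₗ[K] M) : length b w =
    sInf {k | ∃ l : List b.support, l.length = k ∧
      (l.map fun i : b.support ↦ P.reflection i).prod = w} := by
  simp only [length, List.bind_eq_flatMap, List.pure_def, ← List.map_eq_flatMap, List.map_map]
  rfl

lemma exists_list_of_mem_weyl {w : M ≃ₗ[K] M} (hw : w ∈ weyl b) :
    ∃ l : List b.support, (l.map fun i : b.support ↦ P.reflection i).prod = w := by
  induction hw using Subgroup.closure_induction with
  | mem s hs =>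
    obtain ⟨i, hi, rfl⟩ := hs
    exact ⟨[⟨i, hi⟩], by simp⟩
  | one => exact ⟨[], rfl⟩
  | mul u v _ _ hu hv =>
    obtain ⟨l, rfl⟩ := hu
    obtain ⟨l', rfl⟩ := hv
    exact ⟨l ++ l', by simp⟩
  | inv u _ hu =>
    obtain ⟨l, rfl⟩ := hu
    refine ⟨l.reverse, ?_⟩
    rw [List.prod_inv_reverse, List.map_map, List.map_reverse]
    congr 2

lemma prod_mem_weyl (l : List b.support) :
    (l.map fun i : b.support ↦ P.reflection i).prod ∈ weyl b :=
  list_prod_mem fun x hx ↦ by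
    obtain ⟨i, -, rfl⟩ := List.mem_map.mp hx
    exact Subgroup.subset_closure ⟨i, i.2, rfl⟩

/-- An element of minimal length taking `θ` to a simple root is positive on the positive roots
orthogonal to `θ`: otherwise a letter of a shortest word could be deleted. -/
lemma IsShortestTo.exists_isShort {i₀ : b.support} {w : M ≃ₗ[K] M}
    (hw : IsShortestTo b θ i₀ w) :
    ∃ v, (latticeModel hθ hl).IsShort i₀ v ∧
      ∀ x, (toRootSpan b θ (v x) : M) = w (toRootSpan b θ x) := by
  set D := latticeModel hθ hl with hD
  obtain ⟨hmem, hmap, hmin⟩ := hw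
  obtain ⟨l, hlen, hprod⟩ : ∃ l : List b.support, l.length = length b w ∧
      (l.map fun i : b.support ↦ P.reflection i).prod = w := by
    obtain ⟨l, hl⟩ := exists_list_of_mem_weyl hmem
    rw [length_eq_sInf]
    exact Nat.sInf_mem (s := {k | ∃ l : List b.support, l.length = k ∧
      (l.map fun i : b.support ↦ P.reflection i).prod = w}) ⟨_, l, rfl, hl⟩
  have hW : ∀ l : List b.support, D.word (l.map some) ∈ D.W₀ := fun l ↦
    D.word_mem_par fun t ht ↦ by
      obtain ⟨i, -, rfl⟩ := List.mem_map.mp ht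
      exact ⟨i, rfl⟩
  have hfin : ∀ x : Option b.support → ℤ, x none = 0 → ∀ γ, (toRootSpan b θ x : M) = P.root γ →
      x = vec b γ := by
    intro x hx γ h
    apply affEmb_injective (θ := θ)
    rw [affEmb_vec, affEmb_apply, h, hx, Int.cast_zero]
  have hnone : ∀ l : List b.support, ∀ γ, D.word (l.map some) (vec b γ) none = 0 := fun l γ ↦
    (D.fin_apply_none (hW l) _).trans (vec_none b γ)
  refine ⟨D.word (l.map some), ⟨hW l, ?_, ?_⟩, fun x ↦ by rw [toRootSpan_word hθ hl, hprod]⟩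
  · rw [top_latticeModel]
    refine Eq.trans ?_ (vec_simple b i₀)
    exact hfin _ (hnone l θ) _ (by rw [toRootSpan_word hθ hl, hprod, toRootSpan_vec, hmap])
  · intro x hx hx0 horth
    have hxr := D.mem_roots_of_fin hx
    by_contra hneg
    have hneg' : D.word (l.map some) x ≤ 0 :=
      (D.nonneg_or_nonpos' (D.map_mem_roots (D.mem_W (hW l)) hxr)).resolve_left hneg
    obtain ⟨l₁, t, l₂, hl', ht⟩ := D.exists_suffix hxr hx0 hneg'
    obtain ⟨m₁, m₂', rfl, rfl, h2⟩ := List.map_eq_append_iff.mp hl'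
    obtain ⟨i, m₂, rfl, rfl, rfl⟩ := List.map_eq_cons_iff.mp h2
    -- the deleted letter fixes the intermediate image of `θ`
    have hfix : D.s (some i) (D.word (m₂.map some) (vec b θ)) = D.word (m₂.map some) (vec b θ) := by
      apply D.s_apply_of_form_eq_zero
      refine (congrArg (D.form _) ht.symm).trans ?_
      rw [D.form_map_map (D.mem_W (hW m₂)), D.form_comm, ← top_latticeModel hθ hl]
      exact horth
    let w' := ((m₁ ++ m₂).map fun i : b.support ↦ P.reflection i).prod
    have hw' : w' (P.root θ) = P.root i₀ := by
      have e1 := toRootSpan_word hθ hl (m₁ ++ m₂) (vec b θ)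
      have e2 := toRootSpan_word hθ hl (m₁ ++ i :: m₂) (vec b θ)
      rw [toRootSpan_vec] at e1 e2
      rw [List.map_append, D.word_append, LinearEquiv.mul_apply] at e1 e2
      rw [List.map_cons, D.word_cons, LinearEquiv.mul_apply, hfix, hprod, hmap] at e2
      exact e1.symm.trans e2
    have h3 : length b w' ≤ (m₁ ++ m₂).length := by
      rw [length_eq_sInf]
      exact Nat.sInf_le ⟨_, rfl, rfl⟩
    have h4 := hmin w' (prod_mem_weyl _) hw'
    rw [← hlen] at h4
    simp only [List.length_append, List.length_cons] at h3 h4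
    omega

end

end RootPairing

end AbIdeal

namespace AbIdeal

/-! ### Type `A` and the simple roots not orthogonal to the highest root -/

lemma sum_cartanMatrix_A {n : ℕ} (k : Fin n) : ∑ l, CartanMatrix.A n l k =
    (if k.val = 0 then 1 else 0) + if k.val + 1 = n then 1 else 0 := by
  have h1 : ∀ l : Fin n, CartanMatrix.A n l k = (if l = k then 2 else 0) +
      ((if l.val + 1 = k.val then -1 else 0) + if l.val = k.val + 1 then -1 else 0) := by
    intro l
    simp only [CartanMatrix.A, Matrix.of_apply, Fin.ext_iff]
    split_ifs <;> omega
  rw [Finset.sum_congr rfl fun l _ ↦ h1 l, Finset.sum_add_distrib, Finset.sum_add_distrib,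
    Finset.sum_ite_eq' Finset.univ k, Fin.sum_univ_eq_sum_range (n := n)
      (fun l ↦ if l + 1 = k.val then (-1 : ℤ) else 0), Fin.sum_univ_eq_sum_range (n := n)
      (fun l ↦ if l = k.val + 1 then (-1 : ℤ) else 0), Finset.sum_ite_eq' (Finset.range n)]
  have hk := k.2
  have h2 : ∑ l ∈ Finset.range n, (if l + 1 = k.val then (-1 : ℤ) else 0) =
      if k.val = 0 then 0 else -1 := by
    split_ifs with h
    · exact Finset.sum_eq_zero fun l _ ↦ if_neg (by omega)
    · rw [Finset.sum_eq_single (k.val - 1) (fun l _ hl ↦ if_neg (by omega))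
        (fun hl ↦ absurd (Finset.mem_range.mpr (by omega)) hl), if_pos (by omega)]
  rw [h2]
  simp only [Finset.mem_univ, if_true, Finset.mem_range]
  split_ifs <;> omega

section RootPairing

variable {ι K M N : Type*} [Fintype ι] [DecidableEq ι] [Field K] [CharZero K] [AddCommGroup M]
  [Module K M] [AddCommGroup N] [Module K N] {P : RootPairing ι K M N} [P.IsCrystallographic]
  {b : P.Base} {θ : ι}

/-- The Dynkin diagram as a simple graph. -/
def dynkinGraph (b : P.Base) : SimpleGraph b.support where
  Adj i j := i ≠ j ∧ b.cartanMatrix i j ≠ 0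
  symm := ⟨fun _ _ h ↦ ⟨h.1.symm, fun h' ↦ h.2 (b.cartanMatrix_apply_eq_zero_iff_symm.mp h')⟩⟩
  loopless := ⟨fun _ h ↦ h.1 rfl⟩

lemma dynkinGraph_adj {i j : b.support} (h : (dynkinGraph b).Adj i j) :
    b.cartanMatrix i j ≤ -1 := by
  have := b.cartanMatrix_le_zero_of_ne i j h.1
  have := h.2
  lia

lemma dynkinGraph_reachable [P.IsReduced] [P.IsIrreducible] (i j : b.support) :
    (dynkinGraph b).Reachable i j := by
  refine b.induction_on_cartanMatrix (fun k ↦ (dynkinGraph b).Reachable i k) (i := i)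
    (SimpleGraph.Reachable.refl i) fun k l hk hlk ↦ ?_
  by_cases h : l = k
  · rwa [h]
  · exact hk.trans (SimpleGraph.Adj.reachable (G := dynkinGraph b) ⟨h, hlk⟩).symm

/-- The sum of the simple roots along an initial segment of a path in the Dynkin diagram is a
root. -/
lemma exists_vec_eq_sum_getVert {i j : b.support} {p : (dynkinGraph b).Walk i j} (hp : p.IsPath)
    (m : ℕ) (hm : m ≤ p.length) :
    ∃ γ, vec b γ = ∑ a ∈ Finset.range (m + 1), Pi.single (some (p.getVert a)) 1 := by
  induction m with
  | zero => exact ⟨i, by simpa using vec_simple b i⟩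
  | succ m ih =>
    obtain ⟨γ, hγ⟩ := ih (by omega)
    set k := p.getVert (m + 1) with hk
    have hsum : P.pairingIn ℤ γ k = ∑ a ∈ Finset.range (m + 1), b.cartanMatrix (p.getVert a) k := by
      have h1 : P.pairingIn ℤ γ k = P.coroot'In ℤ k (toRootSpan b γ (vec b γ)) := by
        rw [toRootSpan_vec]; rfl
      rw [h1, hγ, map_sum, map_sum]
      refine Finset.sum_congr rfl fun a _ ↦ ?_
      rw [toRootSpan_single_some]
      rfl
    have hne : ∀ a, a < m + 1 → p.getVert a ≠ k := fun a ha h ↦ by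
      have := hp.getVert_injOn (show a ≤ p.length by omega) (show m + 1 ≤ p.length by omega) h
      omega
    have hneg : P.pairingIn ℤ γ k < 0 := by
      rw [hsum, Finset.sum_range_succ]
      have h1 := dynkinGraph_adj (p.adj_getVert_succ (show m < p.length by omega))
      have h2 : ∑ a ∈ Finset.range m, b.cartanMatrix (p.getVert a) k ≤ 0 :=
        Finset.sum_nonpos fun a ha ↦ b.cartanMatrix_le_zero_of_ne _ _
          (hne a (by have := Finset.mem_range.mp ha; omega))
      lia
    have hpos : 0 ≤ vec b γ := by
      rw [hγ]
      exact Finset.sum_nonneg fun a _ ↦ Pi.single_nonneg.mpr zero_le_one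
    have hne' : P.root γ ≠ -P.root k := by
      intro h
      rw [← P.reflection_apply_self, ← P.root_reflectionPerm] at h
      rw [P.root.injective h, vec_neg, vec_simple] at hpos
      have := hpos (some k)
      rw [Pi.neg_apply, Pi.single_eq_same] at this
      norm_num at this
    obtain ⟨δ, hδ⟩ := P.root_add_root_mem_of_pairingIn_neg hneg hne'
    refine ⟨δ, ?_⟩
    rw [Finset.sum_range_succ, ← hγ, vec_eq_add b (n := 1) (by rw [one_smul]; exact hδ), one_smul,
      vec_simple]

/-- If two distinct simple roots are not orthogonal to the highest root `θ`, then `θ` is the sum of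
the simple roots along a path between them in the Dynkin diagram, and the root system is of type
`A` with the two simple roots at the ends of the diagram. -/
lemma isEndOfTypeA_of_form_ne [P.IsReduced] [P.IsIrreducible] (hθ : IsHighestRoot b θ)
    (hl : IsLong P θ) {i j : b.support} (hij : i ≠ j)
    (hi : (latticeModel hθ hl).form (Pi.single (some i) 1) (latticeModel hθ hl).top ≠ 0)
    (hj : (latticeModel hθ hl).form (Pi.single (some j) 1) (latticeModel hθ hl).top ≠ 0) :
    IsEndOfTypeA b (i : ι) ∧ ∀ t, (latticeModel hθ hl).imag t = 1 := by
  set D := latticeModel hθ hl with hD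
  obtain ⟨p, hp⟩ := (dynkinGraph_reachable i j).exists_isPath
  have hlen : 1 ≤ p.length := by
    by_contra h
    exact hij (p.eq_of_length_eq_zero (by omega))
  obtain ⟨γ, hγ⟩ := exists_vec_eq_sum_getVert hp p.length le_rfl
  have hco : ∀ k : b.support, D.co none (Pi.single (some k) 1) ≤ 0 := by
    intro k
    by_contra h
    have h1 := D.co_none_mul (Pi.single (some k) 1)
    have h2 := D.form_simple_top_nonneg k
    have h3 := D.form_top_pos
    change 0 ≤ D.form (Pi.single (some k) 1) D.top at h2
    nlinarith
  have hγco : D.co none (vec b γ) ≤ -2 := by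
    obtain ⟨m, hm⟩ : ∃ m, p.length = m + 1 := ⟨p.length - 1, by omega⟩
    have hm' : p.getVert (m + 1) = j := by rw [← hm, p.getVert_length]
    rw [hγ, map_sum, hm, Finset.sum_range_succ, hm', Finset.sum_range_succ', p.getVert_zero]
    have h1 : D.co none (Pi.single (some i) 1) < 0 := D.co_none_neg hi
    have h2 : D.co none (Pi.single (some j) 1) < 0 := D.co_none_neg hj
    have h3 := Finset.sum_nonpos fun a (_ : a ∈ Finset.range m) ↦ hco (p.getVert (a + 1))
    lia
  have hpos : 0 ≤ vec b γ := by
    rw [hγ]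
    exact Finset.sum_nonneg fun a _ ↦ Pi.single_nonneg.mpr zero_le_one
  have htop : D.top = ∑ a ∈ Finset.range (p.length + 1), Pi.single (some (p.getVert a)) 1 := by
    rw [← hγ]
    by_contra h
    have h1 : vec b γ ≠ -D.top := by
      intro h1
      rw [h1, neg_nonneg] at hpos
      exact D.not_nonpos (D.mem_roots_of_fin D.top_mem_finRoots)
        (by rw [top_latticeModel]; intro t; cases t with
          | none => simp
          | some k => exact zero_le_one.trans (one_le_vec_highest hθ k)) hpos
    have h2 := D.abs_co_none_le _ ⟨γ, rfl⟩ (Ne.symm h) h1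
    rw [abs_le] at h2
    lia
  let f : Fin (p.length + 1) → b.support := fun a ↦ p.getVert a
  have hf : Function.Injective f := fun a a' h ↦ Fin.ext
    (hp.getVert_injOn (show (a : ℕ) ≤ p.length by omega) (show (a' : ℕ) ≤ p.length by omega) h)
  have htop' : D.top = ∑ a, Pi.single (some (f a)) 1 := by
    rw [htop]
    exact (Fin.sum_univ_eq_sum_range (fun a ↦ (Pi.single (some (p.getVert a)) 1 :
      Option b.support → ℤ)) (p.length + 1)).symm
  have hf' : Function.Surjective f := by
    intro k
    by_contra h
    have h1 := one_le_vec_highest hθ k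
    rw [← top_latticeModel hθ hl, ← hD, htop', Finset.sum_apply, Finset.sum_eq_zero] at h1
    · norm_num at h1
    · intro a _
      exact Pi.single_eq_of_ne (fun h' ↦ h ⟨a, (Option.some_injective _ h').symm⟩) _
  let e : Fin (p.length + 1) ≃ b.support := Equiv.ofBijective f ⟨hf, hf'⟩
  have hone : ∀ k : b.support, D.top (some k) = 1 := by
    intro k
    obtain ⟨a, rfl⟩ := hf' k
    rw [htop', Finset.sum_apply, Finset.sum_eq_single a]
    · exact Pi.single_eq_same _ _
    · intro a' _ h
      exact Pi.single_eq_of_ne (fun h' ↦ h (hf (Option.some_injective _ h')).symm) _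
    · simp
  refine ⟨⟨p.length + 1, e, ?_, 0, ?_, Or.inl rfl⟩, ?_⟩
  -- The entries of the Cartan matrix of `b` are at most those of type `A`, while its column sums
  -- `⟨θ, αₖ^∨⟩` are at least those of type `A`.
  · have key : ∀ k, ∑ l, (CartanMatrix.A _ l k - b.cartanMatrix (e l) (e k)) ≤ 0 := by
      intro k
      rw [Finset.sum_sub_distrib, sum_cartanMatrix_A]
      have h1 : ∑ l, b.cartanMatrix (e l) (e k) = D.co (some (e k)) D.top := by
        rw [htop', map_sum]
        refine Finset.sum_congr rfl fun l _ ↦ ?_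
        rw [co_some_latticeModel, toRootSpan_single_some]
        rfl
      have h2 := D.two_form (some (e k)) D.top
      have h3 := D.form_simple_top_nonneg (e k)
      have h4 := D.form_self_pos (D.sr_mem_roots (some (e k)))
      rw [D.form_comm] at h3
      change 0 ≤ D.form D.top (Pi.single (some (e k)) 1) at h3
      change 0 < D.form (Pi.single (some (e k)) 1) (Pi.single (some (e k)) 1) at h4
      have h5 : 0 ≤ D.co (some (e k)) D.top := by
        by_contra h
        nlinarith
      have h6 : D.form (Pi.single (some (e k)) 1) D.top ≠ 0 → 1 ≤ D.co (some (e k)) D.top := by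
        intro h
        by_contra h'
        have : D.co (some (e k)) D.top = 0 := by lia
        rw [this, zero_mul] at h2
        rw [D.form_comm] at h
        lia
      have h7 : k.val = 0 → e k = i := fun h ↦ by
        change p.getVert k = i
        rw [h, p.getVert_zero]
      have h8 : k.val = p.length → e k = j := fun h ↦ by
        change p.getVert k = j
        rw [h, p.getVert_length]
      rw [h1]
      split_ifs with h9 h10 h10
      · omega
      · have := h6 (by rw [h7 h9]; exact hi)
        lia
      · have := h6 (by rw [h8 (by omega)]; exact hj)
        lia
      · lia
    have hle : ∀ l k, b.cartanMatrix (e l) (e k) ≤ CartanMatrix.A _ l k := by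
      intro l k
      simp only [CartanMatrix.A, Matrix.of_apply]
      split_ifs with h1 h2
      · rw [h1, b.cartanMatrix_apply_same]
      · have hadj : (dynkinGraph b).Adj (e l) (e k) := by
          rcases h2 with h2 | h2
          · have := p.adj_getVert_succ (i := l) (by omega)
            rwa [h2] at this
          · have := p.adj_getVert_succ (i := k) (by omega)
            rw [h2] at this
            exact this.symm
        exact dynkinGraph_adj hadj
      · exact b.cartanMatrix_le_zero_of_ne _ _ fun h ↦ h1 (e.injective h)
    intro l k
    have h0 := (Finset.sum_eq_zero_iff_of_nonneg (fun l _ ↦ sub_nonneg.mpr (hle l k))).mp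
      (le_antisymm (key k) (Finset.sum_nonneg fun l _ ↦ sub_nonneg.mpr (hle l k))) l
      (Finset.mem_univ l)
    exact (sub_eq_zero.mp h0).symm
  · change ((p.getVert 0 : b.support) : ι) = i
    rw [p.getVert_zero]
  · rintro (_ | k)
    · exact D.imag_none
    · rw [← D.top_apply, hone]

/-- If a simple root is the highest root, then the root system is of type `A₁`. -/
lemma isEndOfTypeA_of_highest [P.IsReduced] [P.IsIrreducible] (hθ : IsHighestRoot b θ)
    (h : θ ∈ b.support) : IsEndOfTypeA b θ := by
  have hsub : ∀ k : b.support, k = ⟨θ, h⟩ := by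
    intro k
    by_contra hk
    have h1 := one_le_vec_highest hθ k
    rw [vec_simple b ⟨θ, h⟩, Pi.single_eq_of_ne (fun h' ↦ hk (Option.some_injective _ h'))] at h1
    norm_num at h1
  let : Unique b.support := ⟨⟨⟨θ, h⟩⟩, hsub⟩
  refine ⟨1, Equiv.ofUnique _ _, fun i j ↦ ?_, 0, ?_, Or.inl rfl⟩
  · rw [Subsingleton.elim i j, b.cartanMatrix_apply_same]
    simp [CartanMatrix.A]
  · rw [hsub (Equiv.ofUnique (Fin 1) b.support 0)]

end RootPairing

end AbIdeal

namespace AbIdeal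

/-! ### Abelian ideals of the Borel subalgebra and their root sets -/

section LieTheory

variable {K L : Type*} [Field K] [CharZero K] [LieRing L] [LieAlgebra K L]
  [FiniteDimensional K L] [IsKilling K L] {H : LieSubalgebra K L} [H.IsCartanSubalgebra]
  [LieModule.IsTriangularizable K H L]

/-- A subspace that contains a nonzero vector of a root space contains the root space. -/
lemma rootSpace_le_of_mem {S : Submodule K L} (γ : H.root) {x : L} (hx : x ∈ rootSpace H γ.1)
    (h0 : x ≠ 0) (hS : x ∈ S) : (rootSpace H γ.1).toSubmodule ≤ S := by
  intro y hy
  obtain ⟨k, hk⟩ := (finrank_eq_one_iff_of_nonzero' (⟨x, hx⟩ : rootSpace H γ.1)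
    (by simpa using h0)).mp (finrank_rootSpace_eq_one _ (H.isNonZero_coe_root γ)) ⟨y, hy⟩
  rw [← show k • x = y from congrArg Subtype.val hk]
  exact S.smul_mem k hS

/-- The bracket of two weight vectors vanishes, or lies in the Cartan subalgebra, or lies in a root
space. -/
lemma lie_eq_zero_or_mem_rootSpace {χ χ' : H → K} {x y : L} (hx : x ∈ rootSpace H χ)
    (hy : y ∈ rootSpace H χ') :
    ⁅x, y⁆ = 0 ∨ χ + χ' = 0 ∨ ∃ δ : H.root, (δ.1 : H → K) = χ + χ' ∧ ⁅x, y⁆ ∈ rootSpace H δ.1 := by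
  have hs : ⁅x, y⁆ ∈ rootSpace H (χ + χ') := lie_mem_genWeightSpace_of_mem_genWeightSpace hx hy
  by_cases hz : ⁅x, y⁆ = 0
  · exact Or.inl hz
  by_cases h0 : χ + χ' = 0
  · exact Or.inr (Or.inl h0)
  have hne : rootSpace H (χ + χ') ≠ ⊥ := by
    intro hbot
    rw [hbot] at hs
    exact hz (by simpa using hs)
  let ψ : LieModule.Weight K H L := ⟨χ + χ', hne⟩
  have hψ : ¬ ψ.IsZero := h0
  exact Or.inr (Or.inr ⟨⟨ψ, by simpa using hψ⟩, rfl, hs⟩)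

/-- If `β` and `β - α` are roots, then `[𝔤_{-α}, 𝔤_β] ≠ 0`, by the representation theory of the
`𝔰𝔩₂`-triple attached to `α` on the `α`-string through `β`. -/
lemma exists_lie_ne_zero {α β δ : H.root} (h : (δ.1 : H → K) = (β.1 : H → K) - (α.1 : H → K)) :
    ∃ f ∈ rootSpace H (-(α.1 : H → K)), ∃ y ∈ rootSpace H β.1, ⁅f, y⁆ ≠ 0 := by
  have hα := H.isNonZero_coe_root α
  obtain ⟨x, hx, x_ne0⟩ := (LieModule.chainTop (α.1 : H → K) β.1).exists_ne_zero
  obtain ⟨h', e, f, isSl2, he, hf⟩ := exists_isSl2Triple_of_weight_isNonZero hα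
  obtain rfl := isSl2.h_eq_coroot hα he hf
  have prim : isSl2.HasPrimitiveVectorWith x (chainLength α.1 β.1 : K) :=
    have := lie_mem_genWeightSpace_of_mem_genWeightSpace he hx
    ⟨x_ne0, (chainLength_smul _ _ hx).symm,
      by rwa [LieModule.genWeightSpace_add_chainTop _ _ hα] at this⟩
  set n := LieModule.chainTopCoeff (α.1 : H → K) β.1 with hn
  have hbot : (1 : ℤ) ≤ LieModule.chainBotCoeff (α.1 : H → K) β.1 := by
    apply le_chainBotCoeff_of_rootSpace_ne_top α.1 β.1 hα 1
    have : (-1 : ℤ) • (α.1 : H → K) + β.1 = δ.1 := by rw [h, neg_one_smul]; abel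
    rw [this]
    exact δ.1.genWeightSpace_ne_bot
  have hlen : n + 1 ≤ chainLength α.1 β.1 := by
    rw [← chainTopCoeff_add_chainBotCoeff]
    lia
  have hmem := LieAlgebra.toEnd_pow_apply_mem hf hx n
  have hβ : n • (-(α.1 : H → K)) + LieModule.chainTop (α.1 : H → K) β.1 = β.1 := by
    rw [LieModule.coe_chainTop', ← hn, smul_neg]
    abel
  rw [hβ] at hmem
  refine ⟨f, hf, _, hmem, ?_⟩
  have := prim.pow_toEnd_f_ne_zero_of_eq_nat rfl hlen
  rwa [pow_succ', Module.End.mul_apply] at this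

/-- The sum of the weight spaces with weights in a set. -/
noncomputable def weightSum (H : LieSubalgebra K L) [H.IsCartanSubalgebra] (X : Set (H → K)) :
    LieSubmodule K H L :=
  ⨆ χ ∈ X, rootSpace H χ

lemma rootSpace_le_weightSum {X : Set (H → K)} {χ : H → K} (h : χ ∈ X) :
    rootSpace H χ ≤ weightSum H X :=
  le_biSup (fun χ ↦ rootSpace H χ) h

lemma mem_of_rootSpace_le_weightSum {X : Set (H → K)} {γ : H.root}
    (h : rootSpace H γ.1 ≤ weightSum H X) : (γ.1 : H → K) ∈ X := by
  by_contra hγ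
  have := (LieModule.iSupIndep_genWeightSpace K H L).disjoint_biSup hγ
  exact γ.1.2 (this.eq_bot_of_le h)

/-- The bracket of two sums of weight spaces lies in a subspace as soon as this holds for weight
vectors. -/
lemma lie_mem_of_mem_weightSum {X Y : Set (H → K)} {T : Submodule K L} {x y : L}
    (hx : x ∈ weightSum H X) (hy : y ∈ weightSum H Y)
    (h : ∀ χ ∈ X, ∀ ψ ∈ Y, ∀ x ∈ rootSpace H χ, ∀ y ∈ rootSpace H ψ, ⁅x, y⁆ ∈ T) : ⁅x, y⁆ ∈ T := by
  have h1 : (weightSum H Y).toSubmodule ≤ T.comap (LieAlgebra.ad K L x) := by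
    rw [weightSum, LieSubmodule.iSup_toSubmodule]
    simp only [LieSubmodule.iSup_toSubmodule]
    refine iSup₂_le fun ψ hψ y hy ↦ ?_
    have h2 : (weightSum H X).toSubmodule ≤ T.comap (-(LieAlgebra.ad K L y)) := by
      rw [weightSum, LieSubmodule.iSup_toSubmodule]
      simp only [LieSubmodule.iSup_toSubmodule]
      refine iSup₂_le fun χ hχ x hx ↦ ?_
      have := h χ hχ ψ hψ x hx y hy
      rw [← lie_skew] at this
      exact this
    have := h2 hx
    change -⁅y, x⁆ ∈ T at this
    rwa [lie_skew] at this
  exact h1 hy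

lemma borelSubmodule_eq_weightSum (b : (rootSystem H).Base) :
    borelSubmodule b =
      (weightSum H ({0} ∪ {χ | ∃ γ : H.root, b.IsPos γ ∧ χ = γ.1})).toSubmodule := by
  have h0 : (rootSpace H (0 : H → K)).toSubmodule = H.toSubmodule := by
    rw [LieAlgebra.rootSpace_zero_eq]; rfl
  apply le_antisymm
  · refine sup_le ?_ (iSup_le fun γ ↦ ?_)
    · rw [← h0]
      exact rootSpace_le_weightSum (Or.inl rfl)
    · exact rootSpace_le_weightSum (Or.inr ⟨γ.1, γ.2, rfl⟩)
  · rw [weightSum, LieSubmodule.iSup_toSubmodule]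
    simp only [LieSubmodule.iSup_toSubmodule]
    refine iSup₂_le ?_
    rintro _ (rfl | ⟨γ, hγ, rfl⟩)
    · rw [h0]
      exact le_sup_left
    · exact le_sup_of_le_right (le_iSup_of_le (⟨γ, hγ⟩ : {γ : H.root // b.IsPos γ}) le_rfl)

variable {b : (rootSystem H).Base} {𝔞 𝔞' : LieSubalgebra K L}

lemma isPos_of_rootSpace_le_borel {γ : H.root}
    (h : (rootSpace H γ.1).toSubmodule ≤ borelSubmodule b) : b.IsPos γ := by
  rw [borelSubmodule_eq_weightSum] at h
  rcases mem_of_rootSpace_le_weightSum h with h | ⟨δ, hδ, h⟩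
  · exact absurd h (H.isNonZero_coe_root γ)
  · rwa [show γ = δ from Subtype.ext (DFunLike.coe_injective h)]

lemma mem_borel_of_mem_cartan {x : L} (hx : x ∈ H) : x ∈ borel b :=
  (le_sup_left : H.toSubmodule ≤ borelSubmodule b) hx

lemma mem_borel_of_mem_rootSpace {γ : H.root} (hγ : b.IsPos γ) {x : L} (hx : x ∈ rootSpace H γ.1) :
    x ∈ borel b :=
  (le_sup_of_le_right (le_iSup_of_le (⟨γ, hγ⟩ : {γ : H.root // b.IsPos γ}) le_rfl) :
    (rootSpace H γ.1).toSubmodule ≤ borelSubmodule b) hx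

lemma IsAbelianIdeal.mem_rootsOf (h𝔞 : IsAbelianIdeal b 𝔞) {γ : H.root}
    (h : (rootSpace H γ.1).toSubmodule ≤ 𝔞.toSubmodule) : γ ∈ rootsOf b 𝔞 :=
  ⟨isPos_of_rootSpace_le_borel (h.trans h𝔞.1), h⟩

/-- An abelian ideal of the Borel subalgebra meets the Cartan subalgebra trivially: if `h` lies in
the intersection and `γ(h) ≠ 0`, then `𝔤_γ` lies in the ideal and does not commute with `h`. -/
lemma IsAbelianIdeal.eq_zero_of_mem_cartan (h𝔞 : IsAbelianIdeal b 𝔞) {x : L} (hx : x ∈ 𝔞)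
    (hxH : x ∈ H) : x = 0 := by
  have hpos : ∀ γ : H.root, b.IsPos γ → γ.1 (⟨x, hxH⟩ : H) = 0 := by
    intro γ hγ
    by_contra h0
    obtain ⟨e, he, he0⟩ := γ.1.exists_ne_zero
    have h1 : ⁅x, e⁆ = γ.1 (⟨x, hxH⟩ : H) • e := lie_eq_smul_of_mem_rootSpace he ⟨x, hxH⟩
    have h2 : ⁅e, x⁆ ∈ 𝔞 := h𝔞.2.1 e (mem_borel_of_mem_rootSpace hγ he) x hx
    rw [← lie_skew, h1, neg_mem_iff] at h2
    have h3 := h𝔞.2.2 x hx _ h2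
    rw [lie_smul, h1, smul_smul, smul_eq_zero] at h3
    rcases h3 with h3 | h3
    · exact h0 (mul_self_eq_zero.mp h3)
    · exact he0 h3
  have hall : (⟨x, hxH⟩ : H) ∈ ⨅ χ : LieModule.Weight K H L, χ.ker := by
    rw [Submodule.mem_iInf]
    intro χ
    change χ (⟨x, hxH⟩ : H) = 0
    by_cases hχ : χ.IsZero
    · rw [hχ]; rfl
    let γ : H.root := ⟨χ, by simpa using hχ⟩
    by_cases hγ : b.IsPos γ
    · exact hpos γ hγ
    · let := (rootSystem H).indexNeg
      have h1 := hpos (-γ) ((RootPairing.Base.IsPos.or_neg b γ).resolve_left hγ)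
      have h2 : (rootSystem H).root (-γ) = -(rootSystem H).root γ := by
        rw [RootPairing.indexNeg_neg, RootPairing.root_reflectionPerm,
          RootPairing.reflection_apply_self]
      have h3 := LinearMap.congr_fun h2 (⟨x, hxH⟩ : H)
      have h4 : χ (⟨x, hxH⟩ : H) = -(-γ).1 (⟨x, hxH⟩ : H) := by
        rw [← neg_eq_iff_eq_neg]
        exact h3.symm
      rw [h4, h1, neg_zero]
  rw [iInf_ker_weight_eq_bot, Submodule.mem_bot] at hall
  exact congrArg Subtype.val hall

/-- An abelian ideal of the Borel subalgebra is the sum of the root spaces that it contains. -/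
lemma IsAbelianIdeal.le_of_rootsOf (h𝔞 : IsAbelianIdeal b 𝔞) {S : Submodule K L}
    (h : ∀ γ ∈ rootsOf b 𝔞, (rootSpace H γ.1).toSubmodule ≤ S) : 𝔞.toSubmodule ≤ S := by
  let N : LieSubmodule K H L :=
    { 𝔞.toSubmodule with
      lie_mem := fun {x y} hy ↦ h𝔞.2.1 x (mem_borel_of_mem_cartan x.2) y hy }
  have hN : N = ⨆ χ : LieModule.Weight K H L, N ⊓ LieModule.genWeightSpace L χ :=
    LieModule.eq_iSup_inf_genWeightSpace (N := N)
  change N.toSubmodule ≤ S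
  rw [hN, LieSubmodule.iSup_toSubmodule]
  refine iSup_le fun χ x hx ↦ ?_
  obtain ⟨hx1 : x ∈ 𝔞, hx2⟩ := hx
  by_cases hχ : χ.IsZero
  · replace hx2 : x ∈ rootSpace H (0 : H → K) := by
      rw [hχ] at hx2
      exact hx2
    rw [LieAlgebra.rootSpace_zero_eq] at hx2
    rw [h𝔞.eq_zero_of_mem_cartan hx1 hx2]
    exact S.zero_mem
  by_cases hx0 : x = 0
  · rw [hx0]
    exact S.zero_mem
  let γ : H.root := ⟨χ, by simpa using hχ⟩
  exact h γ (h𝔞.mem_rootsOf (rootSpace_le_of_mem γ hx2 hx0 hx1)) hx2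

lemma IsAbelianIdeal.le_iff (h𝔞 : IsAbelianIdeal b 𝔞) :
    𝔞 ≤ 𝔞' ↔ rootsOf b 𝔞 ⊆ rootsOf b 𝔞' :=
  ⟨fun h _ hγ ↦ ⟨hγ.1, hγ.2.trans h⟩, fun h ↦ h𝔞.le_of_rootsOf fun _ hγ ↦ (h hγ).2⟩

lemma IsAbelianIdeal.eq_weightSum (h𝔞 : IsAbelianIdeal b 𝔞) : 𝔞.toSubmodule =
    (weightSum H ((fun γ : H.root ↦ (γ.1 : H → K)) '' rootsOf b 𝔞)).toSubmodule := by
  refine le_antisymm (h𝔞.le_of_rootsOf fun γ hγ ↦ rootSpace_le_weightSum ⟨γ, hγ, rfl⟩) ?_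
  rw [weightSum, LieSubmodule.iSup_toSubmodule]
  simp only [LieSubmodule.iSup_toSubmodule]
  refine iSup₂_le ?_
  rintro _ ⟨γ, hγ, rfl⟩
  exact hγ.2

/-- A set of positive roots that is stable under the addition of positive roots, and in which no
two roots add up to a root, is the set of roots of an abelian ideal. -/
lemma exists_isAbelianIdeal {I : Set H.root} (hI : ∀ γ ∈ I, b.IsPos γ)
    (hadd : ∀ γ ∈ I, ∀ β, b.IsPos β → ∀ δ : H.root,
      (rootSystem H).root δ = (rootSystem H).root γ + (rootSystem H).root β → δ ∈ I)
    (hab : ∀ γ ∈ I, ∀ β ∈ I, ∀ δ : H.root,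
      (rootSystem H).root δ ≠ (rootSystem H).root γ + (rootSystem H).root β) :
    ∃ 𝔞 : LieSubalgebra K L, IsAbelianIdeal b 𝔞 ∧ rootsOf b 𝔞 = I := by
  set X : Set (H → K) := (fun γ : H.root ↦ (γ.1 : H → K)) '' I with hX
  have hpos : ∀ γ β : H.root, b.IsPos γ → b.IsPos β → (γ.1 : H → K) + β.1 ≠ 0 := by
    intro γ β hγ hβ h
    let := (rootSystem H).indexNeg
    have e0 : (rootSystem H).root γ + (rootSystem H).root β = 0 := by
      ext h'
      exact congrFun h h'
    have hn : β = -γ := by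
      apply (rootSystem H).root.injective
      rw [RootPairing.indexNeg_neg, RootPairing.root_reflectionPerm,
        RootPairing.reflection_apply_self]
      exact (neg_eq_of_add_eq_zero_right e0).symm
    rw [hn, RootPairing.Base.IsPos.neg_iff_not] at hβ
    exact hβ hγ
  have hroot : ∀ γ β δ : H.root, (δ.1 : H → K) = γ.1 + β.1 →
      (rootSystem H).root δ = (rootSystem H).root γ + (rootSystem H).root β := by
    intro γ β δ h
    ext x
    exact congrFun h x
  have hcomm : ∀ x ∈ weightSum H X, ∀ y ∈ weightSum H X, ⁅x, y⁆ = 0 := by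
    intro x hx y hy
    rw [← Submodule.mem_bot K]
    refine lie_mem_of_mem_weightSum hx hy ?_
    rintro _ ⟨γ, hγ, rfl⟩ _ ⟨β, hβ, rfl⟩ x hx y hy
    rcases lie_eq_zero_or_mem_rootSpace hx hy with h | h | ⟨δ, h, -⟩
    · exact h
    · exact absurd h (hpos γ β (hI γ hγ) (hI β hβ))
    · exact absurd (hroot γ β δ h) (hab γ hγ β hβ δ)
  let 𝔞 : LieSubalgebra K L :=
    { (weightSum H X).toSubmodule with
      lie_mem' := fun {x y} hx hy ↦ by
        rw [hcomm x hx y hy]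
        exact (weightSum H X).zero_mem }
  have hle : 𝔞.toSubmodule ≤ borelSubmodule b := by
    rw [borelSubmodule_eq_weightSum]
    refine iSup₂_le (f := fun χ (_ : χ ∈ X) ↦ rootSpace H χ) ?_
    rintro _ ⟨γ, hγ, rfl⟩
    exact rootSpace_le_weightSum (Or.inr ⟨γ, hI γ hγ, rfl⟩)
  refine ⟨𝔞, ⟨hle, fun x hx y hy ↦ ?_, hcomm⟩, ?_⟩
  · have hx' : x ∈ borelSubmodule b := hx
    rw [borelSubmodule_eq_weightSum] at hx'
    refine lie_mem_of_mem_weightSum (T := 𝔞.toSubmodule) hx' hy ?_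
    rintro _ (rfl | ⟨β, hβ, rfl⟩) _ ⟨γ, hγ, rfl⟩ x hx y hy
    · rw [LieAlgebra.rootSpace_zero_eq] at hx
      exact (weightSum H X).lie_mem (x := ⟨x, hx⟩) (rootSpace_le_weightSum (X := X) ⟨γ, hγ, rfl⟩ hy)
    · rcases lie_eq_zero_or_mem_rootSpace hx hy with h | h | ⟨δ, h, hδ⟩
      · rw [h]
        exact 𝔞.zero_mem
      · exact absurd h (hpos β γ hβ (hI γ hγ))
      · have hδI : δ ∈ I := hadd γ hγ β hβ δ (by rw [add_comm]; exact hroot β γ δ h)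
        exact rootSpace_le_weightSum (X := X) ⟨δ, hδI, rfl⟩ hδ
  · ext γ
    refine ⟨fun h ↦ ?_, fun h ↦ ⟨hI γ h, rootSpace_le_weightSum (X := X) ⟨γ, h, rfl⟩⟩⟩
    obtain ⟨δ, hδ, h'⟩ := mem_of_rootSpace_le_weightSum (X := X) h.2
    rwa [← show δ = γ from Subtype.ext (DFunLike.coe_injective h')]

/-- The root space of the negative of a simple root `α` normalises an abelian ideal exactly when
the set of roots of the ideal does not contain `α` and is stable under the subtraction of `α`. -/
lemma IsAbelianIdeal.rootSpace_neg_le_normalizer_iff (h𝔞 : IsAbelianIdeal b 𝔞) {α : H.root} :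
    (rootSpace H (-(α.1 : H → K))).toSubmodule ≤ 𝔞.normalizer.toSubmodule ↔
      α ∉ rootsOf b 𝔞 ∧ ∀ γ ∈ rootsOf b 𝔞, ∀ δ : H.root,
        (rootSystem H).root δ = (rootSystem H).root γ - (rootSystem H).root α →
          δ ∈ rootsOf b 𝔞 := by
  have hsub : ∀ γ δ : H.root,
      (rootSystem H).root δ = (rootSystem H).root γ - (rootSystem H).root α ↔
        (δ.1 : H → K) = (γ.1 : H → K) - α.1 := by
    intro γ δ
    constructor
    · intro h
      funext x
      exact LinearMap.congr_fun h x
    · intro h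
      ext x
      exact congrFun h x
  constructor
  · intro h
    refine ⟨fun hα ↦ ?_, fun γ hγ δ hδ ↦ ?_⟩
    · obtain ⟨h', e, f, isSl2, he, hf⟩ :=
        exists_isSl2Triple_of_weight_isNonZero (H.isNonZero_coe_root α)
      have h1 : ⁅f, e⁆ ∈ 𝔞 := (𝔞.mem_normalizer_iff f).mp (h hf) e (hα.2 he)
      rw [← lie_skew, isSl2.lie_e_f, neg_mem_iff] at h1
      have h2 := h𝔞.2.2 _ h1 e (hα.2 he)
      rw [isSl2.lie_h_e_smul K, smul_eq_zero] at h2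
      exact h2.elim two_ne_zero isSl2.e_ne_zero
    · obtain ⟨f, hf, y, hy, hne⟩ := exists_lie_ne_zero ((hsub γ δ).mp hδ)
      have h1 : ⁅f, y⁆ ∈ 𝔞 := (𝔞.mem_normalizer_iff f).mp (h hf) y (hγ.2 hy)
      have h2 : ⁅f, y⁆ ∈ rootSpace H δ.1 := by
        rw [(hsub γ δ).mp hδ, sub_eq_neg_add]
        exact lie_mem_genWeightSpace_of_mem_genWeightSpace hf hy
      exact h𝔞.mem_rootsOf (rootSpace_le_of_mem δ h2 hne h1)
  · rintro ⟨h1, h2⟩ f hf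
    refine (𝔞.mem_normalizer_iff f).mpr fun y hy ↦ ?_
    have hy' : y ∈ 𝔞.toSubmodule := hy
    rw [h𝔞.eq_weightSum] at hy'
    have hf' : f ∈ weightSum H {-(α.1 : H → K)} :=
      rootSpace_le_weightSum (Set.mem_singleton _) hf
    refine lie_mem_of_mem_weightSum (T := 𝔞.toSubmodule) hf' hy' ?_
    rintro χ hχ _ ⟨γ, hγ, rfl⟩ x hx y hy
    rw [Set.mem_singleton_iff.mp hχ] at hx
    rcases lie_eq_zero_or_mem_rootSpace hx hy with h | h | ⟨δ, h, hδ⟩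
    · rw [h]
      exact 𝔞.zero_mem
    · refine absurd ?_ h1
      rwa [show α = γ from Subtype.ext (DFunLike.coe_injective (neg_add_eq_zero.mp h))]
    · refine (h2 γ hγ δ ((hsub γ δ).mpr ?_)).2 hδ
      rw [h, neg_add_eq_sub]

lemma IsAbelianIdeal.rootSpace_le_normalizer (h𝔞 : IsAbelianIdeal b 𝔞) {γ : H.root}
    (hγ : b.IsPos γ) : (rootSpace H γ.1).toSubmodule ≤ 𝔞.normalizer.toSubmodule := fun x hx ↦
  (𝔞.mem_normalizer_iff x).mpr fun y hy ↦ h𝔞.2.1 x (mem_borel_of_mem_rootSpace hγ hx) y hy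

end LieTheory

end AbIdeal

namespace AbIdeal

/-! ### The fibres of the rootlet map and the normalisers of their ideals -/

section LieTheory

variable {K L : Type*} [Field K] [CharZero K] [LieRing L] [LieAlgebra K L]
  [FiniteDimensional K L] [IsKilling K L] {H : LieSubalgebra K L} [H.IsCartanSubalgebra]
  [LieModule.IsTriangularizable K H L] [DecidableEq H.root]
  {b : (rootSystem H).Base} {θ : H.root} (hθ : IsHighestRoot b θ) (hl : IsLong (rootSystem H) θ)

/-- The positive roots `γ` such that `w` makes the affine root `δ - γ` negative. -/
def inversionRoots (w : (Option b.support → ℤ) ≃ₗ[ℤ] (Option b.support → ℤ)) : Set H.root :=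
  {γ | b.IsPos γ ∧ w ((latticeModel hθ hl).imag - vec b γ) ≤ 0}

variable {hθ hl} {i₀ : b.support} {w w' : (Option b.support → ℤ) ≃ₗ[ℤ] (Option b.support → ℤ)}

lemma mem_inversionRoots_of_nonpos (hw : (latticeModel hθ hl).IsFib i₀ w) {γ : H.root}
    (h : w ((latticeModel hθ hl).imag - vec b γ) ≤ 0) : γ ∈ inversionRoots hθ hl w := by
  obtain ⟨x, -, hx0, hx⟩ := hw.exists_eq_sub
    ((latticeModel hθ hl).imag_sub_mem_roots ⟨γ, rfl⟩)
    ((latticeModel hθ hl).imag_sub_nonneg ⟨γ, rfl⟩) h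
  rw [sub_right_inj] at hx
  exact ⟨(isPos_iff_vec_nonneg b γ).mpr (hx ▸ hx0), h⟩

lemma inversionRoots_subset (h : ∀ x ∈ (latticeModel hθ hl).roots, 0 ≤ x → w x ≤ 0 → w' x ≤ 0) :
    inversionRoots hθ hl w ⊆ inversionRoots hθ hl w' := fun γ hγ ↦
  ⟨hγ.1, h _ ((latticeModel hθ hl).imag_sub_mem_roots ⟨γ, rfl⟩)
    ((latticeModel hθ hl).imag_sub_nonneg ⟨γ, rfl⟩) hγ.2⟩

/-- Every element of the fibre over a simple root cuts out the root set of an abelian ideal. -/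
lemma exists_mem_fibre (hw : (latticeModel hθ hl).IsFib i₀ w) :
    ∃ 𝔞 ∈ fibre b θ i₀.1, rootsOf b 𝔞 = inversionRoots hθ hl w := by
  set D := latticeModel hθ hl with hD
  have hvec : ∀ {γ β δ : H.root}, (rootSystem H).root δ =
      (rootSystem H).root γ + (rootSystem H).root β → vec b δ = vec b γ + vec b β := by
    intro γ β δ h
    rw [vec_eq_add b (n := 1) (by rw [one_smul]; exact h), one_smul]
  obtain ⟨𝔞, h𝔞, hroots⟩ := exists_isAbelianIdeal (b := b) (I := inversionRoots hθ hl w)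
    (fun γ hγ ↦ hγ.1)
    (by
      intro γ hγ β hβ δ h
      apply mem_inversionRoots_of_nonpos hw
      have h1 : 0 ≤ w (vec b β) :=
        hw.map_nonneg ((isPos_iff_vec_nonneg b β).mp hβ) (vec_none b β)
      rw [hvec h, ← sub_sub, map_sub]
      exact sub_nonpos.mpr (hγ.2.trans h1))
    (by
      intro γ hγ β hβ δ h
      -- `w (γ + β) ≥ 2δ`, but `w δ' ≤ w θ < 2δ` for all finite roots `δ'`
      have h1 : w D.imag - w (vec b γ) ≤ 0 := by rw [← map_sub]; exact hγ.2
      have h2 : w D.imag - w (vec b β) ≤ 0 := by rw [← map_sub]; exact hβ.2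
      have h3 : 0 ≤ w (D.top - vec b δ) := hw.map_nonneg
        (sub_nonneg.mpr (D.le_top' ⟨δ, rfl⟩)) (by
          rw [Pi.sub_apply, D.top_none, vec_none, sub_zero])
      have h4 := hw.map_eq
      rw [map_sub, two_nsmul, map_add, D.map_imag hw.mem] at h4
      rw [D.map_imag hw.mem] at h1 h2
      rw [hvec h, map_sub, map_add] at h3
      have h5 := h1 (some i₀)
      have h6 := h2 (some i₀)
      have h7 := h3 (some i₀)
      have h8 := congrFun h4 (some i₀)
      rw [AffineSystem.sr_self] at h8
      simp only [Pi.sub_apply, Pi.add_apply, Pi.zero_apply] at h5 h6 h7 h8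
      lia)
  refine ⟨𝔞, ⟨h𝔞, ?_, ?_⟩, hroots⟩
  · rintro rfl
    have h1 : θ ∈ rootsOf b (⊥ : LieSubalgebra K L) := by
      rw [hroots]
      apply mem_inversionRoots_of_nonpos hw
      have h2 : D.imag - vec b θ = AffineSystem.sr none := add_sub_cancel_left _ _
      rw [← hD, h2, hw.map_sr_none, sub_nonpos]
      intro t
      by_cases ht : t = some i₀
      · rw [ht, AffineSystem.sr_self]
        exact D.one_le_imag _
      · rw [AffineSystem.sr_ne ht]
        exact zero_le_one.trans (D.one_le_imag _)
    obtain ⟨x, hx, hx0⟩ := θ.1.exists_ne_zero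
    exact hx0 (h1.2 hx)
  · rw [isRootlet_iff hθ hl (fun γ hγ ↦ hγ.1)]
    exact ⟨w, hw, hroots⟩

lemma exists_isFib_of_mem_fibre {𝔞 : LieSubalgebra K L} (h𝔞 : 𝔞 ∈ fibre b θ i₀.1) :
    ∃ w, (latticeModel hθ hl).IsFib i₀ w ∧ rootsOf b 𝔞 = inversionRoots hθ hl w :=
  (isRootlet_iff hθ hl (fun _ hγ ↦ hγ.1)).mp h𝔞.2.2

/-- An element whose inversions are among those of every element of the fibre gives the smallest
ideal with the given rootlet. -/
lemma isLeast_fibre (hw : ∀ w', (latticeModel hθ hl).IsFib i₀ w' →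
      ∀ x ∈ (latticeModel hθ hl).roots, 0 ≤ x → w x ≤ 0 → w' x ≤ 0)
    {𝔞 : LieSubalgebra K L} (h𝔞 : 𝔞 ∈ fibre b θ i₀.1)
    (hroots : rootsOf b 𝔞 = inversionRoots hθ hl w) : IsLeast (fibre b θ i₀.1) 𝔞 := by
  refine ⟨h𝔞, fun 𝔞' h𝔞' ↦ ?_⟩
  obtain ⟨w', hw', h'⟩ := exists_isFib_of_mem_fibre (hθ := hθ) (hl := hl) h𝔞'
  rw [h𝔞.1.le_iff, hroots, h']
  exact inversionRoots_subset (hw w' hw')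

/-- An element whose inversions comprise those of every element of the fibre gives the largest
ideal with the given rootlet. -/
lemma isGreatest_fibre (hw : ∀ w', (latticeModel hθ hl).IsFib i₀ w' →
      ∀ x ∈ (latticeModel hθ hl).roots, 0 ≤ x → w' x ≤ 0 → w x ≤ 0)
    {𝔞 : LieSubalgebra K L} (h𝔞 : 𝔞 ∈ fibre b θ i₀.1)
    (hroots : rootsOf b 𝔞 = inversionRoots hθ hl w) : IsGreatest (fibre b θ i₀.1) 𝔞 := by
  refine ⟨h𝔞, fun 𝔞' h𝔞' ↦ ?_⟩
  obtain ⟨w', hw', h'⟩ := exists_isFib_of_mem_fibre (hθ := hθ) (hl := hl) h𝔞'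
  rw [h𝔞'.1.le_iff, hroots, h']
  exact inversionRoots_subset (hw w' hw')

/-- If the set of roots cut out by `w` does not contain the simple root `αᵢ` and is stable under the
subtraction of `αᵢ`, then it is stable under the reflection in `αᵢ`: if `⟨γ, αᵢ^∨⟩ > 0`, then `αᵢ`
can be subtracted that many times along the root string, and otherwise `γ` increases. -/
lemma map_imag_sub_reflection_nonpos (hw : (latticeModel hθ hl).IsFib i₀ w) {i : b.support}
    (hi : i.1 ∉ inversionRoots hθ hl w)
    (hsub : ∀ γ ∈ inversionRoots hθ hl w, ∀ δ : H.root,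
        (rootSystem H).root δ = (rootSystem H).root γ - (rootSystem H).root i →
          δ ∈ inversionRoots hθ hl w) {γ : H.root} (hγ : γ ∈ inversionRoots hθ hl w) :
    w ((latticeModel hθ hl).imag - (latticeModel hθ hl).s (some i) (vec b γ)) ≤ 0 := by
  set D := latticeModel hθ hl with hD
  set n := (rootSystem H).pairingIn ℤ γ i with hn
  have hs : D.s (some i) (vec b γ) = vec b γ - n • AffineSystem.sr (some i) := by
    rw [D.s_apply, co_some_latticeModel, toRootSpan_vec]
    rfl
  rcases le_or_gt n 0 with h0 | h0
  · have h1 : w (D.imag - D.s (some i) (vec b γ)) =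
        w (D.imag - vec b γ) + n • w (AffineSystem.sr (some i)) := by
      rw [hs, ← map_smul, ← map_add]
      congr 1
      abel
    rw [h1]
    exact add_nonpos hγ.2 (smul_nonpos_of_nonpos_of_nonneg h0 (hw.nonneg i))
  · have hne : i.1 ≠ γ := fun h ↦ hi (h ▸ hγ)
    have hne' : (rootSystem H).root i ≠ -(rootSystem H).root γ := by
      intro h
      rw [← (rootSystem H).reflection_apply_self, ← (rootSystem H).root_reflectionPerm] at h
      have h1 := vec_simple b i
      rw [(rootSystem H).root.injective h, vec_neg] at h1
      have h2 := (isPos_iff_vec_nonneg b γ).mp hγ.1 (some i)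
      have h3 := congrFun h1 (some i)
      rw [Pi.neg_apply, Pi.single_eq_same] at h3
      change 0 ≤ vec b γ (some i) at h2
      lia
    have hlin := RootPairing.IsReduced.linearIndependent (P := rootSystem H) hne hne'
    have key : ∀ k : ℕ, (k : ℤ) ≤ n → ∃ δ ∈ inversionRoots hθ hl w,
        (rootSystem H).root δ = (rootSystem H).root γ - k • (rootSystem H).root i := by
      intro k
      induction k with
      | zero => exact fun _ ↦ ⟨γ, hγ, by simp⟩
      | succ k ih =>
        intro hk
        obtain ⟨δ, hδ, hδe⟩ := ih (by push_cast at hk; lia)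
        have hchain : k + 1 ≤ (rootSystem H).chainBotCoeff i γ := by
          have := RootPairing.chainBotCoeff_sub_chainTopCoeff hlin
          lia
        obtain ⟨ε, hε⟩ :=
          (RootPairing.root_sub_nsmul_mem_range_iff_le_chainBotCoeff hlin).mpr hchain
        refine ⟨ε, hsub δ hδ ε ?_, hε⟩
        rw [hε, hδe, succ_nsmul]
        abel
    obtain ⟨δ, hδ, hδe⟩ := key n.toNat (by lia)
    have h1 : vec b δ = D.s (some i) (vec b γ) := by
      rw [hs, vec_eq_add b (i := γ) (j := i.1) (n := -n), vec_simple, neg_smul, sub_eq_add_neg]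
      rw [hδe, neg_smul, ← sub_eq_add_neg, ← natCast_zsmul, Int.toNat_of_nonneg h0.le]
    rw [← h1]
    exact hδ.2

/-- The simple roots of the standard Levi subalgebra of the normaliser of an abelian ideal are the
simple roots that the corresponding element of the affine Weyl group takes to affine simple
roots. -/
lemma leviSimpleRoots_normalizer (hw : (latticeModel hθ hl).IsFib i₀ w) {𝔞 : LieSubalgebra K L}
    (h𝔞 : IsAbelianIdeal b 𝔞) (hroots : rootsOf b 𝔞 = inversionRoots hθ hl w) :
    leviSimpleRoots b 𝔞.normalizer = {x | ∃ i : b.support,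
      (∃ s, w (AffineSystem.sr (some i)) = AffineSystem.sr s) ∧ x = (rootSystem H).root i} := by
  set D := latticeModel hθ hl with hD
  have hvec : ∀ i : b.support, vec b i = AffineSystem.sr (some i) := fun i ↦ vec_simple b i
  have key : ∀ i : b.support, (rootSpace H (-(i.1.1 : H → K))).toSubmodule ≤
      𝔞.normalizer.toSubmodule ↔ ∃ s, w (AffineSystem.sr (some i)) = AffineSystem.sr s := by
    intro i
    rw [h𝔞.rootSpace_neg_le_normalizer_iff, hroots]
    constructor
    · rintro ⟨h1, h2⟩
      refine hw.exists_map_simple ?_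
      rintro _ ⟨γ, rfl⟩ hγ
      exact map_imag_sub_reflection_nonpos hw h1 h2 (mem_inversionRoots_of_nonpos hw hγ)
    · rintro ⟨s, hs⟩
      refine ⟨fun h ↦ hw.not_simple_mem hs (by rw [← hvec]; exact h.2), fun γ hγ δ hδ ↦ ?_⟩
      have h1 : vec b δ = vec b γ - AffineSystem.sr (some i) := by
        rw [vec_eq_add b (i := γ) (j := i.1) (n := -1), hvec, neg_one_smul, sub_eq_add_neg]
        rw [hδ, neg_one_smul, sub_eq_add_neg]
      apply mem_inversionRoots_of_nonpos hw
      rw [h1]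
      exact hw.sub_mem hs hγ.2 ⟨δ, h1⟩
  ext x
  constructor
  · rintro ⟨γ, hγ, -, hneg, rfl⟩
    exact ⟨⟨γ, hγ⟩, (key ⟨γ, hγ⟩).mp hneg, rfl⟩
  · rintro ⟨i, hi, rfl⟩
    exact ⟨i, i.2, h𝔞.rootSpace_le_normalizer (RootPairing.Base.isPos_of_mem_support i.2),
      (key i).mpr hi, rfl⟩

end LieTheory

/-! ### Sets of simple roots in the lattice model -/

section RootPairing

variable {ι K M N : Type*} [Fintype ι] [DecidableEq ι] [Field K] [CharZero K] [AddCommGroup M]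
  [Module K M] [AddCommGroup N] [Module K N] {P : RootPairing ι K M N} [P.IsCrystallographic]
  {b : P.Base} {θ : ι}

open AffineSystem

/-- The simple roots whose index satisfies a predicate, as vectors. -/
def simpleRootsOf (b : P.Base) (p : b.support → Prop) : Set M :=
  {x | ∃ i : b.support, p i ∧ x = P.root i}

lemma simpleRootsOf_congr {p q : b.support → Prop} (h : ∀ i, p i ↔ q i) :
    simpleRootsOf b p = simpleRootsOf b q := by rw [funext fun i ↦ propext (h i)]

lemma simpleRootsOf_union (p q : b.support → Prop) :
    simpleRootsOf b p ∪ simpleRootsOf b q = simpleRootsOf b fun i ↦ p i ∨ q i := by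
  ext x
  constructor
  · rintro (⟨i, hi, hx⟩ | ⟨i, hi, hx⟩)
    · exact ⟨i, Or.inl hi, hx⟩
    · exact ⟨i, Or.inr hi, hx⟩
  · rintro ⟨i, hi | hi, hx⟩
    · exact Or.inl ⟨i, hi, hx⟩
    · exact Or.inr ⟨i, hi, hx⟩

lemma disjoint_simpleRootsOf {p q : b.support → Prop} (h : ∀ i, p i → ¬ q i) :
    Disjoint (simpleRootsOf b p) (simpleRootsOf b q) := by
  rw [Set.disjoint_left]
  rintro _ ⟨i, hi, rfl⟩ ⟨j, hj, hij⟩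
  rw [Subtype.ext (P.root.injective hij)] at hi
  exact h j hi hj

variable (hθ : IsHighestRoot b θ) (hl : IsLong P θ)

lemma form_sr_sr_eq_zero_iff (i j : b.support) :
    (latticeModel hθ hl).form (sr (some i)) (sr (some j)) = 0 ↔
      ip P (P.root i) (P.root j) = 0 := by
  rw [← form_vec_eq_zero_iff hθ hl, vec_simple, vec_simple]

lemma form_sr_top_eq_zero_iff (i : b.support) :
    (latticeModel hθ hl).form (sr (some i)) (latticeModel hθ hl).top = 0 ↔
      ip P (P.root i) (P.root θ) = 0 := by
  rw [← form_vec_eq_zero_iff hθ hl, vec_simple, top_latticeModel]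

lemma simpleRoots_inter_nonOrthogonal : simpleRoots b ∩ nonOrthogonal b θ =
    simpleRootsOf b fun i ↦
      (latticeModel hθ hl).form (sr (some i)) (latticeModel hθ hl).top ≠ 0 := by
  ext x
  constructor
  · rintro ⟨⟨i, hi, rfl⟩, γ, -, hγ, hx⟩
    refine ⟨⟨i, hi⟩, ?_, rfl⟩
    rw [← hx] at hγ
    exact (form_sr_top_eq_zero_iff hθ hl _).not.mpr hγ
  · rintro ⟨i, hi, rfl⟩
    exact ⟨⟨i, i.2, rfl⟩, i, RootPairing.Base.isPos_of_mem_support i.2,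
      (form_sr_top_eq_zero_iff hθ hl _).not.mp hi, rfl⟩

/-- The set of all `u⁻¹ β`, for `β` simple and orthogonal to the rootlet, consists of the simple roots
orthogonal to `θ` that the shortest element takes to simple roots. -/
lemma transported_eq {i₀ : b.support} {u : M ≃ₗ[K] M}
    {v : (Option b.support → ℤ) ≃ₗ[ℤ] (Option b.support → ℤ)}
    (hv : (latticeModel hθ hl).IsShort i₀ v)
    (huv : ∀ x, (toRootSpan b θ (v x) : M) = u (toRootSpan b θ x)) :
    transported b i₀ u = simpleRootsOf b fun i ↦
      (latticeModel hθ hl).form (sr (some i)) (latticeModel hθ hl).top = 0 ∧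
        ∃ j : b.support, v (sr (some i)) = sr (some j) := by
  have hu : ∀ i j : b.support, v (sr (some i)) = sr (some j) → u.symm (P.root j) = P.root i := by
    intro i j h
    have h1 := huv (sr (some i))
    rw [h, toRootSpan_single_some, toRootSpan_single_some] at h1
    rw [LinearEquiv.symm_apply_eq]
    exact h1
  ext x
  constructor
  · rintro ⟨β, hβ, horth, rfl⟩
    obtain ⟨i, hi, hi'⟩ := hv.inv_simple (j := ⟨β, hβ⟩)
      ((form_sr_sr_eq_zero_iff hθ hl ⟨β, hβ⟩ i₀).mpr horth)
    have h1 := (inv_apply_eq.mp hi).symm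
    exact ⟨i, ⟨hi', _, h1⟩, hu i ⟨β, hβ⟩ h1⟩
  · rintro ⟨i, ⟨horth, j, hj⟩, rfl⟩
    refine ⟨j, j.2, (form_sr_sr_eq_zero_iff hθ hl j i₀).mp ?_, (hu i j hj).symm⟩
    rw [← hj, hv.form_map, horth]

end RootPairing

end AbIdeal

namespace AbIdeal

/-! ### The simple roots of the Levi subalgebras -/

namespace AffineSystem

variable {S : Type*} [Fintype S] [DecidableEq S] {D : AffineSystem S} {i₀ : S}
  {v w : (Option S → ℤ) ≃ₗ[ℤ] (Option S → ℤ)}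

/-- If the rootlet is orthogonal to the highest root, then the smallest element of the fibre takes
exactly those simple roots to affine simple roots that are orthogonal to the highest root and that
the shortest element takes to simple roots. -/
lemma IsShort.exists_map_simple_iff (hv : D.IsShort i₀ v)
    (horth : D.form (sr (some i₀)) D.top = 0) (i : S) :
    (∃ s, (v * D.s none) (sr (some i)) = sr s) ↔
      D.form (sr (some i)) D.top = 0 ∧ ∃ j : S, v (sr (some i)) = sr (some j) := by
  constructor
  · rintro ⟨s, hs⟩
    have h : D.form (sr (some i)) D.top = 0 := by
      by_contra h
      exact hv.not_map_simple horth h ⟨s, hs⟩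
    exact ⟨h, hv.isFib.map_simple_of_map hv h hs⟩
  · rintro ⟨h, j, hj⟩
    exact ⟨some j, by rw [mul_s_none_apply h, hj]⟩

/-- The largest element of the fibre takes all simple roots that are not orthogonal to the highest
root to affine simple roots. The last hypothesis holds unless the rootlet is an end of a diagram of
type `A`: in this type two simple roots are not orthogonal to the highest root. -/
lemma IsMax.exists_map_simple_iff (hw : D.IsMax i₀ w) (hv : D.IsShort i₀ v)
    (hne : D.top ≠ sr (some i₀))
    (htwo : ∀ i i', i ≠ i' → D.form (sr (some i)) D.top ≠ 0 → D.form (sr (some i')) D.top ≠ 0 →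
      D.form (sr (some i₀)) D.top = 0 ∧ ∀ t, D.imag t = 1) (i : S) :
    (∃ s, w (sr (some i)) = sr s) ↔ D.form (sr (some i)) D.top ≠ 0 ∨
      D.form (sr (some i)) D.top = 0 ∧ ∃ j : S, v (sr (some i)) = sr (some j) := by
  constructor
  · rintro ⟨s, hs⟩
    by_cases h : D.form (sr (some i)) D.top = 0
    · exact Or.inr ⟨h, hw.isFib.map_simple_of_map hv h hs⟩
    · exact Or.inl h
  · rintro (h | ⟨h, j, hj⟩)
    · obtain ⟨i', s, hs, h'⟩ := hw.exists_map_simple hv hne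
      by_cases hii : i' = i
      · exact ⟨s, by rw [← hii]; exact hs⟩
      · obtain ⟨horth, hone⟩ := htwo i' i hii h' h
        obtain ⟨k, k', hk, ⟨hks, hk0⟩, hks', hk0'⟩ := hw.exists_two_map_simple hv horth hone
        rcases eq_or_eq_of_form_ne hk hk0 hk0' h with rfl | rfl
        · exact hks
        · exact hks'
    · exact hw.map_simple hv h hj

/-- If the rootlet is the only simple root that is not orthogonal to the highest root, then the
fibre consists of one element, which takes the rootlet and the simple roots orthogonal to it to
affine simple roots. -/
lemma IsShort.exists_map_simple_iff_of_single (hv : D.IsShort i₀ v)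
    (hne : D.top ≠ sr (some i₀)) (h₀ : D.form (sr (some i₀)) D.top ≠ 0)
    (hsingle : ∀ i, D.form (sr (some i)) D.top ≠ 0 → i = i₀) (i : S) :
    (∃ s, (v * D.s none) (sr (some i)) = sr s) ↔
      i = i₀ ∨ D.form (sr (some i)) (sr (some i₀)) = 0 := by
  obtain ⟨w, hw⟩ := exists_isMax hv
  obtain ⟨k, s, hs, hk⟩ := hw.exists_map_simple hv hne
  obtain rfl := hsingle k hk
  rw [hw.isFib.eq_of_not_orthogonal hv h₀] at hs
  have hmap := (hv.map_simple_of_ne h₀ hs).2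
  constructor
  · rintro ⟨t, ht⟩
    refine or_iff_not_imp_left.mpr fun hi ↦ (hv.map_simple_iff hsingle hmap i).mp ?_
    have h : D.form (sr (some i)) D.top = 0 := by
      by_contra h
      exact hi (hsingle i h)
    exact ⟨h, hv.isFib.map_simple_of_map hv h ht⟩
  · rintro (rfl | h)
    · exact ⟨s, hs⟩
    · obtain ⟨h1, j, hj⟩ := (hv.map_simple_iff hsingle hmap i).mpr h
      exact ⟨some j, by rw [mul_s_none_apply h1, hj]⟩

end AffineSystem

section RootPairing

variable {ι K M N : Type*} [Fintype ι] [DecidableEq ι] [Field K] [CharZero K] [AddCommGroup M]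
  [Module K M] [AddCommGroup N] [Module K N] {P : RootPairing ι K M N} [P.IsCrystallographic]
  {b : P.Base} {θ : ι}

open AffineSystem

variable (hθ : IsHighestRoot b θ) (hl : IsLong P θ)

lemma top_ne_sr {i₀ : b.support} (h : θ ≠ i₀) :
    (latticeModel hθ hl).top ≠ sr (some i₀) := by
  rw [top_latticeModel]
  exact fun h1 ↦ h (vec_injective (b := b) (h1.trans (vec_simple b i₀).symm))

/-- If the highest root is a fundamental weight, then a simple root that is not orthogonal to it is
the only one, and it differs from the highest root. -/
lemma IsFundamental.ne_and_eq_of_form_ne (h : IsFundamental b θ) {i₀ : b.support}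
    (h₀ : ip P (P.root i₀) (P.root θ) ≠ 0) :
    θ ≠ i₀ ∧ ∀ i : b.support,
      (latticeModel hθ hl).form (sr (some i)) (latticeModel hθ hl).top ≠ 0 → i = i₀ := by
  obtain ⟨k, hk, hk1, hk0⟩ := h
  have key : ∀ i : b.support, ip P (P.root i) (P.root θ) ≠ 0 → i.1 = k := by
    intro i hi
    by_contra hne
    have h1 : P.pairing i θ = 0 := P.pairing_eq_zero_iff.mp (hk0 i i.2 hne)
    exact hi (P.toInvariantForm.apply_root_root_zero_iff i θ |>.mpr h1)
  refine ⟨fun h ↦ ?_, fun i hi ↦ Subtype.ext ?_⟩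
  · rw [← key i₀ h₀, h, P.pairing_same] at hk1
    norm_num at hk1
  · rw [key i₀ h₀, key i ((form_sr_top_eq_zero_iff hθ hl i).not.mp hi)]

lemma singleton_root_eq (i₀ : b.support) : {P.root i₀} = simpleRootsOf b fun i ↦ i = i₀ := by
  ext x
  constructor
  · rintro rfl
    exact ⟨i₀, rfl, rfl⟩
  · rintro ⟨_, rfl, rfl⟩
    rfl

lemma simpleRoots_orthogonal_eq (i₀ : b.support) :
    {x | ∃ β ∈ b.support, ip P (P.root β) (P.root i₀) = 0 ∧ x = P.root β} =
      simpleRootsOf b fun i ↦ (latticeModel hθ hl).form (sr (some i)) (sr (some i₀)) = 0 := by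
  ext x
  constructor
  · rintro ⟨β, hβ, h, rfl⟩
    exact ⟨⟨β, hβ⟩, (form_sr_sr_eq_zero_iff hθ hl _ _).mpr h, rfl⟩
  · rintro ⟨i, hi, rfl⟩
    exact ⟨i, i.2, (form_sr_sr_eq_zero_iff hθ hl _ _).mp hi, rfl⟩

/-- The case of a fundamental highest root: the simple roots taken to affine simple roots by the
only element of the fibre. -/
lemma IsFundamental.simpleRootsOf_eq (h : IsFundamental b θ) {i₀ : b.support}
    (h₀ : ip P (P.root i₀) (P.root θ) ≠ 0) {v : (Option b.support → ℤ) ≃ₗ[ℤ] (Option b.support → ℤ)}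
    (hv : (latticeModel hθ hl).IsShort i₀ v) :
    simpleRootsOf b (fun i ↦ ∃ s, (v * (latticeModel hθ hl).s none) (sr (some i)) = sr s) =
        {P.root i₀} ∪ {x | ∃ β ∈ b.support, ip P (P.root β) (P.root i₀) = 0 ∧ x = P.root β} ∧
      Disjoint {P.root i₀}
        {x | ∃ β ∈ b.support, ip P (P.root β) (P.root i₀) = 0 ∧ x = P.root β} := by
  obtain ⟨hne, hsingle⟩ := h.ne_and_eq_of_form_ne hθ hl h₀
  rw [simpleRoots_orthogonal_eq hθ hl, singleton_root_eq, simpleRootsOf_union]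
  refine ⟨simpleRootsOf_congr (hv.exists_map_simple_iff_of_single (top_ne_sr hθ hl hne)
    ((form_sr_top_eq_zero_iff hθ hl i₀).not.mpr h₀) hsingle), disjoint_simpleRootsOf ?_⟩
  rintro _ rfl
  exact ((latticeModel hθ hl).form_self_pos (sr_mem_roots _ _)).ne'

end RootPairing

end AbIdeal

set_option maxHeartbeats 400000 in
open AbIdeal AbIdeal.AffineSystem in
theorem theorem3p7 {L : Type*} [LieRing L] [LieAlgebra ℂ L] [FiniteDimensional ℂ L]
    [LieAlgebra.IsSimple ℂ L] (H : LieSubalgebra ℂ L) [H.IsCartanSubalgebra]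
    (b : (rootSystem H).Base) (θ : H.root) (hθ : AbIdeal.IsHighestRoot b θ)
    (α : H.root) (hα : α ∈ b.support) (hlong : AbIdeal.IsLong (rootSystem H) α) :
    (∃ w, AbIdeal.IsShortestTo b θ α w) ∧
    (∃ 𝔞, IsLeast (AbIdeal.fibre b θ α) 𝔞) ∧
    (∃ 𝔞, IsGreatest (AbIdeal.fibre b θ α) 𝔞) ∧
    ∀ (w : Dual ℂ H ≃ₗ[ℂ] Dual ℂ H) (𝔞min 𝔞max : LieSubalgebra ℂ L),
      AbIdeal.IsShortestTo b θ α w →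
      IsLeast (AbIdeal.fibre b θ α) 𝔞min →
      IsGreatest (AbIdeal.fibre b θ α) 𝔞max →
      -- (i)
      (¬ AbIdeal.IsEndOfTypeA b α →
        AbIdeal.leviSimpleRoots b 𝔞max.normalizer =
            (AbIdeal.simpleRoots b ∩ AbIdeal.nonOrthogonal b θ) ∪ AbIdeal.transported b α w ∧
          Disjoint (AbIdeal.simpleRoots b ∩ AbIdeal.nonOrthogonal b θ)
            (AbIdeal.transported b α w)) ∧
      -- (ii)
      (AbIdeal.ip (rootSystem H) ((rootSystem H).root θ) ((rootSystem H).root α) = 0 →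
        AbIdeal.leviSimpleRoots b 𝔞max.normalizer =
            (AbIdeal.simpleRoots b ∩ AbIdeal.nonOrthogonal b θ) ∪
              AbIdeal.leviSimpleRoots b 𝔞min.normalizer ∧
          Disjoint (AbIdeal.simpleRoots b ∩ AbIdeal.nonOrthogonal b θ)
            (AbIdeal.leviSimpleRoots b 𝔞min.normalizer)) ∧
      -- (iii)
      (AbIdeal.IsFundamental b θ →
        AbIdeal.ip (rootSystem H) ((rootSystem H).root θ) ((rootSystem H).root α) ≠ 0 →
        AbIdeal.leviSimpleRoots b 𝔞max.normalizer = AbIdeal.leviSimpleRoots b 𝔞min.normalizer ∧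
          AbIdeal.leviSimpleRoots b 𝔞min.normalizer =
            {(rootSystem H).root α} ∪
              {x | ∃ β ∈ b.support, AbIdeal.ip (rootSystem H) ((rootSystem H).root β)
                ((rootSystem H).root α) = 0 ∧ x = (rootSystem H).root β} ∧
          Disjoint ({(rootSystem H).root α} : Set (Dual ℂ H))
            {x | ∃ β ∈ b.support, AbIdeal.ip (rootSystem H) ((rootSystem H).root β)
              ((rootSystem H).root α) = 0 ∧ x = (rootSystem H).root β}) := by
  classical
  obtain ⟨hl, hweyl⟩ := exists_weyl_map_highest hθ hlong
  obtain ⟨w₀, hw₀⟩ := exists_isShortestTo hweyl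
  let i₀ : b.support := ⟨α, hα⟩
  set D := latticeModel hθ hl with hD
  obtain ⟨v, hv, -⟩ := IsShortestTo.exists_isShort (i₀ := i₀) hθ hl hw₀
  obtain ⟨m, hm⟩ := exists_isMax hv
  obtain ⟨𝔞₁, h𝔞₁, hroots₁⟩ := exists_mem_fibre hv.isFib
  obtain ⟨𝔞₂, h𝔞₂, hroots₂⟩ := exists_mem_fibre hm.isFib
  have hleast := isLeast_fibre
    (fun w' hw' x hx hx0 h ↦ hw'.map_nonpos_of_short hv hx hx0 h) h𝔞₁ hroots₁
  have hgreatest := isGreatest_fibre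
    (fun w' hw' x hx hx0 h ↦ hm.map_nonpos hv hw' hx hx0 h) h𝔞₂ hroots₂
  refine ⟨⟨w₀, hw₀⟩, ⟨𝔞₁, hleast⟩, ⟨𝔞₂, hgreatest⟩, fun w 𝔞min 𝔞max hw hmin hmax ↦ ?_⟩
  obtain rfl := hmin.unique hleast
  obtain rfl := hmax.unique hgreatest
  have hmin' : leviSimpleRoots b 𝔞min.normalizer = simpleRootsOf b _ :=
    leviSimpleRoots_normalizer hv.isFib h𝔞₁.1 hroots₁
  have hmax' : leviSimpleRoots b 𝔞max.normalizer = simpleRootsOf b _ :=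
    leviSimpleRoots_normalizer hm.isFib h𝔞₂.1 hroots₂
  have hip : ip (rootSystem H) ((rootSystem H).root θ) ((rootSystem H).root α) = 0 ↔
      D.form (sr (some i₀)) D.top = 0 := by
    rw [form_sr_top_eq_zero_iff]
    exact (rootSystem H).toInvariantForm.symm.eq_iff
  rw [hmin', hmax', simpleRoots_inter_nonOrthogonal hθ hl]
  refine ⟨fun hend ↦ ?_, fun horth ↦ ?_, fun hfund hnorth ↦ ?_⟩
  · obtain ⟨v', hv', hwv⟩ := IsShortestTo.exists_isShort (i₀ := i₀) hθ hl hw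
    obtain rfl := hv'.unique hv
    have hne : D.top ≠ sr (some i₀) := top_ne_sr hθ hl fun h ↦
      hend (by rw [← show θ = α from h]; exact isEndOfTypeA_of_highest hθ (h ▸ hα))
    have htrans := transported_eq hθ hl hv hwv
    change transported b α w = _ at htrans
    rw [htrans, simpleRootsOf_union]
    refine ⟨simpleRootsOf_congr (hm.exists_map_simple_iff hv hne fun i i' hii hi hi' ↦ ?_),
      disjoint_simpleRootsOf fun i hi hi' ↦ hi hi'.1⟩
    refine ⟨?_, (isEndOfTypeA_of_form_ne hθ hl hii hi hi').2⟩
    -- otherwise the rootlet is one of two simple roots not orthogonal to the highest root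
    by_contra h₀
    rcases eq_or_ne i₀ i with rfl | h
    · exact hend (isEndOfTypeA_of_form_ne hθ hl hii hi hi').1
    · exact hend (isEndOfTypeA_of_form_ne hθ hl h h₀ hi).1
  · rw [hip] at horth
    have hne : D.top ≠ sr (some i₀) := by
      intro h
      rw [← h] at horth
      exact D.form_top_pos.ne' horth
    rw [simpleRootsOf_congr (hv.exists_map_simple_iff horth), simpleRootsOf_union]
    exact ⟨simpleRootsOf_congr (hm.exists_map_simple_iff hv hne fun i i' hii hi hi' ↦
      ⟨horth, (isEndOfTypeA_of_form_ne hθ hl hii hi hi').2⟩),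
      disjoint_simpleRootsOf fun i hi hi' ↦ hi hi'.1⟩
  · rw [Ne, hip] at hnorth
    have h := hfund.simpleRootsOf_eq hθ hl ((form_sr_top_eq_zero_iff hθ hl i₀).not.mp hnorth) hv
    rw [hm.isFib.eq_of_not_orthogonal hv hnorth]
    exact ⟨rfl, h⟩
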